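/- Let $d\ge 1$, let $\mathbb T^d=\mathbb R^d/\mathbb Z^d$ be the $d$-dimensional torus, identified with $[0,1)^d$ (functions on $\mathbb T^d$ being regarded as $\mathbb Z^d$-periodic functions on $\mathbb R^d$), let $\mathcal Y^d=[0,1)^d$, let $P\in\mathbb R^d$, and let $V:\mathbb T^d\times\mathbb R^d\to\mathbb R$ be smooth and $\mathcal Y^d$-periodic in its second variable. Let $\epsilon$ range over a sequence of positive numbers converging to $0$ and, for each such $\epsilon$, let $(u_\epsilon,m_\epsilon,\overline H_\epsilon(P))\in C^\infty(\mathbb T^d)\times C^\infty(\mathbb T^d)\times\mathbb R$ with $m_\epsilon>0$ solve $$\begin{cases}\frac{|P+\nabla u_\epsilon(x)|^2}{2}+V\big(x,\frac{x}{\epsilon}\big)=\ln m_\epsilon(x)+\overline H_\epsilon(P)&\text{in }\mathbb T^d,\\ -\operatorname{div}\big(m_\epsilon(x)(P+\nabla u_\epsilon(x))\big)=0&\text{in }\mathbb T^d,\\ \int_{\mathbb T^d}u_\epsilon\,dx=0,\quad\int_{\mathbb T^d}m_\epsilon\,dx=1.\end{cases}$$ Let $q\in[1,\infty)$. Let $C^\infty_\#(\mathcal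 Y^d)$ be the set of smooth $\mathcal Y^d$-periodic functions on $\mathbb R^d$ and $W^{1,q}_\#(\mathcal Y^d)$ its closure in the $W^{1,q}(\mathcal Y^d)$-norm. For $r\in[1,\infty]$, a sequence $(w_\epsilon)_\epsilon$ in $L^r(\mathbb T^d)$ is said to (weakly) two-scale converge to $w\in L^r(\mathbb T^d\times\mathcal Y^d)$ in $L^r(\mathbb T^d\times\mathcal Y^d)$, written $w_\epsilon\overset{2}{\rightharpoonup}w$, if for all $\psi\in C^\infty(\mathbb T^d;C^\infty_\#(\mathcal Y^d))$ $$\lim_{\epsilon\to0}\int_{\mathbb T^d}w_\epsilon(x)\,\psi\Big(x,\frac x\epsilon\Big)dx=\int_{\mathbb T^d}\int_{\mathcal Y^d}w(x,y)\,\psi(x,y)\,dy\,dx;$$ for vector-valued sequences this is understood componentwise. Then there exist $\alpha\in(0,1)$, $u_0\in C^{0,\alpha}(\mathbb T^d)\cap W^{1,q}(\mathbb T^d)$ with $\int_{\mathbb T^d}u_0\,dx=0$, $u_1\in L^q(\mathbb T^d;W^{1,q}_\#(\mathcal Y^d)/\mathbb R)$, $m\in L^1(\mathbb T^d\times\mathcal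 Y^d)$ with $\int_{\mathbb T^d}\int_{\mathcal Y^d}m(x,y)\,dy\,dx=1$, and $\overline H(P)\in\mathbb R$ such that, along a common subsequence of $\epsilon\to0$, $$u_\epsilon\to u_0\ \text{in }L^\infty(\mathbb T^d),\qquad u_\epsilon\rightharpoonup u_0\ \text{weakly in }W^{1,q}(\mathbb T^d),$$ $$\nabla u_\epsilon\overset{2}{\rightharpoonup}\nabla u_0+\nabla_yu_1\ \text{in }[L^q(\mathbb T^d\times\mathcal Y^d)]^d,$$ $$m_\epsilon\overset{2}{\rightharpoonup}m\ \text{in }L^1(\mathbb T^d\times\mathcal Y^d),\qquad m_\epsilon\rightharpoonup\int_{\mathcal Y^d}m(\cdot,y)\,dy\ \text{weakly in }L^1(\mathbb T^d),$$ $$\overline H_\epsilon(P)\to\overline H(P)\ \text{in }\mathbb R.$$ -/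

import Mathlib

open MeasureTheory Filter Topology
open scoped ENNReal NNReal ContDiff

noncomputable section

namespace TwoScaleMFG

/-- `ℝ^d` with its Euclidean norm. Functions on the torus `𝕋^d = ℝ^d / ℤ^d` are regarded as
`ℤ^d`-periodic functions on `ℝ^d`. -/
abbrev Euc (d : ℕ) := EuclideanSpace ℝ (Fin d)

/-- The cell `[0,1)^d`. It is both the reference cell `𝒴^d` and the fundamental domain
used for integration over `𝕋^d`. -/
def cell (d : ℕ) : Set (Euc d) := {x | ∀ i, x i ∈ Set.Ico (0 : ℝ) 1}

/-- Lebesgue measure on the unit cell. -/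
def cellVol (d : ℕ) : Measure (Euc d) := volume.restrict (cell d)

/-- `ℤ^d`-periodicity. -/
def IsPeriodic {d : ℕ} {β : Type*} (f : Euc d → β) : Prop :=
  ∀ (i : Fin d) (x : Euc d), f (x + EuclideanSpace.single i 1) = f x

/-- Smooth `ℤ^d`-periodic functions: `C^∞(𝕋^d)`, equivalently `C^∞_#(𝒴^d)`. -/
structure SmoothPeriodic {d : ℕ} (f : Euc d → ℝ) : Prop where
  smooth : ContDiff ℝ ∞ f
  periodic : IsPeriodic f

/-- Functions of `(x, y)` that are smooth and periodic in each of the two variables: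
`C^∞(𝕋^d; C^∞_#(𝒴^d))`. -/
structure SmoothPeriodic₂ {d : ℕ} (ψ : Euc d × Euc d → ℝ) : Prop where
  smooth : ContDiff ℝ ∞ ψ
  periodic_fst : ∀ y, IsPeriodic fun x => ψ (x, y)
  periodic_snd : ∀ x, IsPeriodic fun y => ψ (x, y)

/-- Divergence of a vector field on `ℝ^d`. -/
def divergence {d : ℕ} (F : Euc d → Euc d) (x : Euc d) : ℝ :=
  ∑ i, fderiv ℝ (fun z => F z i) x (EuclideanSpace.single i 1)

/-- `(u, m, H)` is a smooth solution, with `m > 0`, of the mean-field game on the torus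
`|P + ∇u|²/2 + V(x, x/ε) = ln m + H`, `-div (m (P + ∇u)) = 0`, `∫ u = 0`, `∫ m = 1`.
The first equation is imposed on the fundamental domain `[0,1)^d`, since `x/ε` depends on the
representative of a point of the torus when `1/ε` is not an integer. -/
structure SolvesMFG {d : ℕ} (V : Euc d × Euc d → ℝ) (P : Euc d) (ε : ℝ)
    (u m : Euc d → ℝ) (H : ℝ) : Prop where
  smooth_u : SmoothPeriodic u
  smooth_m : SmoothPeriodic m
  m_pos : ∀ x, 0 < m x
  hamilton_jacobi : ∀ x ∈ cell d,
    ‖P + gradient u x‖ ^ 2 / 2 + V (x, ε⁻¹ • x) = Real.log (m x) + H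
  fokker_planck : ∀ x, -divergence (fun z => m z • (P + gradient u z)) x = 0
  integral_u : ∫ x, u x ∂cellVol d = 0
  integral_m : ∫ x, m x ∂cellVol d = 1

/-- `u ∈ W^{1,q}(𝕋^d)` with weak gradient `g`. -/
structure MemSobolev {d : ℕ} (q : ℝ≥0∞) (u : Euc d → ℝ) (g : Euc d → Euc d) : Prop where
  memLp : MemLp u q (cellVol d)
  memLp_grad : MemLp g q (cellVol d)
  weak_grad : ∀ φ : Euc d → ℝ, SmoothPeriodic φ → ∀ i,
    ∫ x, u x * gradient φ x i ∂cellVol d = -∫ x, g x i * φ x ∂cellVol d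

/-- `w ∈ W^{1,q}_#(𝒴^d)` with gradient `G`: the pair `(w, G)` lies in the closure of
`{(φ, ∇φ) : φ ∈ C^∞_#(𝒴^d)}` with respect to the `W^{1,q}(𝒴^d)`-norm. -/
structure MemSobolevPer {d : ℕ} (q : ℝ≥0∞) (w : Euc d → ℝ) (G : Euc d → Euc d) : Prop where
  memLp : MemLp w q (cellVol d)
  memLp_grad : MemLp G q (cellVol d)
  approx : ∃ φ : ℕ → Euc d → ℝ, (∀ n, SmoothPeriodic (φ n)) ∧
    Tendsto (fun n => eLpNorm (fun y => φ n y - w y) q (cellVol d)) atTop (𝓝 0) ∧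
    Tendsto (fun n => eLpNorm (fun y => gradient (φ n) y - G y) q (cellVol d)) atTop (𝓝 0)

/-- `w ∈ L^q(𝕋^d; W^{1,q}_#(𝒴^d)/ℝ)` with `∇_y w = G`. The class of `w(x, ·)` modulo constants
is represented by its element of mean zero. -/
structure MemLpSobolevPer {d : ℕ} (q : ℝ≥0∞) (w : Euc d × Euc d → ℝ)
    (G : Euc d × Euc d → Euc d) : Prop where
  memLp : MemLp w q ((cellVol d).prod (cellVol d))
  memLp_grad : MemLp G q ((cellVol d).prod (cellVol d))
  sobolev : ∀ᵐ x ∂cellVol d, MemSobolevPer q (fun y => w (x, y)) (fun y => G (x, y))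
  mean_zero : ∀ᵐ x ∂cellVol d, ∫ y, w (x, y) ∂cellVol d = 0

/-- Weak convergence `f_n ⇀ f` in `L^q(𝕋^d)`, `1 ≤ q < ∞`: convergence of the pairings with
all functions in `L^{q'}(𝕋^d)`, `1/q + 1/q' = 1`. -/
structure WeakLp {d : ℕ} (q : ℝ≥0∞) (f : ℕ → Euc d → ℝ) (f₀ : Euc d → ℝ) : Prop where
  memLp : ∀ n, MemLp (f n) q (cellVol d)
  memLp_lim : MemLp f₀ q (cellVol d)
  tendsto : ∀ q' : ℝ≥0∞, q.HolderConjugate q' → ∀ g : Euc d → ℝ, MemLp g q' (cellVol d) →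
    Tendsto (fun n => ∫ x, f n x * g x ∂cellVol d) atTop (𝓝 (∫ x, f₀ x * g x ∂cellVol d))

/-- Weak convergence in `W^{1,q}(𝕋^d)` of smooth functions `u_n` to a function `u₀` with weak
gradient `g₀`: weak convergence in `L^q` of the functions and of their first derivatives. -/
structure WeakSobolev {d : ℕ} (q : ℝ≥0∞) (u : ℕ → Euc d → ℝ) (u₀ : Euc d → ℝ)
    (g₀ : Euc d → Euc d) : Prop where
  memSobolev : MemSobolev q u₀ g₀
  fn : WeakLp q u u₀
  grad : ∀ i, WeakLp q (fun n x => gradient (u n) x i) (fun x => g₀ x i)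

/-- Weak two-scale convergence of `w_n` (along the scales `ε_n`) to `w` in
`L^q(𝕋^d × 𝒴^d)`. -/
structure TwoScale {d : ℕ} (q : ℝ≥0∞) (ε : ℕ → ℝ) (w : ℕ → Euc d → ℝ)
    (w₀ : Euc d × Euc d → ℝ) : Prop where
  memLp : ∀ n, MemLp (w n) q (cellVol d)
  memLp_lim : MemLp w₀ q ((cellVol d).prod (cellVol d))
  tendsto : ∀ ψ : Euc d × Euc d → ℝ, SmoothPeriodic₂ ψ →
    Tendsto (fun n => ∫ x, w n x * ψ (x, (ε n)⁻¹ • x) ∂cellVol d) atTop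
      (𝓝 (∫ x, ∫ y, w₀ (x, y) * ψ (x, y) ∂cellVol d ∂cellVol d))

end TwoScaleMFG

end

open TwoScaleMFG

/-!
Testing the continuity equation with `u` and integrating the Hamilton–Jacobi equation against `m`
bounds the entropy `∫ m ln m` and `H` in terms of `P` and `sup |V|`; since
`m = exp (|P + ∇u|² / 2 + V - H)` has mass one, `∇u` is then bounded in every `L^p`, `p < ∞`.
Morrey's inequality and the Arzelà–Ascoli theorem give the uniform limit of `u`.

Sequences whose truncation errors are uniformly small in `L¹` (`m` by the entropy bound, `∂ᵢu` by
the `L²` bound) have two-scale limits: the Riesz representation theorem provides the limits of the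
truncated sequences, and these form a Cauchy sequence in `L¹`. The limit of `∇u` is curl-free in
the fast variable. A curl-free field of mean zero is mollified and integrated along rays, averaging
over the base point; the resulting potentials are periodic and converge to `u₁`.
-/

noncomputable section

namespace TwoScaleMFG

variable {d : ℕ}

/-! ### The torus and its fundamental cell -/

/-- The torus `𝕋^d` as a compact group. The cell `[0,1)^d` is a fundamental domain of the
projection `toTorus`, and periodic functions on `ℝ^d` factor through it. -/
abbrev Torus (d : ℕ) := UnitAddTorus (Fin d)

instance : IsProbabilityMeasure (volume : Measure UnitAddCircle) := ⟨UnitAddCircle.measure_univ⟩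

instance (d : ℕ) : IsProbabilityMeasure (volume : Measure (Torus d)) :=
  inferInstanceAs (IsProbabilityMeasure (Measure.pi fun _ => volume))

instance (d : ℕ) :
    ((volume : Measure (Torus d)).prod (volume : Measure (Torus d))).WeaklyRegular := by
  have : IsFiniteMeasure ((volume : Measure (Torus d)).prod (volume : Measure (Torus d))) :=
    inferInstance
  have : BorelSpace (Torus d × Torus d) := inferInstance
  have : TopologicalSpace.PseudoMetrizableSpace (Torus d × Torus d) := inferInstance
  infer_instance

instance : (volume : Measure (Torus d)).IsNegInvariant := by
  have : (volume : Measure (Torus d)).Regular := inferInstance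
  exact Measure.IsAddHaarMeasure.isNegInvariant_of_regular _

/-- The projection `ℝ^d → 𝕋^d`. -/
def toTorus (x : Euc d) : Torus d := fun i => (x i : UnitAddCircle)

theorem toTorus_add (x y : Euc d) : toTorus (x + y) = toTorus x + toTorus y := by
  ext i
  simp [toTorus]

theorem toTorus_sub (x y : Euc d) : toTorus (x - y) = toTorus x - toTorus y := by
  ext i
  simp [toTorus]

theorem isOpenQuotientMap_toTorus : IsOpenQuotientMap (toTorus : Euc d → Torus d) := by
  have hpi : IsOpenQuotientMap (Pi.map fun (_ : Fin d) (t : ℝ) => (t : UnitAddCircle)) :=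
    IsOpenQuotientMap.piMap fun _ => QuotientAddGroup.isOpenQuotientMap_mk
  exact hpi.comp (PiLp.homeomorph 2 fun _ : Fin d => ℝ).isOpenQuotientMap

@[fun_prop]
theorem continuous_toTorus : Continuous (toTorus : Euc d → Torus d) :=
  isOpenQuotientMap_toTorus.continuous

theorem measurable_toTorus : Measurable (toTorus : Euc d → Torus d) :=
  continuous_toTorus.measurable

theorem cell_eq_preimage_pi :
    cell d = WithLp.ofLp ⁻¹' (Set.univ.pi fun _ : Fin d => Set.Ico (0 : ℝ) 1) := by
  ext x
  simp [cell]

theorem measurableSet_cell : MeasurableSet (cell d) := by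
  rw [cell_eq_preimage_pi]
  exact (PiLp.volume_preserving_ofLp (Fin d)).measurable
    (MeasurableSet.univ_pi fun _ => measurableSet_Ico)

theorem ae_mem_cell : ∀ᵐ x ∂cellVol d, x ∈ cell d := ae_restrict_mem measurableSet_cell

theorem measurePreserving_toTorus :
    MeasurePreserving (toTorus : Euc d → Torus d) (cellVol d) volume := by
  have hcoord : MeasurePreserving (WithLp.ofLp : Euc d → Fin d → ℝ) (cellVol d)
      (Measure.pi fun _ => volume.restrict (Set.Ioc (0 : ℝ) (0 + 1))) := by
    have := (PiLp.volume_preserving_ofLp (Fin d)).restrict_preimage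
      (MeasurableSet.univ_pi fun _ : Fin d => measurableSet_Ico (a := (0 : ℝ)) (b := 1))
    rw [← cell_eq_preimage_pi, volume_pi, Measure.restrict_pi_pi] at this
    simp only [restrict_Ico_eq_restrict_Ioc] at this
    rw [zero_add]
    exact this
  exact (measurePreserving_pi (fun _ : Fin d => volume.restrict (Set.Ioc (0 : ℝ) (0 + 1)))
    (fun _ => (volume : Measure UnitAddCircle))
    fun _ => UnitAddCircle.measurePreserving_mk 0).comp hcoord

instance : IsProbabilityMeasure (cellVol d) :=
  ⟨by simpa using (measurePreserving_toTorus (d := d)).measure_preimage nullMeasurableSet_univ⟩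

theorem measurePreserving_toTorus_prod :
    MeasurePreserving (Prod.map toTorus toTorus : Euc d × Euc d → Torus d × Torus d)
      ((cellVol d).prod (cellVol d)) (volume.prod volume) :=
  measurePreserving_toTorus.prod measurePreserving_toTorus

theorem measurePreserving_toTorus_add (a : Torus d) :
    MeasurePreserving (fun x : Euc d => toTorus x + a) (cellVol d) volume :=
  (measurePreserving_add_right volume a).comp measurePreserving_toTorus

theorem measurePreserving_sub_toTorus (a : Torus d) :
    MeasurePreserving (fun x : Euc d => a - toTorus x) (cellVol d) volume :=
  (Measure.measurePreserving_sub_left volume a).comp measurePreserving_toTorus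

theorem integral_comp_measurePreserving {α β E : Type*}
    [MeasurableSpace α] [MeasurableSpace β] [NormedAddCommGroup E] [NormedSpace ℝ E]
    {μ : Measure α} {ν : Measure β} {φ : α → β} (hφ : MeasurePreserving φ μ ν) {f : β → E}
    (hf : AEStronglyMeasurable f ν) : ∫ x, f (φ x) ∂μ = ∫ y, f y ∂ν := by
  rw [← hφ.map_eq, integral_map hφ.aemeasurable (by rwa [hφ.map_eq])]

theorem abs_le_one_of_mem_cell {x : Euc d} (hx : x ∈ cell d) (i : Fin d) : |x i| ≤ 1 := by
  rw [abs_of_nonneg (hx i).1]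
  exact (hx i).2.le

theorem norm_le_sqrt_of_mem_cell {x : Euc d} (hx : x ∈ cell d) : ‖x‖ ≤ √d := by
  rw [EuclideanSpace.norm_eq]
  refine Real.sqrt_le_sqrt ?_
  calc ∑ i, ‖x i‖ ^ 2 ≤ ∑ _i : Fin d, (1 : ℝ) := Finset.sum_le_sum fun i _ =>
        pow_le_one₀ (norm_nonneg _) (abs_le_one_of_mem_cell hx i)
    _ = d := by simp

theorem memLp_cellVol_of_continuous {E : Type*} [NormedAddCommGroup E] {f : Euc d → E}
    (hf : Continuous f) (p : ℝ≥0∞) : MemLp f p (cellVol d) := by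
  obtain ⟨C, hC⟩ := (isCompact_closedBall (0 : Euc d) √d).exists_bound_of_continuousOn
    hf.continuousOn
  refine MemLp.of_bound hf.aestronglyMeasurable C ?_
  filter_upwards [ae_mem_cell] with x hx
  exact hC x (by simpa using norm_le_sqrt_of_mem_cell hx)

theorem integrable_cellVol_of_continuous {E : Type*} [NormedAddCommGroup E] {f : Euc d → E}
    (hf : Continuous f) : Integrable f (cellVol d) :=
  memLp_one_iff_integrable.1 (memLp_cellVol_of_continuous hf 1)

/-! ### Periodic functions and their derivatives -/

theorem IsPeriodic.add_sum_single {β : Type*} {f : Euc d → β} (hf : IsPeriodic f)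
    (k : Fin d → ℤ) (s : Finset (Fin d)) (x : Euc d) :
    f (x + ∑ i ∈ s, k i • EuclideanSpace.single i (1 : ℝ)) = f x := by
  induction s using Finset.induction_on with
  | empty => simp
  | insert i s hi ih =>
    rw [Finset.sum_insert hi, add_left_comm, add_comm, Function.Periodic.zsmul (hf i) (k i), ih]

theorem IsPeriodic.eq_of_toTorus_eq {β : Type*} {f : Euc d → β} (hf : IsPeriodic f)
    {x y : Euc d} (h : toTorus x = toTorus y) : f x = f y := by
  have hcoord : ∀ i, ∃ k : ℤ, y i = x i + k := by
    intro i
    have hi : ((x i : ℝ) : UnitAddCircle) = (y i : ℝ) := congrFun h i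
    rw [eq_comm, QuotientAddGroup.eq_iff_sub_mem, AddSubgroup.mem_zmultiples_iff] at hi
    obtain ⟨k, hk⟩ := hi
    refine ⟨k, ?_⟩
    simp only [zsmul_eq_mul, mul_one] at hk
    linarith
  choose k hk using hcoord
  rw [← hf.add_sum_single k Finset.univ x]
  congr 1
  ext j
  simp [hk, Pi.single_apply]

theorem IsPeriodic.comp_toTorus {β : Type*} (F : Torus d → β) :
    IsPeriodic fun x => F (toTorus x) := by
  intro i x
  refine congrArg F ?_
  ext j
  by_cases h : j = i
  · subst h
    simp only [toTorus, PiLp.add_apply, PiLp.single_apply, if_true, AddCircle.coe_add,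
      AddCircle.coe_period, add_zero]
  · simp [toTorus, h]

theorem IsPeriodic.exists_lift {β : Type*} [TopologicalSpace β] {f : Euc d → β}
    (hf : IsPeriodic f) (hc : Continuous f) : ∃ F : C(Torus d, β), ∀ x, F (toTorus x) = f x := by
  have hq : IsQuotientMap (⟨toTorus, continuous_toTorus⟩ : C(Euc d, Torus d)) :=
    isOpenQuotientMap_toTorus.isQuotientMap
  have hfac : Function.FactorsThrough (⟨f, hc⟩ : C(Euc d, β)) (toTorus : Euc d → Torus d) :=
    fun _ _ h => hf.eq_of_toTorus_eq h
  exact ⟨hq.lift ⟨f, hc⟩ hfac, fun x => DFunLike.congr_fun (hq.lift_comp ⟨f, hc⟩ hfac) x⟩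

theorem exists_lift₂ {β : Type*} [TopologicalSpace β] {f : Euc d × Euc d → β}
    (hc : Continuous f) (hfst : ∀ y, IsPeriodic fun x => f (x, y))
    (hsnd : ∀ x, IsPeriodic fun y => f (x, y)) :
    ∃ F : C(Torus d × Torus d, β), ∀ x y, F (toTorus x, toTorus y) = f (x, y) := by
  have hq : IsQuotientMap (⟨Prod.map toTorus toTorus, by fun_prop⟩ :
      C(Euc d × Euc d, Torus d × Torus d)) :=
    (isOpenQuotientMap_toTorus.prodMap isOpenQuotientMap_toTorus).isQuotientMap
  have hfac : Function.FactorsThrough (⟨f, hc⟩ : C(Euc d × Euc d, β))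
      (Prod.map toTorus toTorus : Euc d × Euc d → Torus d × Torus d) := fun z w h =>
    ((hfst z.2).eq_of_toTorus_eq (congrArg Prod.fst h)).trans
      ((hsnd w.1).eq_of_toTorus_eq (congrArg Prod.snd h))
  exact ⟨hq.lift ⟨f, hc⟩ hfac, fun x y => DFunLike.congr_fun (hq.lift_comp ⟨f, hc⟩ hfac) (x, y)⟩

theorem IsPeriodic.exists_bound {f : Euc d → ℝ} (hf : IsPeriodic f) (hc : Continuous f) :
    ∃ C, ∀ x, |f x| ≤ C := by
  obtain ⟨F, hF⟩ := hf.exists_lift hc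
  exact ⟨‖F‖, fun x => by rw [← hF]; exact F.norm_coe_le_norm _⟩

theorem IsPeriodic.integral_add {f : Euc d → ℝ} (hf : IsPeriodic f) (hc : Continuous f)
    (s : Euc d) : ∫ x, f (x + s) ∂cellVol d = ∫ x, f x ∂cellVol d := by
  obtain ⟨F, hF⟩ := hf.exists_lift hc
  have hF_meas := F.continuous.aestronglyMeasurable (μ := volume)
  simp only [← hF, toTorus_add]
  rw [integral_comp_measurePreserving (measurePreserving_toTorus_add _) hF_meas,
    integral_comp_measurePreserving measurePreserving_toTorus hF_meas]

theorem IsPeriodic.integral_sub {f : Euc d → ℝ} (hf : IsPeriodic f) (hc : Continuous f)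
    (s : Euc d) : ∫ x, f (s - x) ∂cellVol d = ∫ x, f x ∂cellVol d := by
  obtain ⟨F, hF⟩ := hf.exists_lift hc
  have hF_meas := F.continuous.aestronglyMeasurable (μ := volume)
  simp only [← hF, toTorus_sub]
  rw [integral_comp_measurePreserving (measurePreserving_sub_toTorus _) hF_meas,
    integral_comp_measurePreserving measurePreserving_toTorus hF_meas]

/-- The `i`-th partial derivative. -/
def partialDeriv (i : Fin d) (f : Euc d → ℝ) (x : Euc d) : ℝ :=
  fderiv ℝ f x (EuclideanSpace.single i 1)

theorem gradient_apply (f : Euc d → ℝ) (x : Euc d) (i : Fin d) :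
    gradient f x i = partialDeriv i f x := by
  have h : inner ℝ (gradient f x) (EuclideanSpace.single i (1 : ℝ)) = partialDeriv i f x := by
    simp [gradient, partialDeriv]
  rw [← h, EuclideanSpace.inner_single_right]
  simp

theorem contDiff_partialDeriv {f : Euc d → ℝ} (hf : ContDiff ℝ ∞ f) (i : Fin d) :
    ContDiff ℝ ∞ (partialDeriv i f) :=
  (hf.fderiv_right (m := ∞) (by simp)).clm_apply contDiff_const

theorem IsPeriodic.partialDeriv {f : Euc d → ℝ} (hf : IsPeriodic f) (i : Fin d) :
    IsPeriodic (partialDeriv i f) := by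
  intro j x
  unfold TwoScaleMFG.partialDeriv
  rw [← fderiv_comp_add_right, funext (hf j)]

theorem SmoothPeriodic.partialDeriv {f : Euc d → ℝ} (hf : SmoothPeriodic f) (i : Fin d) :
    SmoothPeriodic (partialDeriv i f) :=
  ⟨contDiff_partialDeriv hf.smooth i, hf.periodic.partialDeriv i⟩

theorem SmoothPeriodic.continuous {f : Euc d → ℝ} (hf : SmoothPeriodic f) : Continuous f :=
  hf.smooth.continuous

theorem SmoothPeriodic.differentiable {f : Euc d → ℝ} (hf : SmoothPeriodic f) :
    Differentiable ℝ f := hf.smooth.differentiable (by simp)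

theorem SmoothPeriodic.mul {f g : Euc d → ℝ} (hf : SmoothPeriodic f) (hg : SmoothPeriodic g) :
    SmoothPeriodic fun x => f x * g x :=
  ⟨hf.smooth.mul hg.smooth, fun i x => by rw [hf.periodic, hg.periodic]⟩

theorem SmoothPeriodic.add {f g : Euc d → ℝ} (hf : SmoothPeriodic f) (hg : SmoothPeriodic g) :
    SmoothPeriodic fun x => f x + g x :=
  ⟨hf.smooth.add hg.smooth, fun i x => by rw [hf.periodic, hg.periodic]⟩

theorem SmoothPeriodic.const (c : ℝ) : SmoothPeriodic fun _ : Euc d => c :=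
  ⟨contDiff_const, fun _ _ => rfl⟩

theorem partialDeriv_mul {f g : Euc d → ℝ} {x : Euc d} (hf : DifferentiableAt ℝ f x)
    (hg : DifferentiableAt ℝ g x) (i : Fin d) :
    partialDeriv i (fun x => f x * g x) x
      = partialDeriv i f x * g x + f x * partialDeriv i g x := by
  simp only [partialDeriv, fderiv_fun_mul hf hg, add_apply, smul_apply, smul_eq_mul]
  ring

theorem sub_eq_intervalIntegral_fderiv {E : Type*} [NormedAddCommGroup E] [NormedSpace ℝ E]
    {f : E → ℝ} (hf : ContDiff ℝ 1 f) (x v : E) :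
    f (x + v) - f x = ∫ t in (0 : ℝ)..1, fderiv ℝ f (x + t • v) v := by
  have hderiv : ∀ t : ℝ,
      HasDerivAt (fun t : ℝ => f (x + t • v)) (fderiv ℝ f (x + t • v) v) t := by
    intro t
    have hline : HasDerivAt (fun t : ℝ => x + t • v) v t := by
      simpa using ((hasDerivAt_id t).smul_const v).const_add x
    exact (hf.differentiable (by simp) _).hasFDerivAt.comp_hasDerivAt t hline
  rw [intervalIntegral.integral_eq_sub_of_hasDerivAt fun t _ => hderiv t]
  · simp
  · exact (((hf.continuous_fderiv (by simp)).comp (by fun_prop)).clm_apply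
      continuous_const).intervalIntegrable _ _

/- The increments of `f` over a full period vanish; integrating the fundamental theorem of
calculus over the cell and shifting gives the integral of the derivative. -/
theorem integral_partialDeriv_eq_zero {f : Euc d → ℝ} (hf : SmoothPeriodic f) (i : Fin d) :
    ∫ x, partialDeriv i f x ∂cellVol d = 0 := by
  set e : Euc d := EuclideanSpace.single i 1
  have hf' := hf.partialDeriv i
  have hcont : Continuous (Function.uncurry fun (x : Euc d) (t : ℝ) =>
      partialDeriv i f (x + t • e)) := hf'.continuous.comp (by fun_prop)
  obtain ⟨C, hC⟩ := hf'.periodic.exists_bound hf'.continuous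
  calc ∫ x, partialDeriv i f x ∂cellVol d
      = ∫ t in Set.Ioc (0 : ℝ) 1, ∫ x, partialDeriv i f (x + t • e) ∂cellVol d := by
        simp [hf'.periodic.integral_add hf'.continuous]
    _ = ∫ x, (∫ t in (0 : ℝ)..1, partialDeriv i f (x + t • e)) ∂cellVol d := by
        simp only [intervalIntegral.integral_of_le zero_le_one]
        exact (integral_integral_swap (Integrable.of_bound hcont.aestronglyMeasurable C
          (ae_of_all _ fun z => hC _))).symm
    _ = ∫ x, (f (x + e) - f x) ∂cellVol d := integral_congr_ae (ae_of_all _ fun x =>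
        (sub_eq_intervalIntegral_fderiv (hf.smooth.of_le (by simp)) x e).symm)
    _ = 0 := by simp [e, hf.periodic i]

theorem integral_mul_partialDeriv {f g : Euc d → ℝ} (hf : SmoothPeriodic f)
    (hg : SmoothPeriodic g) (i : Fin d) :
    ∫ x, f x * partialDeriv i g x ∂cellVol d = -∫ x, partialDeriv i f x * g x ∂cellVol d := by
  have h := integral_partialDeriv_eq_zero (hf.mul hg) i
  simp only [partialDeriv_mul (hf.differentiable _) (hg.differentiable _)] at h
  rw [integral_add (integrable_cellVol_of_continuous ((hf.partialDeriv i).mul hg).continuous)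
    (integrable_cellVol_of_continuous (hf.mul (hg.partialDeriv i)).continuous)] at h
  linarith

/-! ### A priori bounds for the mean-field game -/

theorem continuous_gradient {u : Euc d → ℝ} (hu : ContDiff ℝ 1 u) : Continuous (gradient u) :=
  (LinearIsometryEquiv.continuous _).comp (hu.continuous_fderiv (by simp))

theorem SmoothPeriodic.contDiff_one {f : Euc d → ℝ} (hf : SmoothPeriodic f) : ContDiff ℝ 1 f :=
  hf.smooth.of_le (by simp)

theorem SmoothPeriodic.continuous_gradient {f : Euc d → ℝ} (hf : SmoothPeriodic f) :
    Continuous (gradient f) := TwoScaleMFG.continuous_gradient hf.contDiff_one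

theorem SmoothPeriodic₂.exists_bound {V : Euc d × Euc d → ℝ} (hV : SmoothPeriodic₂ V) :
    ∃ M, ∀ z, |V z| ≤ M := by
  obtain ⟨F, hF⟩ := exists_lift₂ hV.smooth.continuous hV.periodic_fst hV.periodic_snd
  exact ⟨‖F‖, fun z => by rw [← hF z.1 z.2]; exact F.norm_coe_le_norm _⟩

namespace SolvesMFG

variable {V : Euc d × Euc d → ℝ} {P : Euc d} {ε : ℝ} {u m : Euc d → ℝ} {H : ℝ}

theorem continuous_density (h : SolvesMFG V P ε u m H) : Continuous m := h.smooth_m.continuous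

theorem integral_flux_inner_gradient (h : SolvesMFG V P ε u m H) :
    ∫ x, m x * inner ℝ (P + gradient u x) (gradient u x) ∂cellVol d = 0 := by
  set F : Fin d → Euc d → ℝ := fun i x => m x * (P i + partialDeriv i u x)
  have hF : ∀ i, SmoothPeriodic (F i) := fun i =>
    h.smooth_m.mul ((SmoothPeriodic.const (P i)).add (h.smooth_u.partialDeriv i))
  have hdiv : ∀ x, ∑ i, partialDeriv i (F i) x = 0 := by
    intro x
    have := h.fokker_planck x
    simpa only [divergence, neg_eq_zero, PiLp.smul_apply, PiLp.add_apply, gradient_apply,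
      smul_eq_mul, partialDeriv, F] using this
  calc ∫ x, m x * inner ℝ (P + gradient u x) (gradient u x) ∂cellVol d
      = ∫ x, ∑ i, partialDeriv i u x * F i x ∂cellVol d := by
        refine integral_congr_ae (ae_of_all _ fun x => ?_)
        simp only [PiLp.inner_apply, PiLp.add_apply, gradient_apply, Finset.mul_sum, F]
        refine Finset.sum_congr rfl fun i _ => ?_
        simp only [RCLike.inner_apply, conj_trivial]
        ring
    _ = ∑ i, ∫ x, partialDeriv i u x * F i x ∂cellVol d :=
        integral_finsetSum _ fun i _ => integrable_cellVol_of_continuous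
          ((h.smooth_u.partialDeriv i).mul (hF i)).continuous
    _ = -∑ i, ∫ x, u x * partialDeriv i (F i) x ∂cellVol d := by
        rw [← Finset.sum_neg_distrib]
        refine Finset.sum_congr rfl fun i _ => ?_
        rw [integral_mul_partialDeriv h.smooth_u (hF i), neg_neg]
    _ = -∫ x, u x * ∑ i, partialDeriv i (F i) x ∂cellVol d := by
        simp only [Finset.mul_sum]
        rw [integral_finsetSum _ fun i _ => integrable_cellVol_of_continuous
          (h.smooth_u.mul ((hF i).partialDeriv i)).continuous]
    _ = 0 := by simp [hdiv]

theorem integral_mul_norm_sq_le (h : SolvesMFG V P ε u m H) :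
    ∫ x, m x * ‖P + gradient u x‖ ^ 2 ∂cellVol d ≤ ‖P‖ ^ 2 := by
  have hm := h.continuous_density
  have hg := h.smooth_u.continuous_gradient
  have integrable {f : Euc d → ℝ} (hf : Continuous f) := integrable_cellVol_of_continuous hf
  have hQ : ∫ x, m x * ‖P + gradient u x‖ ^ 2 ∂cellVol d
      = ∫ x, m x * inner ℝ (P + gradient u x) P ∂cellVol d := by
    rw [← add_zero (∫ x, m x * inner ℝ (P + gradient u x) P ∂cellVol d),
      ← h.integral_flux_inner_gradient, ← integral_add (integrable (by fun_prop))
        (integrable (by fun_prop))]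
    refine integral_congr_ae (ae_of_all _ fun x => ?_)
    simp only
    rw [← mul_add, ← inner_add_right, real_inner_self_eq_norm_sq]
  have hyoung : ∫ x, m x * inner ℝ (P + gradient u x) P ∂cellVol d
      ≤ ∫ x, (2⁻¹ * (m x * ‖P + gradient u x‖ ^ 2) + 2⁻¹ * ‖P‖ ^ 2 * m x) ∂cellVol d := by
    refine integral_mono (integrable (by fun_prop)) (integrable (by fun_prop)) fun x => ?_
    have hinner : inner ℝ (P + gradient u x) P ≤
        2⁻¹ * ‖P + gradient u x‖ ^ 2 + 2⁻¹ * ‖P‖ ^ 2 := by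
      nlinarith [real_inner_le_norm (P + gradient u x) P, sq_nonneg (‖P + gradient u x‖ - ‖P‖)]
    linarith [mul_le_mul_of_nonneg_left hinner (h.m_pos x).le]
  rw [integral_add (integrable (by fun_prop)) (integrable (by fun_prop)), integral_const_mul,
    integral_const_mul, h.integral_m] at hyoung
  linarith

variable {M : ℝ}

theorem neg_le_hamiltonian (h : SolvesMFG V P ε u m H) (hM : ∀ z, |V z| ≤ M) : -M ≤ H := by
  have hm := h.continuous_density
  have hint : ∫ x, (-M + 1 - m x) ∂cellVol d ≤ ∫ _, H ∂cellVol d := by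
    refine integral_mono_ae (integrable_cellVol_of_continuous (by fun_prop))
      (integrable_const _) ?_
    filter_upwards [ae_mem_cell] with x hx
    have hlog := Real.log_le_sub_one_of_pos (h.m_pos x)
    have hV := (abs_le.1 (hM (x, ε⁻¹ • x))).1
    linarith [h.hamilton_jacobi x hx, sq_nonneg ‖P + gradient u x‖]
  rw [integral_sub (integrable_const _) (integrable_cellVol_of_continuous hm), h.integral_m]
    at hint
  simp only [integral_const, probReal_univ, one_smul] at hint
  linarith

theorem integral_mul_log_le (h : SolvesMFG V P ε u m H) (hM : ∀ z, |V z| ≤ M) :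
    ∫ x, m x * Real.log (m x) ∂cellVol d ≤ ‖P‖ ^ 2 / 2 + M - H := by
  have hm := h.continuous_density
  have hg := h.smooth_u.continuous_gradient
  have : Continuous fun x => Real.log (m x) := hm.log fun x => (h.m_pos x).ne'
  have integrable {f : Euc d → ℝ} (hf : Continuous f) := integrable_cellVol_of_continuous hf
  have hint : ∫ x, m x * Real.log (m x) ∂cellVol d
      ≤ ∫ x, (2⁻¹ * (m x * ‖P + gradient u x‖ ^ 2) + (M - H) * m x) ∂cellVol d := by
    refine integral_mono_ae (integrable (by fun_prop)) (integrable (by fun_prop)) ?_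
    filter_upwards [ae_mem_cell] with x hx
    have hV := (abs_le.1 (hM (x, ε⁻¹ • x))).2
    have hle : Real.log (m x) ≤ 2⁻¹ * ‖P + gradient u x‖ ^ 2 + (M - H) := by
      linarith [h.hamilton_jacobi x hx]
    linarith [mul_le_mul_of_nonneg_left hle (h.m_pos x).le]
  rw [integral_add (integrable (by fun_prop)) (integrable (by fun_prop)), integral_const_mul,
    integral_const_mul, h.integral_m] at hint
  linarith [h.integral_mul_norm_sq_le]

theorem integral_mul_log_nonneg (h : SolvesMFG V P ε u m H) :
    0 ≤ ∫ x, m x * Real.log (m x) ∂cellVol d := by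
  have hm := h.continuous_density
  have : Continuous fun x => Real.log (m x) := hm.log fun x => (h.m_pos x).ne'
  calc (0 : ℝ) = ∫ x, (m x - 1) ∂cellVol d := by
        rw [integral_sub (integrable_cellVol_of_continuous hm) (integrable_const _), h.integral_m]
        simp
    _ ≤ ∫ x, m x * Real.log (m x) ∂cellVol d := by
        refine integral_mono (integrable_cellVol_of_continuous (by fun_prop))
          (integrable_cellVol_of_continuous (by fun_prop)) fun x => ?_
        have hlog_ge := mul_le_mul_of_nonneg_left
          (Real.one_sub_inv_le_log_of_pos (h.m_pos x)) (h.m_pos x).le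
        rwa [mul_sub, mul_inv_cancel₀ (h.m_pos x).ne', mul_one] at hlog_ge

theorem hamiltonian_le (h : SolvesMFG V P ε u m H) (hM : ∀ z, |V z| ≤ M) :
    H ≤ ‖P‖ ^ 2 / 2 + M := by
  linarith [h.integral_mul_log_le hM, h.integral_mul_log_nonneg]

theorem integral_exp_le (h : SolvesMFG V P ε u m H) (hM : ∀ z, |V z| ≤ M) :
    ∫ x, Real.exp (‖P + gradient u x‖ ^ 2 / 2) ∂cellVol d ≤ Real.exp (‖P‖ ^ 2 / 2 + 2 * M) := by
  have hm := h.continuous_density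
  have hg := h.smooth_u.continuous_gradient
  calc ∫ x, Real.exp (‖P + gradient u x‖ ^ 2 / 2) ∂cellVol d
      ≤ ∫ x, Real.exp (‖P‖ ^ 2 / 2 + 2 * M) * m x ∂cellVol d := by
        refine integral_mono_ae (integrable_cellVol_of_continuous (by fun_prop))
          (integrable_cellVol_of_continuous (by fun_prop)) ?_
        filter_upwards [ae_mem_cell] with x hx
        have hV := (abs_le.1 (hM (x, ε⁻¹ • x))).1
        have hle : ‖P + gradient u x‖ ^ 2 / 2 ≤ ‖P‖ ^ 2 / 2 + 2 * M + Real.log (m x) := by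
          linarith [h.hamilton_jacobi x hx, h.hamiltonian_le hM]
        simpa only [Real.exp_add, Real.exp_log (h.m_pos x)] using Real.exp_le_exp.2 hle
    _ = Real.exp (‖P‖ ^ 2 / 2 + 2 * M) := by rw [integral_const_mul, h.integral_m, mul_one]

theorem integral_norm_gradient_pow_le (h : SolvesMFG V P ε u m H) (hM : ∀ z, |V z| ≤ M)
    (r : ℕ) :
    ∫ x, ‖gradient u x‖ ^ (2 * r) ∂cellVol d
      ≤ 2 ^ (2 * r - 1) *
        (2 ^ r * r.factorial * Real.exp (‖P‖ ^ 2 / 2 + 2 * M) + ‖P‖ ^ (2 * r)) := by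
  have hg := h.smooth_u.continuous_gradient
  have hexp : ∀ x, ‖P + gradient u x‖ ^ (2 * r)
      ≤ 2 ^ r * r.factorial * Real.exp (‖P + gradient u x‖ ^ 2 / 2) := by
    intro x
    have hseries := Real.pow_div_factorial_le_exp (‖P + gradient u x‖ ^ 2 / 2) (by positivity) r
    rw [div_le_iff₀ (by positivity), div_pow, div_le_iff₀ (by positivity), ← pow_mul] at hseries
    linarith
  calc ∫ x, ‖gradient u x‖ ^ (2 * r) ∂cellVol d
      ≤ ∫ x, 2 ^ (2 * r - 1) * (2 ^ r * r.factorial * Real.exp (‖P + gradient u x‖ ^ 2 / 2)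
          + ‖P‖ ^ (2 * r)) ∂cellVol d := by
        refine integral_mono (integrable_cellVol_of_continuous (by fun_prop))
          (integrable_cellVol_of_continuous (by fun_prop)) fun x => ?_
        have htri : ‖gradient u x‖ ≤ ‖P + gradient u x‖ + ‖P‖ := by
          simpa using norm_sub_le (P + gradient u x) P
        calc ‖gradient u x‖ ^ (2 * r) ≤ (‖P + gradient u x‖ + ‖P‖) ^ (2 * r) := by gcongr
          _ ≤ 2 ^ (2 * r - 1) * (‖P + gradient u x‖ ^ (2 * r) + ‖P‖ ^ (2 * r)) :=
            add_pow_le (norm_nonneg _) (norm_nonneg _) _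
          _ ≤ _ := by gcongr; exact hexp x
    _ = 2 ^ (2 * r - 1) * (2 ^ r * r.factorial *
          ∫ x, Real.exp (‖P + gradient u x‖ ^ 2 / 2) ∂cellVol d + ‖P‖ ^ (2 * r)) := by
        rw [integral_const_mul, integral_add (integrable_cellVol_of_continuous (by fun_prop))
          (integrable_const _), integral_const_mul]
        simp
    _ ≤ _ := by gcongr; exact h.integral_exp_le hM

end SolvesMFG

/-! ### Morrey's inequality on the torus -/

theorem norm_gradient (f : Euc d → ℝ) (x : Euc d) : ‖gradient f x‖ = ‖fderiv ℝ f x‖ := by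
  simp [gradient]

theorem abs_fderiv_le (f : Euc d → ℝ) (x v : Euc d) :
    |fderiv ℝ f x v| ≤ ‖v‖ * ‖gradient f x‖ := by
  rw [norm_gradient, mul_comm]
  exact (fderiv ℝ f x).le_opNorm v

theorem IsPeriodic.gradient {f : Euc d → ℝ} (hf : IsPeriodic f) : IsPeriodic (gradient f) := by
  intro i x
  unfold _root_.gradient
  rw [← fderiv_comp_add_right, funext (hf i)]

theorem IsPeriodic.comp {β γ : Type*} {f : Euc d → β} (hf : IsPeriodic f) (φ : β → γ) :
    IsPeriodic fun x => φ (f x) := fun i x => congrArg φ (hf i x)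

section

open scoped Pointwise

theorem smul_cell_subset_cell {r : ℝ} (hr : 0 ≤ r) (hr1 : r ≤ 1) : r • cell d ⊆ cell d := by
  rintro _ ⟨x, hx, rfl⟩ i
  obtain ⟨h0, h1⟩ := hx i
  simp only [PiLp.smul_apply, smul_eq_mul, Set.mem_Ico]
  exact ⟨mul_nonneg hr h0, by nlinarith⟩

theorem IsPeriodic.integral_sub_smul_le {f : Euc d → ℝ} (hper : IsPeriodic f)
    (hc : Continuous f) (hf : ∀ x, 0 ≤ f x) {r : ℝ} (hr : 0 < r) (hr1 : r ≤ 1) (c : Euc d) :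
    ∫ s, f (c - r • s) ∂cellVol d ≤ (r ^ d)⁻¹ * ∫ x, f x ∂cellVol d := by
  calc ∫ s, f (c - r • s) ∂cellVol d = (r ^ d)⁻¹ * ∫ z in r • cell d, f (c - z) := by
        unfold cellVol
        rw [Measure.setIntegral_comp_smul_of_pos volume (fun z => f (c - z)) _ hr]
        simp
    _ ≤ (r ^ d)⁻¹ * ∫ z, f (c - z) ∂cellVol d := by
        refine mul_le_mul_of_nonneg_left ?_ (by positivity)
        exact setIntegral_mono_set (integrable_cellVol_of_continuous (by fun_prop))
          (ae_of_all _ fun z => hf _) (smul_cell_subset_cell hr.le hr1).eventuallyLE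
    _ = (r ^ d)⁻¹ * ∫ x, f x ∂cellVol d := by rw [hper.integral_sub hc]

end

theorem integral_sub_smul_le_mul_rpow {g : Euc d → ℝ} (hg : Continuous g) (hg0 : ∀ x, 0 ≤ g x)
    (hper : IsPeriodic g) {p : ℝ} (hp : 1 ≤ p) {B : ℝ} (hB : 0 ≤ B)
    (hgB : ∫ x, g x ^ p ∂cellVol d ≤ B ^ p) {r : ℝ} (hr : 0 < r) (hr1 : r ≤ 1) (c : Euc d) :
    ∫ s, g (c - r • s) ∂cellVol d ≤ B * r ^ (-(d / p) : ℝ) := by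
  have hp0 : 0 < p := one_pos.trans_le hp
  have hgp : Continuous fun x => g x ^ p := hg.rpow_const fun _ => Or.inr hp0.le
  refine (Real.rpow_le_rpow_iff (integral_nonneg fun _ => hg0 _) (by positivity) hp0).1 ?_
  calc (∫ s, g (c - r • s) ∂cellVol d) ^ p ≤ ∫ s, g (c - r • s) ^ p ∂cellVol d :=
        (convexOn_rpow hp).map_integral_le (continuousOn_id.rpow_const fun _ _ => Or.inr hp0.le)
          isClosed_Ici (ae_of_all _ fun s => hg0 _)
          (integrable_cellVol_of_continuous (by fun_prop))
          (integrable_cellVol_of_continuous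
            (hgp.comp (by fun_prop : Continuous fun s : Euc d => c - r • s)))
    _ ≤ (r ^ d)⁻¹ * ∫ x, g x ^ p ∂cellVol d :=
        (hper.comp (· ^ p)).integral_sub_smul_le hgp (fun x => Real.rpow_nonneg (hg0 x) p) hr hr1 c
    _ ≤ (r ^ d)⁻¹ * B ^ p := by gcongr
    _ = (B * r ^ (-(d / p) : ℝ)) ^ p := by
        rw [Real.mul_rpow hB (by positivity), ← Real.rpow_mul hr.le,
          show -(d / p) * p = -(d : ℝ) by field_simp, Real.rpow_neg hr.le, Real.rpow_natCast,
          mul_comm]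

theorem abs_integral_sub_le_of_forall_integral_le {u : Euc d → ℝ} (hu : ContDiff ℝ 1 u)
    (hper : IsPeriodic u) {x v : Euc d → Euc d} (hx : Continuous x) (hv : Continuous v)
    {k : ℝ → ℝ} (hk : IntegrableOn k (Set.Ioc 0 1))
    (hkb : ∀ t ∈ Set.Ioc (0 : ℝ) 1,
      ∫ s, ‖v s‖ * ‖gradient u (x s + t • v s)‖ ∂cellVol d ≤ k t) :
    |∫ s, (u (x s + v s) - u (x s)) ∂cellVol d| ≤ ∫ t in Set.Ioc (0 : ℝ) 1, k t := by
  have huc := hu.continuous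
  have hg := continuous_gradient hu
  obtain ⟨C, hC⟩ := (hper.gradient.comp norm).exists_bound (by fun_prop)
  have hint : Integrable (Function.uncurry fun (s : Euc d) (t : ℝ) =>
      ‖v s‖ * ‖gradient u (x s + t • v s)‖)
      ((cellVol d).prod (volume.restrict (Set.Ioc (0 : ℝ) 1))) := by
    have hdom : Integrable (fun z : Euc d × ℝ => ‖v z.1‖ * C)
        ((cellVol d).prod (volume.restrict (Set.Ioc (0 : ℝ) 1))) :=
      (integrable_cellVol_of_continuous (hv.norm.mul continuous_const)).comp_fst _
    refine hdom.mono' (Continuous.aestronglyMeasurable (by fun_prop)) (ae_of_all _ fun z => ?_)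
    simp only [Function.uncurry, norm_mul, norm_norm]
    gcongr
    simpa using hC (x z.1 + z.2 • v z.1)
  have hsegment : ∀ s, |u (x s + v s) - u (x s)|
      ≤ ∫ t in Set.Ioc (0 : ℝ) 1, ‖v s‖ * ‖gradient u (x s + t • v s)‖ := by
    intro s
    rw [sub_eq_intervalIntegral_fderiv hu, intervalIntegral.integral_of_le zero_le_one]
    have hi : IntegrableOn (fun t : ℝ => ‖v s‖ * ‖gradient u (x s + t • v s)‖) (Set.Ioc 0 1) :=
      Continuous.integrableOn_Ioc (by fun_prop)
    exact norm_integral_le_of_norm_le (f := fun t : ℝ => fderiv ℝ u (x s + t • v s) (v s)) hi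
      (ae_of_all _ fun t => abs_fderiv_le u _ _)
  calc |∫ s, (u (x s + v s) - u (x s)) ∂cellVol d|
      ≤ ∫ s, |u (x s + v s) - u (x s)| ∂cellVol d := abs_integral_le_integral_abs
    _ ≤ ∫ s, (∫ t in Set.Ioc (0 : ℝ) 1, ‖v s‖ * ‖gradient u (x s + t • v s)‖) ∂cellVol d :=
        integral_mono (integrable_cellVol_of_continuous (by fun_prop)) hint.integral_prod_left
          hsegment
    _ = ∫ t in Set.Ioc (0 : ℝ) 1, ∫ s, ‖v s‖ * ‖gradient u (x s + t • v s)‖ ∂cellVol d :=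
        integral_integral_swap hint
    _ ≤ ∫ t in Set.Ioc (0 : ℝ) 1, k t :=
        setIntegral_mono_on hint.integral_prod_right hk measurableSet_Ioc hkb

section Morrey

variable {u : Euc d → ℝ} {p B : ℝ}

theorem integral_norm_smul_mul_norm_gradient_le (hu : ContDiff ℝ 1 u) (hper : IsPeriodic u)
    (hp : 1 ≤ p) (hB : 0 ≤ B) (hgrad : ∫ x, ‖gradient u x‖ ^ p ∂cellVol d ≤ B ^ p) {r t : ℝ}
    (hr : 0 < r) (hr1 : r ≤ 1) (ht : 0 < t) (ht1 : t ≤ 1) (y : Euc d) :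
    ∫ s, ‖-(r • s)‖ * ‖gradient u (y + t • -(r • s))‖ ∂cellVol d
      ≤ √d * B * r ^ (1 - d / p : ℝ) * t ^ (-(d / p) : ℝ) := by
  have hg := continuous_gradient hu
  calc ∫ s, ‖-(r • s)‖ * ‖gradient u (y + t • -(r • s))‖ ∂cellVol d
      ≤ ∫ s, r * √d * ‖gradient u (y - (t * r) • s)‖ ∂cellVol d := by
        refine integral_mono_ae (integrable_cellVol_of_continuous (by fun_prop))
          (integrable_cellVol_of_continuous (by fun_prop)) ?_
        filter_upwards [ae_mem_cell] with s hs
        rw [norm_neg, norm_smul, Real.norm_of_nonneg hr.le, smul_neg, smul_smul,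
          ← sub_eq_add_neg]
        gcongr
        exact norm_le_sqrt_of_mem_cell hs
    _ ≤ r * √d * (B * (t * r) ^ (-(d / p) : ℝ)) := by
        rw [integral_const_mul]
        gcongr
        exact integral_sub_smul_le_mul_rpow (by fun_prop) (fun _ => norm_nonneg _)
          (hper.gradient.comp norm) hp hB hgrad (mul_pos ht hr)
          (mul_le_one₀ ht1 hr.le hr1) y
    _ = √d * B * r ^ (1 - d / p : ℝ) * t ^ (-(d / p) : ℝ) := by
        rw [Real.mul_rpow ht.le hr.le, sub_eq_add_neg, Real.rpow_add hr, Real.rpow_one]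
        ring

theorem abs_integral_sub_smul_sub_le (hu : ContDiff ℝ 1 u) (hper : IsPeriodic u) (hp : 1 ≤ p)
    (hdp : d < p) (hB : 0 ≤ B) (hgrad : ∫ x, ‖gradient u x‖ ^ p ∂cellVol d ≤ B ^ p)
    {r : ℝ} (hr : 0 < r) (hr1 : r ≤ 1) (y : Euc d) :
    |∫ s, (u (y - r • s) - u y) ∂cellVol d| ≤ √d / (1 - d / p) * B * r ^ (1 - d / p : ℝ) := by
  have := continuous_gradient hu
  have hγ : (d / p : ℝ) < 1 := (div_lt_one (one_pos.trans_le hp)).2 hdp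
  have hk : IntegrableOn (fun t : ℝ => √d * B * r ^ (1 - d / p : ℝ) * t ^ (-(d / p) : ℝ))
      (Set.Ioc 0 1) := by
    refine Integrable.const_mul ?_ _
    have := intervalIntegral.intervalIntegrable_rpow' (a := 0) (b := 1) (r := -(d / p))
      (by linarith)
    rwa [intervalIntegrable_iff_integrableOn_Ioc_of_le zero_le_one] at this
  calc |∫ s, (u (y - r • s) - u y) ∂cellVol d|
      ≤ ∫ t in Set.Ioc (0 : ℝ) 1, √d * B * r ^ (1 - d / p : ℝ) * t ^ (-(d / p) : ℝ) := by
        simpa only [← sub_eq_add_neg] using abs_integral_sub_le_of_forall_integral_le hu hper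
          continuous_const (by fun_prop) hk fun t ht =>
            integral_norm_smul_mul_norm_gradient_le hu hper hp hB hgrad hr hr1 ht.1 ht.2 y
    _ = √d / (1 - d / p) * B * r ^ (1 - d / p : ℝ) := by
        rw [integral_const_mul, ← intervalIntegral.integral_of_le zero_le_one,
          integral_rpow (Or.inl (by linarith)), neg_add_eq_sub, Real.one_rpow,
          Real.zero_rpow (by linarith)]
        ring

theorem abs_integral_add_sub_le (hu : ContDiff ℝ 1 u) (hper : IsPeriodic u) (hp : 1 ≤ p)
    (hB : 0 ≤ B) (hgrad : ∫ x, ‖gradient u x‖ ^ p ∂cellVol d ≤ B ^ p)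
    {r : ℝ} (hr : 0 < r) (hr1 : r ≤ 1) (y v : Euc d) :
    |∫ s, (u (y - r • s + v) - u (y - r • s)) ∂cellVol d| ≤ ‖v‖ * (B * r ^ (-(d / p) : ℝ)) := by
  have hg := continuous_gradient hu
  have hslice : ∀ t ∈ Set.Ioc (0 : ℝ) 1,
      ∫ s, ‖v‖ * ‖gradient u (y - r • s + t • v)‖ ∂cellVol d
        ≤ ‖v‖ * (B * r ^ (-(d / p) : ℝ)) := by
    intro t _
    simp only [integral_const_mul, sub_add_eq_add_sub]
    gcongr
    exact integral_sub_smul_le_mul_rpow (by fun_prop) (fun _ => norm_nonneg _)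
      (hper.gradient.comp norm) hp hB hgrad hr hr1 (y + t • v)
  simpa using abs_integral_sub_le_of_forall_integral_le hu hper (by fun_prop) continuous_const
    (integrable_const _) hslice

theorem abs_sub_integral_le (hu : ContDiff ℝ 1 u) (hper : IsPeriodic u) (hp : 1 ≤ p)
    (hdp : d < p) (hB : 0 ≤ B) (hgrad : ∫ x, ‖gradient u x‖ ^ p ∂cellVol d ≤ B ^ p)
    (y : Euc d) : |u y - ∫ x, u x ∂cellVol d| ≤ √d / (1 - d / p) * B := by
  have huc := hu.continuous
  have h := abs_integral_sub_smul_sub_le hu hper hp hdp hB hgrad one_pos le_rfl y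
  rw [integral_sub (integrable_cellVol_of_continuous (by fun_prop)) (integrable_const _)] at h
  simp only [one_smul, hper.integral_sub huc, integral_const, probReal_univ, Real.one_rpow,
    mul_one] at h
  rwa [abs_sub_comm]

/- For nearby points compare both values with averages over cells of size `‖y - z‖`; for distant
points compare both with the mean. -/
theorem abs_sub_le_mul_rpow (hu : ContDiff ℝ 1 u) (hper : IsPeriodic u) (hp : 1 ≤ p)
    (hdp : d < p) (hB : 0 ≤ B) (hgrad : ∫ x, ‖gradient u x‖ ^ p ∂cellVol d ≤ B ^ p)
    (y z : Euc d) :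
    |u y - u z| ≤ (2 * (√d / (1 - d / p)) + 1) * B * ‖y - z‖ ^ (1 - d / p : ℝ) := by
  have huc := hu.continuous
  have hγ : 0 < 1 - (d / p : ℝ) := sub_pos.2 ((div_lt_one (one_pos.trans_le hp)).2 hdp)
  rcases eq_or_ne y z with rfl | hyz
  · simp [Real.zero_rpow hγ.ne']
  set r := ‖y - z‖ with hr_def
  have hr : 0 < r := norm_pos_iff.2 (sub_ne_zero.2 hyz)
  rcases le_or_gt r 1 with hr1 | hr1
  · have hint : ∀ c : Euc d, Integrable (fun s => u (c - r • s)) (cellVol d) := fun c =>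
      integrable_cellVol_of_continuous (by fun_prop)
    have hy := abs_integral_sub_smul_sub_le hu hper hp hdp hB hgrad hr hr1 y
    have hz := abs_integral_sub_smul_sub_le hu hper hp hdp hB hgrad hr hr1 z
    have hyz := abs_integral_add_sub_le hu hper hp hB hgrad hr hr1 z (y - z)
    have hshift : ∀ s, z - r • s + (y - z) = y - r • s := fun s => by abel
    have hpow : r * (B * r ^ (-(d / p) : ℝ)) = B * r ^ (1 - d / p : ℝ) := by
      rw [sub_eq_add_neg, Real.rpow_add hr, Real.rpow_one]
      ring
    simp only [hshift] at hyz
    rw [integral_sub (hint _) (hint _), ← hr_def, hpow] at hyz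
    rw [integral_sub (hint _) (integrable_const _)] at hy hz
    simp only [integral_const, probReal_univ, one_smul] at hy hz
    rw [abs_le] at *
    constructor <;> linarith
  · have hy := abs_sub_integral_le hu hper hp hdp hB hgrad y
    have hz := abs_sub_integral_le hu hper hp hdp hB hgrad z
    calc |u y - u z| ≤ (2 * (√d / (1 - d / p)) + 1) * B * 1 := by
          rw [abs_le] at *
          constructor <;> linarith
      _ ≤ (2 * (√d / (1 - d / p)) + 1) * B * r ^ (1 - d / p : ℝ) := by
          gcongr
          exact Real.one_le_rpow hr1.le hγ.le

end Morrey

/-! ### Equidistribution of rapidly oscillating points -/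

theorem abs_setIntegral_sub_setIntegral_le {α : Type*} [MeasurableSpace α] {μ : Measure α}
    {A B : Set α} (hA : MeasurableSet A) (hB : MeasurableSet B) (hAμ : μ A ≠ ⊤) (hBμ : μ B ≠ ⊤)
    {F : α → ℝ} {M : ℝ} (hF : AEStronglyMeasurable F μ) (hM : ∀ x, |F x| ≤ M) :
    |∫ x in A, F x ∂μ - ∫ x in B, F x ∂μ| ≤ 2 * M * μ.real (symmDiff A B) := by
  have hint : ∀ S, μ S ≠ ⊤ → IntegrableOn F S μ := fun S hS =>
    IntegrableOn.of_bound hS.lt_top hF.restrict M (ae_of_all _ hM)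
  have hA_split := integral_inter_add_sdiff (μ := μ) (f := F) hB (hint A hAμ)
  have hB_split := integral_inter_add_sdiff (μ := μ) (f := F) hA (hint B hBμ)
  rw [Set.inter_comm] at hB_split
  have hfin : μ (symmDiff A B) ≠ ⊤ :=
    measure_ne_top_of_subset Set.symmDiff_subset_union
      (measure_union_lt_top hAμ.lt_top hBμ.lt_top).ne
  have hdiff : ∀ S, S ⊆ symmDiff A B → |∫ x in S, F x ∂μ| ≤ M * μ.real (symmDiff A B) := by
    intro S hS
    rcases isEmpty_or_nonempty α with hα | ⟨⟨x⟩⟩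
    · simp [Measure.eq_zero_of_isEmpty μ]
    have hM0 : 0 ≤ M := (abs_nonneg _).trans (hM x)
    refine (norm_setIntegral_le_of_norm_le_const (C := M) (f := F)
      ((measure_mono hS).trans_lt hfin.lt_top) fun x _ => hM x).trans ?_
    exact mul_le_mul_of_nonneg_left (measureReal_mono hS hfin) hM0
  have hAB := hdiff (A \ B) (by rw [Set.symmDiff_def]; exact Set.subset_union_left)
  have hBA := hdiff (B \ A) (by rw [Set.symmDiff_def]; exact Set.subset_union_right)
  rw [abs_le] at *
  constructor <;> linarith

theorem volume_cell_ne_top : volume (cell d) ≠ ⊤ := by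
  simpa [cellVol] using measure_ne_top (cellVol d) Set.univ

theorem tendsto_volume_symmDiff_preimage_cell {v : ℕ → Euc d} (hv : Tendsto v atTop (𝓝 0)) :
    Tendsto (fun n => volume.real (symmDiff ((fun x => x - v n) ⁻¹' cell d) (cell d))) atTop
      (𝓝 0) := by
  let shift : Euc d → C(Euc d, Euc d) :=
    (ContinuousMap.mk (fun a : Euc d × Euc d => a.2 - a.1) (by fun_prop)).curry
  have hshift : Tendsto (fun n => shift (v n)) atTop (𝓝 (shift 0)) :=
    ((ContinuousMap.continuous (ContinuousMap.curry _)).tendsto 0).comp hv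
  have hlim := (ENNReal.tendsto_toReal ENNReal.zero_ne_top).comp
    (tendsto_measure_symmDiff_preimage_nhds_zero (μ := volume) (ν := volume) hshift
      (Eventually.of_forall fun n => measurePreserving_sub_right volume (v n))
      (measurePreserving_sub_right volume 0) measurableSet_cell.nullMeasurableSet
      volume_cell_ne_top)
  have hzero : shift 0 ⁻¹' cell d = cell d := by
    ext
    simp [shift]
  rw [hzero] at hlim
  exact hlim

theorem tendsto_integral_translate_sub {F : ℕ → Euc d → ℝ}
    (hF : ∀ n, AEStronglyMeasurable (F n) volume) {M : ℝ} (hM : ∀ n x, |F n x| ≤ M)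
    {v : ℕ → Euc d} (hv : Tendsto v atTop (𝓝 0)) :
    Tendsto (fun n => ∫ x, F n (x + v n) ∂cellVol d - ∫ x, F n x ∂cellVol d) atTop (𝓝 0) := by
  have hbound := (tendsto_volume_symmDiff_preimage_cell hv).const_mul (2 * M)
  rw [mul_zero] at hbound
  refine squeeze_zero_norm (fun n => ?_) hbound
  have hpres := measurePreserving_sub_right volume (v n)
  have htranslate : ∫ x, F n (x + v n) ∂cellVol d
      = ∫ x in (fun x => x - v n) ⁻¹' cell d, F n x := by
    have := hpres.setIntegral_preimage_emb (MeasurableEquiv.subRight (v n)).measurableEmbedding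
      (fun x => F n (x + v n)) (cell d)
    simpa only [cellVol, sub_add_cancel] using this.symm
  rw [Real.norm_eq_abs, htranslate]
  refine abs_setIntegral_sub_setIntegral_le (hpres.measurable measurableSet_cell)
    measurableSet_cell ?_ volume_cell_ne_top (hF n) (hM n)
  rw [hpres.measure_preimage measurableSet_cell.nullMeasurableSet]
  exact volume_cell_ne_top

theorem tendstoUniformly_add_right {G : Type*} [SeminormedAddCommGroup G] [CompactSpace G]
    (Ψ : C(G, ℝ)) {a : ℕ → G} (ha : Tendsto a atTop (𝓝 0)) :
    TendstoUniformly (fun n z => Ψ (z + a n)) Ψ atTop := by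
  rw [Metric.tendstoUniformly_iff]
  intro δ hδ
  obtain ⟨η, hη, hΨ⟩ := Metric.uniformContinuous_iff.1
    (CompactSpace.uniformContinuous_of_continuous Ψ.continuous) δ hδ
  filter_upwards [Metric.tendsto_nhds.1 ha η hη] with n hn z
  refine hΨ ?_
  simpa using hn

/-- The graph `x ↦ (x, x/ε)` of the fast variable, with values in `𝕋^d × 𝕋^d`. -/
def twoScaleMap (ε : ℝ) (x : Euc d) : Torus d × Torus d := (toTorus x, toTorus (ε⁻¹ • x))

@[fun_prop]
theorem continuous_twoScaleMap (ε : ℝ) :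
    Continuous (twoScaleMap ε : Euc d → Torus d × Torus d) := by
  unfold twoScaleMap
  fun_prop

theorem twoScaleMap_add_smul {ε : ℝ} (hε : ε ≠ 0) (x s : Euc d) :
    twoScaleMap ε (x + ε • s) = twoScaleMap ε x + (0, toTorus s) + (toTorus (ε • s), 0) := by
  simp [twoScaleMap, smul_add, smul_smul, inv_mul_cancel₀ hε, toTorus_add]

theorem integrable_continuousMap {X : Type*} [TopologicalSpace X] [CompactSpace X]
    [MeasurableSpace X] [OpensMeasurableSpace X] {μ : Measure X} [IsFiniteMeasure μ]
    (Ψ : C(X, ℝ)) : Integrable Ψ μ :=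
  (BoundedContinuousFunction.mkOfCompact Ψ).integrable μ

theorem tendsto_integral_twoScaleMap_add_sub {ε : ℕ → ℝ} (hε : ∀ n, ε n ≠ 0)
    (hε0 : Tendsto ε atTop (𝓝 0)) (Ψ : C(Torus d × Torus d, ℝ)) (s : Euc d) :
    Tendsto (fun n => ∫ x, Ψ (twoScaleMap (ε n) x + (0, toTorus s)) ∂cellVol d
      - ∫ x, Ψ (twoScaleMap (ε n) x) ∂cellVol d) atTop (𝓝 0) := by
  have hv : Tendsto (fun n => ε n • s) atTop (𝓝 0) := by simpa using hε0.smul_const s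
  have htranslate := tendsto_integral_translate_sub (F := fun n x => Ψ (twoScaleMap (ε n) x))
    (fun n => Continuous.aestronglyMeasurable (by fun_prop))
    (fun n x => Ψ.norm_coe_le_norm _) hv
  have hslow : Tendsto (fun n => ((toTorus (ε n • s), 0) : Torus d × Torus d)) atTop (𝓝 0) := by
    have hzero : (toTorus 0 : Torus d) = 0 := by
      ext
      simp [toTorus]
    have := (continuous_toTorus.tendsto (0 : Euc d)).comp hv
    rw [hzero] at this
    exact this.prodMk_nhds tendsto_const_nhds
  have huniform : Tendsto (fun n => ∫ x, (Ψ (twoScaleMap (ε n) x + (0, toTorus s))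
      - Ψ (twoScaleMap (ε n) (x + ε n • s))) ∂cellVol d) atTop (𝓝 0) := by
    rw [Metric.tendsto_nhds]
    intro δ hδ
    filter_upwards [Metric.tendstoUniformly_iff.1 (tendstoUniformly_add_right Ψ hslow) (δ / 2)
      (half_pos hδ)] with n hn
    have hle := norm_integral_le_of_norm_le_const (μ := cellVol d) (C := δ / 2)
      (f := fun x => Ψ (twoScaleMap (ε n) x + (0, toTorus s))
        - Ψ (twoScaleMap (ε n) (x + ε n • s)))
      (ae_of_all _ fun x => by
        rw [twoScaleMap_add_smul (hε n)]
        exact (hn _).le)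
    rw [probReal_univ, mul_one] at hle
    rw [dist_zero_right]
    linarith
  convert huniform.add htranslate using 2 with n
  · rw [integral_sub (integrable_cellVol_of_continuous (by fun_prop))
      (integrable_cellVol_of_continuous (by fun_prop))]
    ring
  · simp

theorem integral_integral_twoScaleMap_add (ε : ℝ) (Ψ : C(Torus d × Torus d, ℝ)) :
    ∫ s, ∫ x, Ψ (twoScaleMap ε x + (0, toTorus s)) ∂cellVol d ∂cellVol d
      = ∫ z, Ψ z ∂(volume.prod volume) := by
  have hc : Continuous (Function.uncurry fun (s x : Euc d) =>
      Ψ (twoScaleMap ε x + (0, toTorus s))) := by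
    simp only [Function.uncurry_def]
    fun_prop
  have hfast : ∀ x : Euc d, ∫ s, Ψ (twoScaleMap ε x + (0, toTorus s)) ∂cellVol d
      = ∫ b, Ψ (toTorus x, b) := by
    intro x
    simp only [twoScaleMap, Prod.mk_add_mk, add_zero]
    rw [integral_comp_measurePreserving measurePreserving_toTorus
      (f := fun b => Ψ (toTorus x, toTorus (ε⁻¹ • x) + b))
      (Continuous.aestronglyMeasurable (by fun_prop))]
    exact integral_add_left_eq_self (fun b => Ψ (toTorus x, b)) _
  have hΨ : Integrable Ψ ((volume : Measure (Torus d)).prod volume) := integrable_continuousMap Ψ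
  rw [integral_integral_swap (Integrable.of_bound hc.aestronglyMeasurable ‖Ψ‖
    (ae_of_all _ fun z => Ψ.norm_coe_le_norm _))]
  simp only [hfast]
  rw [integral_comp_measurePreserving measurePreserving_toTorus (f := fun a => ∫ b, Ψ (a, b))
    hΨ.integral_prod_left.aestronglyMeasurable, integral_prod _ hΨ]

/- A shift of the fast variable by `s` is a shift of `x` by the small vector `ε s`, up to a small
change of the slow variable. Hence it does not affect the limit, and neither does averaging
over `s`, after which the integral equals its expected limit for every `ε`. -/
theorem tendsto_integral_twoScaleMap {ε : ℕ → ℝ} (hε : ∀ n, ε n ≠ 0)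
    (hε0 : Tendsto ε atTop (𝓝 0)) (Ψ : C(Torus d × Torus d, ℝ)) :
    Tendsto (fun n => ∫ x, Ψ (twoScaleMap (ε n) x) ∂cellVol d) atTop
      (𝓝 (∫ z, Ψ z ∂(volume.prod volume))) := by
  let D : ℕ → Euc d → ℝ := fun n s => ∫ x, Ψ (twoScaleMap (ε n) x + (0, toTorus s)) ∂cellVol d
    - ∫ x, Ψ (twoScaleMap (ε n) x) ∂cellVol d
  have hshift_cont : ∀ n, Continuous fun s : Euc d =>
      ∫ x, Ψ (twoScaleMap (ε n) x + (0, toTorus s)) ∂cellVol d := fun n =>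
    continuous_of_dominated (bound := fun _ => ‖Ψ‖)
      (fun s => Continuous.aestronglyMeasurable (by fun_prop))
      (fun s => ae_of_all _ fun x => Ψ.norm_coe_le_norm _) (integrable_const _)
      (ae_of_all _ fun x => by fun_prop)
  have hΨ_le : ∀ f : Euc d → Torus d × Torus d, ‖∫ x, Ψ (f x) ∂cellVol d‖ ≤ ‖Ψ‖ := fun f => by
    simpa using norm_integral_le_of_norm_le_const (μ := cellVol d) (C := ‖Ψ‖)
      (f := fun x => Ψ (f x)) (ae_of_all _ fun x => Ψ.norm_coe_le_norm _)
  have hlim : Tendsto (fun n => ∫ s, D n s ∂cellVol d) atTop (𝓝 (∫ _, (0 : ℝ) ∂cellVol d)) :=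
    tendsto_integral_of_dominated_convergence (fun _ => ‖Ψ‖ + ‖Ψ‖)
      (fun n => ((hshift_cont n).sub continuous_const).aestronglyMeasurable) (integrable_const _)
      (fun n => ae_of_all _ fun s => (norm_sub_le _ _).trans (add_le_add (hΨ_le _) (hΨ_le _)))
      (ae_of_all _ fun s => tendsto_integral_twoScaleMap_add_sub hε hε0 Ψ s)
  have haverage : ∀ n, ∫ s, D n s ∂cellVol d
      = ∫ z, Ψ z ∂(volume.prod volume) - ∫ x, Ψ (twoScaleMap (ε n) x) ∂cellVol d := fun n => by
    simp only [D]
    rw [integral_sub (integrable_cellVol_of_continuous (hshift_cont n)) (integrable_const _),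
      integral_integral_twoScaleMap_add]
    simp
  simp only [haverage, integral_zero] at hlim
  simpa using (tendsto_const_nhds (x := ∫ z, Ψ z ∂(volume.prod volume))).sub hlim

/-! ### Weak limits of uniformly integrable sequences -/

theorem exists_strictMono_forall_tendsto {ι : Type*} [Countable ι] (a : ι → ℕ → ℝ)
    (ha : ∀ i, ∃ C, ∀ n, |a i n| ≤ C) :
    ∃ σ : ℕ → ℕ, StrictMono σ ∧ ∀ i, ∃ l, Tendsto (fun n => a i (σ n)) atTop (𝓝 l) := by
  choose C hC using ha
  have hcompact : IsCompact (Set.univ.pi fun i => Set.Icc (-C i) (C i)) :=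
    isCompact_univ_pi fun i => isCompact_Icc
  obtain ⟨l, -, σ, hσ, hl⟩ := hcompact.tendsto_subseq (x := fun n i => a i n)
    fun n i _ => abs_le.1 (hC i n)
  exact ⟨σ, hσ, fun i => ⟨l i, tendsto_pi_nhds.1 hl i⟩⟩

/-- The truncation of `t` to the interval `[-k, k]`. -/
def truncate (k t : ℝ) : ℝ := max (-k) (min t k)

@[fun_prop]
theorem continuous_truncate (k : ℝ) : Continuous (truncate k) := by
  unfold truncate
  fun_prop

theorem abs_truncate_le {k : ℝ} (hk : 0 ≤ k) (t : ℝ) : |truncate k t| ≤ k :=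
  abs_le.2 ⟨le_max_left _ _, max_le (by linarith) (min_le_right _ _)⟩

theorem truncate_of_abs_le {k t : ℝ} (h : |t| ≤ k) : truncate k t = t := by
  rw [abs_le] at h
  rw [truncate, min_eq_left h.2, max_eq_right h.1]

theorem tendsto_truncate (t : ℝ) : Tendsto (fun k : ℕ => truncate k t) atTop (𝓝 t) := by
  obtain ⟨N, hN⟩ := exists_nat_ge |t|
  refine tendsto_const_nhds.congr' (eventually_atTop.2 ⟨N, fun n hn => ?_⟩)
  exact (truncate_of_abs_le (hN.trans (by exact_mod_cast hn))).symm

theorem integrable_truncate_comp {Ω : Type*} [MeasurableSpace Ω] {P : Measure Ω}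
    [IsFiniteMeasure P] {w : Ω → ℝ} (hw : AEStronglyMeasurable w P)
    {k : ℝ} (hk : 0 ≤ k) : Integrable (fun x => truncate k (w x)) P :=
  .of_bound ((continuous_truncate k).comp_aestronglyMeasurable hw) k
    (ae_of_all _ fun x => abs_truncate_le hk (w x))

theorem exists_continuousMap_abs_le_one_mul_ge {X : Type*} [TopologicalSpace X]
    (g : C(X, ℝ)) {η : ℝ} (hη : 0 < η) :
    ∃ Ψ : C(X, ℝ), (∀ x, |Ψ x| ≤ 1) ∧ ∀ x, |g x| - η ≤ g x * Ψ x := by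
  have hpos : ∀ x, 0 < |g x| + η := fun x => by positivity
  refine ⟨⟨fun x => g x / (|g x| + η), g.continuous.div (by fun_prop) fun x => (hpos x).ne'⟩,
    fun x => ?_, fun x => ?_⟩
  · rw [ContinuousMap.coe_mk, abs_div, abs_of_pos (hpos x), div_le_one (hpos x)]
    linarith
  · change |g x| - η ≤ g x * (g x / (|g x| + η))
    rw [← mul_div_assoc, le_div_iff₀ (hpos x)]
    nlinarith [abs_mul_abs_self (g x)]

theorem abs_integral_mul_comp_le {Ω X : Type*} [MeasurableSpace Ω] {P : Measure Ω}
    [TopologicalSpace X] [CompactSpace X] {w : Ω → ℝ} (hw : Integrable w P) (φ : Ω → X)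
    (Ψ : C(X, ℝ)) :
    |∫ x, w x * Ψ (φ x) ∂P| ≤ (∫ x, |w x| ∂P) * ‖Ψ‖ := by
  rw [← integral_mul_const, ← Real.norm_eq_abs]
  refine norm_integral_le_of_norm_le (hw.abs.mul_const _) (ae_of_all _ fun x => ?_)
  rw [norm_mul]
  exact mul_le_mul_of_nonneg_left (Ψ.norm_coe_le_norm (φ x)) (norm_nonneg (w x))

section Duality

variable {Ω X : Type*} [MeasurableSpace Ω] {P : Measure Ω} [TopologicalSpace X] [CompactSpace X]
  [MeasurableSpace X] [BorelSpace X] {μ : Measure X}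

theorem integrable_mul_comp {w : Ω → ℝ} (hw : Integrable w P) {φ : Ω → X} (hφ : Measurable φ)
    (Ψ : C(X, ℝ)) : Integrable (fun x => w x * Ψ (φ x)) P :=
  hw.mul_bdd (c := ‖Ψ‖) (Ψ.continuous.measurable.comp hφ).aestronglyMeasurable
    (ae_of_all _ fun x => Ψ.norm_coe_le_norm (φ x))

theorem abs_integral_mul_comp_sub_le {v w : Ω → ℝ} (hv : Integrable v P) (hw : Integrable w P)
    {φ : Ω → X} (hφ : Measurable φ) (Ψ : C(X, ℝ)) :
    |∫ x, v x * Ψ (φ x) ∂P - ∫ x, w x * Ψ (φ x) ∂P| ≤ (∫ x, |v x - w x| ∂P) * ‖Ψ‖ := by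
  rw [← integral_sub (integrable_mul_comp hv hφ Ψ) (integrable_mul_comp hw hφ Ψ)]
  simpa only [Pi.sub_apply, sub_mul] using abs_integral_mul_comp_le (hv.sub hw) φ Ψ

theorem integral_abs_le_of_forall_continuousMap [IsProbabilityMeasure μ] [NormalSpace X]
    [μ.WeaklyRegular] {f : X → ℝ} (hf : Integrable f μ) {C : ℝ}
    (h : ∀ Ψ : C(X, ℝ), (∀ x, |Ψ x| ≤ 1) → ∫ x, f x * Ψ x ∂μ ≤ C) : ∫ x, |f x| ∂μ ≤ C := by
  refine le_of_forall_pos_le_add fun η hη => ?_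
  obtain ⟨g, hg, -⟩ := hf.exists_boundedContinuous_integral_sub_le (show 0 < η / 3 by positivity)
  obtain ⟨Ψ, hΨ, hgΨ⟩ := exists_continuousMap_abs_le_one_mul_ge g.toContinuousMap
    (show 0 < η / 3 by positivity)
  have hdiff : Integrable (fun x => |f x - g x|) μ := (hf.sub (g.integrable μ)).abs
  have hfΨ : Integrable (fun x => f x * Ψ x) μ := integrable_mul_comp hf measurable_id Ψ
  have hpointwise : ∀ x, |f x| ≤ f x * Ψ x + 2 * |f x - g x| + η / 3 := by
    intro x
    have hgΨx : |g x| - η / 3 ≤ g x * Ψ x := hgΨ x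
    have hmul : (g x - f x) * Ψ x ≤ |f x - g x| := by
      refine (le_abs_self _).trans ?_
      rw [abs_mul, abs_sub_comm]
      exact mul_le_of_le_one_right (abs_nonneg _) (hΨ x)
    linarith [abs_sub_abs_le_abs_sub (f x) (g x)]
  have hsum : Integrable (fun x => f x * Ψ x + 2 * |f x - g x|) μ := hfΨ.add (hdiff.const_mul 2)
  calc ∫ x, |f x| ∂μ ≤ ∫ x, (f x * Ψ x + 2 * |f x - g x| + η / 3) ∂μ :=
        integral_mono hf.abs (hsum.add (integrable_const _)) hpointwise
    _ = ∫ x, f x * Ψ x ∂μ + 2 * ∫ x, |f x - g x| ∂μ + η / 3 := by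
        rw [integral_add hsum (integrable_const _), integral_add hfΨ (hdiff.const_mul 2),
          integral_const_mul, integral_const, probReal_univ, one_smul]
    _ ≤ C + η := by
        have hg' : ∫ x, |f x - g x| ∂μ ≤ η / 3 := hg
        linarith [h Ψ hΨ]

theorem integral_abs_le_norm_toLp_two [IsProbabilityMeasure μ] (Ψ : C(X, ℝ)) :
    ∫ x, |Ψ x| ∂μ ≤ ‖ContinuousMap.toLp 2 μ ℝ Ψ‖ := by
  have hmeas : AEStronglyMeasurable Ψ μ := Ψ.continuous.aestronglyMeasurable
  have hone : ∫ x, |Ψ x| ∂μ = (eLpNorm Ψ 1 μ).toReal := by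
    rw [eLpNorm_one_eq_lintegral_enorm, ← integral_norm_eq_lintegral_enorm hmeas]
    rfl
  rw [hone, Lp.norm_def]
  refine ENNReal.toReal_mono (Lp.eLpNorm_ne_top _) ?_
  rw [eLpNorm_congr_ae (ContinuousMap.coeFn_toLp μ Ψ)]
  exact eLpNorm_le_eLpNorm_of_exponent_le one_le_two hmeas

theorem exists_memLp_two_of_abs_le_integral_abs [IsProbabilityMeasure μ]
    [μ.IsOpenPosMeasure] (L : C(X, ℝ) →ₗ[ℝ] ℝ) {k : ℝ}
    (hL : ∀ Ψ, |L Ψ| ≤ k * ∫ x, |Ψ x| ∂μ) :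
    ∃ W : X → ℝ, MemLp W 2 μ ∧ ∀ Ψ, L Ψ = ∫ x, W x * Ψ x ∂μ := by
  have hk : 0 ≤ k := by simpa using (abs_nonneg _).trans (hL 1)
  let toL2 : C(X, ℝ) →L[ℝ] Lp ℝ 2 μ := ContinuousMap.toLp 2 μ ℝ
  let e := LinearEquiv.ofInjective toL2.toLinearMap (ContinuousMap.toLp_injective μ)
  let l : LinearMap.range toL2.toLinearMap →L[ℝ] ℝ :=
    (L ∘ₗ e.symm.toLinearMap).mkContinuous k fun y => by
      obtain ⟨Ψ, rfl⟩ := e.surjective y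
      simp only [LinearMap.comp_apply, LinearEquiv.coe_coe, LinearEquiv.symm_apply_apply]
      exact (hL Ψ).trans (mul_le_mul_of_nonneg_left (integral_abs_le_norm_toLp_two Ψ) hk)
  obtain ⟨g, hg, -⟩ := exists_extension_norm_eq _ l
  let W := (InnerProductSpace.toDual ℝ (Lp ℝ 2 μ)).symm g
  refine ⟨W, Lp.memLp W, fun Ψ => ?_⟩
  have hextend : g (toL2 Ψ) = L Ψ := by
    have := hg (e Ψ)
    simp only [l, LinearMap.mkContinuous_apply, LinearMap.comp_apply, LinearEquiv.coe_coe,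
      LinearEquiv.symm_apply_apply] at this
    exact this
  have hriesz : inner ℝ W (toL2 Ψ) = g (toL2 Ψ) := by simp [W]
  rw [← hextend, ← hriesz, L2.inner_def]
  refine integral_congr_ae ?_
  filter_upwards [ContinuousMap.coeFn_toLp (p := 2) (𝕜 := ℝ) μ Ψ] with x hx
  rw [hx]
  simp [mul_comm]

end Duality

section WeakLimit

variable {Ω X : Type*} [MeasurableSpace Ω] {P : Measure Ω}
  [TopologicalSpace X] [CompactSpace X] [MeasurableSpace X] [BorelSpace X]
  {μ : Measure X} {φ : ℕ → Ω → X} {w : ℕ → Ω → ℝ} {W : X → ℝ}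

/-- The images under `φ n` of the signed measures `w n • P` converge weakly to `W • μ`. For
`φ n x = (x, x / ε n)` this is two-scale convergence, for a fixed `φ n` it is weak convergence. -/
def TendstoAlong (P : Measure Ω) (μ : Measure X) (φ : ℕ → Ω → X) (w : ℕ → Ω → ℝ) (W : X → ℝ) :
    Prop :=
  ∀ Ψ : C(X, ℝ), Tendsto (fun n => ∫ x, w n x * Ψ (φ n x) ∂P) atTop (𝓝 (∫ z, W z * Ψ z ∂μ))

theorem exists_tendsto_of_denseRange (hφ : ∀ n, Measurable (φ n)) (hw : ∀ n, Integrable (w n) P)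
    {C : ℝ} (hC : ∀ n, ∫ x, |w n x| ∂P ≤ C) {Ψ : ℕ → C(X, ℝ)} (hΨ : DenseRange Ψ)
    (h : ∀ j, ∃ l, Tendsto (fun n => ∫ x, w n x * Ψ j (φ n x) ∂P) atTop (𝓝 l)) (Φ : C(X, ℝ)) :
    ∃ l, Tendsto (fun n => ∫ x, w n x * Φ (φ n x) ∂P) atTop (𝓝 l) := by
  have hC0 : 0 ≤ C := (integral_nonneg fun x => abs_nonneg _).trans (hC 0)
  refine cauchySeq_tendsto_of_complete (Metric.cauchySeq_iff.2 fun δ hδ => ?_)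
  obtain ⟨j, hj⟩ := hΨ.exists_dist_lt Φ (ε := δ / (3 * (C + 1))) (by positivity)
  obtain ⟨l, hl⟩ := h j
  obtain ⟨N, hN⟩ := Metric.cauchySeq_iff.1 hl.cauchySeq (δ / 3) (by positivity)
  have hclose : ∀ n,
      dist (∫ x, w n x * Φ (φ n x) ∂P) (∫ x, w n x * Ψ j (φ n x) ∂P) < δ / 3 := by
    intro n
    rw [Real.dist_eq, ← integral_sub (integrable_mul_comp (hw n) (hφ n) Φ)
      (integrable_mul_comp (hw n) (hφ n) (Ψ j))]
    have hle := abs_integral_mul_comp_le (hw n) (φ n) (Φ - Ψ j)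
    simp only [ContinuousMap.sub_apply, mul_sub] at hle
    refine hle.trans_lt ?_
    rw [dist_eq_norm, lt_div_iff₀ (by positivity)] at hj
    nlinarith [norm_nonneg (Φ - Ψ j), hC n]
  refine ⟨N, fun a ha b hb => ?_⟩
  linarith [dist_triangle4_right (∫ x, w a x * Φ (φ a x) ∂P) (∫ x, w b x * Φ (φ b x) ∂P)
    (∫ x, w a x * Ψ j (φ a x) ∂P) (∫ x, w b x * Ψ j (φ b x) ∂P), hclose a, hclose b, hN a ha b hb]

theorem exists_tendstoAlong_of_abs_le [IsProbabilityMeasure μ] [μ.IsOpenPosMeasure]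
    [IsProbabilityMeasure P] (hφ : ∀ n, Measurable (φ n))
    (hlaw : ∀ Ψ : C(X, ℝ), Tendsto (fun n => ∫ x, Ψ (φ n x) ∂P) atTop (𝓝 (∫ z, Ψ z ∂μ)))
    (hw : ∀ n, Integrable (w n) P) {k : ℝ} (hk : ∀ n x, |w n x| ≤ k)
    (h : ∀ Ψ : C(X, ℝ), ∃ l, Tendsto (fun n => ∫ x, w n x * Ψ (φ n x) ∂P) atTop (𝓝 l)) :
    ∃ W, MemLp W 2 μ ∧ TendstoAlong P μ φ w W := by
  choose L hL using h
  let ℓ : C(X, ℝ) →ₗ[ℝ] ℝ :=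
    { toFun := L
      map_add' := fun Φ Ψ => by
        refine tendsto_nhds_unique (hL _) (((hL Φ).add (hL Ψ)).congr fun n => ?_)
        rw [← integral_add (integrable_mul_comp (hw n) (hφ n) Φ)
          (integrable_mul_comp (hw n) (hφ n) Ψ)]
        simp [mul_add]
      map_smul' := fun c Φ => by
        refine tendsto_nhds_unique (hL _) (((hL Φ).const_mul c).congr fun n => ?_)
        rw [← integral_const_mul]
        simp [mul_left_comm] }
  have hℓ : ∀ Φ, |ℓ Φ| ≤ k * ∫ z, |Φ z| ∂μ := by
    intro Φ
    refine le_of_tendsto_of_tendsto' (hL Φ).abs ((hlaw |Φ|).const_mul k) fun n => ?_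
    rw [← integral_const_mul, ← Real.norm_eq_abs]
    refine norm_integral_le_of_norm_le ?_ (ae_of_all _ fun x => ?_)
    · simpa using (integrable_mul_comp (integrable_const (1 : ℝ)) (hφ n) |Φ|).const_mul k
    · rw [norm_mul]
      exact mul_le_mul_of_nonneg_right (hk n x) (norm_nonneg _)
  obtain ⟨W, hW, hW_eq⟩ := exists_memLp_two_of_abs_le_integral_abs ℓ hℓ
  exact ⟨W, hW, fun Ψ => by rw [← hW_eq]; exact hL Ψ⟩

theorem TendstoAlong.integral_abs_sub_le [NormalSpace X] [IsProbabilityMeasure μ]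
    [μ.WeaklyRegular] {v : ℕ → Ω → ℝ} {V : X → ℝ} (hφ : ∀ n, Measurable (φ n))
    (hv : ∀ n, Integrable (v n) P) (hw : ∀ n, Integrable (w n) P) (hV : Integrable V μ)
    (hW : Integrable W μ)
    (hvV : TendstoAlong P μ φ v V) (hwW : TendstoAlong P μ φ w W) {c : ℝ}
    (hc : ∀ n, ∫ x, |v n x - w n x| ∂P ≤ c) : ∫ z, |V z - W z| ∂μ ≤ c := by
  refine integral_abs_le_of_forall_continuousMap (hV.sub hW) fun Ψ hΨ => ?_
  have hlim := (hvV Ψ).sub (hwW Ψ)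
  have hVΨ : Integrable (fun z => V z * Ψ z) μ := integrable_mul_comp hV measurable_id Ψ
  have hWΨ : Integrable (fun z => W z * Ψ z) μ := integrable_mul_comp hW measurable_id Ψ
  rw [← integral_sub hVΨ hWΨ] at hlim
  simp only [← sub_mul] at hlim
  refine le_of_tendsto' hlim fun n => (le_abs_self _).trans ?_
  refine (abs_integral_mul_comp_sub_le (hv n) (hw n) (hφ n) Ψ).trans ?_
  exact (mul_le_of_le_one_right (integral_nonneg fun x => abs_nonneg _)
    ((ContinuousMap.norm_le _ zero_le_one).2 hΨ)).trans (hc n)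

theorem exists_tendsto_integral_abs_sub {α : Type*} [MeasurableSpace α] {μ : Measure α}
    {W : ℕ → α → ℝ} (hW : ∀ k, Integrable (W k) μ) {δ : ℕ → ℝ} (hδ : Tendsto δ atTop (𝓝 0))
    (hWδ : ∀ k l, ∫ z, |W k z - W l z| ∂μ ≤ δ k + δ l) :
    ∃ W₀, StronglyMeasurable W₀ ∧ Integrable W₀ μ ∧
      Tendsto (fun k => ∫ z, |W k z - W₀ z| ∂μ) atTop (𝓝 0) := by
  have hcauchy : CauchySeq fun k => (hW k).toL1 (W k) := by
    refine Metric.cauchySeq_iff.2 fun η hη => ?_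
    obtain ⟨N, hN⟩ := eventually_atTop.1 (hδ.eventually (gt_mem_nhds (half_pos hη)))
    refine ⟨N, fun a ha b hb => ?_⟩
    rw [dist_eq_norm, ← Integrable.toL1_sub, L1.norm_of_fun_eq_integral_norm]
    exact (hWδ a b).trans_lt (by linarith [hN a ha, hN b hb])
  obtain ⟨W₀, hW₀⟩ := cauchySeq_tendsto_of_complete hcauchy
  refine ⟨W₀, Lp.stronglyMeasurable W₀, L1.integrable_coeFn W₀,
    (tendsto_iff_dist_tendsto_zero.1 hW₀).congr fun k => ?_⟩
  rw [dist_eq_norm, L1.norm_eq_integral_norm]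
  refine integral_congr_ae ?_
  filter_upwards [Lp.coeFn_sub ((hW k).toL1 (W k)) W₀, (hW k).coeFn_toL1] with z hsub hz
  rw [hsub, Pi.sub_apply, hz, Real.norm_eq_abs]

theorem TendstoAlong.of_integral_abs_sub_le {v : ℕ → ℕ → Ω → ℝ} {V : ℕ → X → ℝ} {δ : ℕ → ℝ}
    (hφ : ∀ n, Measurable (φ n)) (hv : ∀ k n, Integrable (v k n) P)
    (hw : ∀ n, Integrable (w n) P) (hV : ∀ k, Integrable (V k) μ) (hW : Integrable W μ)
    (hvV : ∀ k, TendstoAlong P μ φ (v k) (V k)) (hδ : Tendsto δ atTop (𝓝 0))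
    (hvw : ∀ k n, ∫ x, |v k n x - w n x| ∂P ≤ δ k)
    (hVW : Tendsto (fun k => ∫ z, |V k z - W z| ∂μ) atTop (𝓝 0)) : TendstoAlong P μ φ w W := by
  intro Ψ
  refine TendstoUniformly.tendsto_of_eventually_tendsto
    (F := fun k n => ∫ x, v k n x * Ψ (φ n x) ∂P) (L := fun k => ∫ z, V k z * Ψ z ∂μ)
    (p := atTop) ?_ (Eventually.of_forall fun k => hvV k Ψ) ?_
  · refine Metric.tendstoUniformly_iff.2 fun η hη => ?_
    have hδΨ : Tendsto (fun k => δ k * ‖Ψ‖) atTop (𝓝 0) := by simpa using hδ.mul_const ‖Ψ‖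
    filter_upwards [hδΨ.eventually (gt_mem_nhds hη)] with k hk n
    rw [dist_comm]
    exact ((abs_integral_mul_comp_sub_le (hv k n) (hw n) (hφ n) Ψ).trans
      (mul_le_mul_of_nonneg_right (hvw k n) (norm_nonneg Ψ))).trans_lt hk
  · refine tendsto_iff_dist_tendsto_zero.2 (squeeze_zero (fun _ => dist_nonneg) (fun k => ?_)
      (by simpa using hVW.mul_const ‖Ψ‖))
    exact abs_integral_mul_comp_sub_le (hV k) hW measurable_id Ψ

/- The truncations of `w n` at height `k` have bounded, hence square integrable, limits. By
`integral_abs_sub_le` these form a Cauchy sequence in `L¹` as `k → ∞`. -/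
theorem exists_tendstoAlong_of_truncate [IsProbabilityMeasure P] [NormalSpace X]
    [IsProbabilityMeasure μ] [μ.WeaklyRegular] (hφ : ∀ n, Measurable (φ n))
    (hw : ∀ n, Integrable (w n) P) {δ : ℕ → ℝ} (hδ : Tendsto δ atTop (𝓝 0))
    (hwδ : ∀ n (k : ℕ), ∫ x, |w n x - truncate k (w n x)| ∂P ≤ δ k) {Wk : ℕ → X → ℝ}
    (hWk : ∀ k, MemLp (Wk k) 2 μ)
    (hlim : ∀ k : ℕ, TendstoAlong P μ φ (fun n x => truncate k (w n x)) (Wk k)) :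
    ∃ W, StronglyMeasurable W ∧ Integrable W μ ∧ TendstoAlong P μ φ w W := by
  have htrunc : ∀ (k : ℕ) n, Integrable (fun x => truncate k (w n x)) P := fun k n =>
    integrable_truncate_comp (hw n).1 (Nat.cast_nonneg k)
  have hWk1 : ∀ k, Integrable (Wk k) μ := fun k => (hWk k).integrable one_le_two
  have hdist : ∀ (k l : ℕ) n,
      ∫ x, |truncate k (w n x) - truncate l (w n x)| ∂P ≤ δ k + δ l := by
    intro k l n
    have hk := ((hw n).sub (htrunc k n)).abs
    have hl := ((hw n).sub (htrunc l n)).abs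
    refine (integral_mono ((htrunc k n).sub (htrunc l n)).abs (hk.add hl) fun x => ?_).trans
      ((integral_add hk hl).trans_le (add_le_add (hwδ n k) (hwδ n l)))
    simpa only [Pi.add_apply, Pi.sub_apply, abs_sub_comm (truncate k (w n x)) (w n x)] using
      abs_sub_le (truncate k (w n x)) (w n x) (truncate l (w n x))
  obtain ⟨W, hW, hW1, hWlim⟩ := exists_tendsto_integral_abs_sub hWk1 hδ fun k l =>
    (hlim k).integral_abs_sub_le hφ (htrunc k) (htrunc l) (hWk1 k) (hWk1 l) (hlim l) (hdist k l)
  refine ⟨W, hW, hW1, .of_integral_abs_sub_le hφ htrunc hw hWk1 hW1 hlim hδ (fun k n => ?_) hWlim⟩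
  simpa only [abs_sub_comm] using hwδ n k

theorem exists_strictMono_forall_tendstoAlong [IsProbabilityMeasure P]
    [SecondCountableTopology X] [T2Space X] [IsProbabilityMeasure μ] [μ.IsOpenPosMeasure]
    [μ.WeaklyRegular] {ι : Type*} [Countable ι] (hφ : ∀ n, Measurable (φ n))
    (hlaw : ∀ Ψ : C(X, ℝ), Tendsto (fun n => ∫ x, Ψ (φ n x) ∂P) atTop (𝓝 (∫ z, Ψ z ∂μ)))
    {w : ι → ℕ → Ω → ℝ} (hw : ∀ i n, Integrable (w i n) P) {δ : ι → ℕ → ℝ}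
    (hδ : ∀ i, Tendsto (δ i) atTop (𝓝 0))
    (hwδ : ∀ i n (k : ℕ), ∫ x, |w i n x - truncate k (w i n x)| ∂P ≤ δ i k) :
    ∃ σ : ℕ → ℕ, StrictMono σ ∧ ∀ i, ∃ W, StronglyMeasurable W ∧ Integrable W μ ∧
      TendstoAlong P μ (fun n => φ (σ n)) (fun n => w i (σ n)) W := by
  let Ψ : ℕ → C(X, ℝ) := TopologicalSpace.denseSeq _
  have htrunc : ∀ i (k : ℕ) n, Integrable (fun x => truncate k (w i n x)) P := fun i k n =>
    integrable_truncate_comp (hw i n).1 (Nat.cast_nonneg k)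
  have hbound : ∀ i (k : ℕ) n, ∫ x, |truncate k (w i n x)| ∂P ≤ k := fun i k n => by
    simpa using integral_mono (htrunc i k n).abs (integrable_const (k : ℝ)) fun x =>
      abs_truncate_le (Nat.cast_nonneg k) (w i n x)
  obtain ⟨σ, hσ, hl⟩ := exists_strictMono_forall_tendsto (ι := ι × ℕ × ℕ)
    (fun p n => ∫ x, truncate p.2.1 (w p.1 n x) * Ψ p.2.2 (φ n x) ∂P) fun p =>
    ⟨p.2.1 * ‖Ψ p.2.2‖, fun n => (abs_integral_mul_comp_le (htrunc _ _ _) _ _).trans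
      (mul_le_mul_of_nonneg_right (hbound _ _ _) (norm_nonneg _))⟩
  refine ⟨σ, hσ, fun i => ?_⟩
  choose Wk hWk hlim using fun k : ℕ => exists_tendstoAlong_of_abs_le (fun n => hφ (σ n))
    (fun Ψ => (hlaw Ψ).comp hσ.tendsto_atTop) (fun n => htrunc i k (σ n))
    (fun n x => abs_truncate_le (Nat.cast_nonneg k) _)
    (exists_tendsto_of_denseRange (fun n => hφ (σ n)) (fun n => htrunc i k _)
      (fun n => hbound i k _) (TopologicalSpace.denseRange_denseSeq _) fun j => hl (i, k, j))
  exact exists_tendstoAlong_of_truncate (fun n => hφ (σ n)) (fun n => hw i _) (hδ i)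
    (fun n k => hwδ i _ k) hWk hlim

end WeakLimit

/-! ### Integrability of weak limits -/

theorem eLpNorm_le_of_integral_abs_pow_le {α : Type*} [MeasurableSpace α] {μ : Measure α}
    {f : α → ℝ} {p : ℕ} (hp : p ≠ 0) (hf : Integrable (fun x => |f x| ^ p) μ) {C : ℝ}
    (hC : ∫ x, |f x| ^ p ∂μ ≤ C) :
    eLpNorm f p μ ≤ ENNReal.ofReal C ^ (1 / (p : ℝ)) := by
  rw [eLpNorm_eq_lintegral_rpow_enorm_toReal (by exact_mod_cast hp) (ENNReal.natCast_ne_top p)]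
  simp only [ENNReal.toReal_natCast]
  gcongr
  calc ∫⁻ x, ‖f x‖ₑ ^ (p : ℝ) ∂μ = ∫⁻ x, ENNReal.ofReal (|f x| ^ p) ∂μ := by
        congr 1 with x
        rw [ENNReal.rpow_natCast, ← ofReal_norm, Real.norm_eq_abs,
          ENNReal.ofReal_pow (abs_nonneg _)]
    _ = ENNReal.ofReal (∫ x, |f x| ^ p ∂μ) :=
        (ofReal_integral_eq_lintegral_ofReal hf (ae_of_all _ fun x => by positivity)).symm
    _ ≤ ENNReal.ofReal C := ENNReal.ofReal_le_ofReal hC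

theorem exists_seq_continuousMap_tendsto_ae {X : Type*} [TopologicalSpace X] [NormalSpace X]
    [MeasurableSpace X] [BorelSpace X] {μ : Measure X} [IsFiniteMeasure μ] [μ.WeaklyRegular]
    {f : X → ℝ} (hf : AEStronglyMeasurable f μ) {M : ℝ} (hM : 0 ≤ M)
    (hfM : ∀ᵐ x ∂μ, |f x| ≤ M) :
    ∃ g : ℕ → C(X, ℝ), (∀ n x, |g n x| ≤ M) ∧
      ∀ᵐ x ∂μ, Tendsto (fun n => g n x) atTop (𝓝 (f x)) := by
  have hf1 : MemLp f 1 μ := memLp_one_iff_integrable.2 (.of_bound hf M hfM)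
  choose g hg hgm using fun n : ℕ => hf1.exists_boundedContinuous_eLpNorm_sub_le
    ENNReal.one_ne_top (ENNReal.inv_ne_zero.2 (ENNReal.natCast_ne_top n))
  have hlim : Tendsto (fun n => eLpNorm (⇑(g n) - f) 1 μ) atTop (𝓝 0) :=
    tendsto_of_tendsto_of_tendsto_of_le_of_le tendsto_const_nhds
      ENNReal.tendsto_inv_nat_nhds_zero (fun _ => zero_le)
      fun n => (eLpNorm_sub_comm _ _ _ _).trans_le (hg n)
  obtain ⟨ns, -, hns⟩ := (tendstoInMeasure_of_tendsto_eLpNorm one_ne_zero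
    (fun n => (hgm n).1) hf hlim).exists_seq_tendsto_ae
  refine ⟨fun n => ⟨fun x => truncate M (g (ns n) x),
    (continuous_truncate M).comp (g (ns n)).continuous⟩, fun n x => abs_truncate_le hM _, ?_⟩
  filter_upwards [hns, hfM] with x hx hxM
  have hlim := ((continuous_truncate M).tendsto (f x)).comp hx
  rwa [truncate_of_abs_le hxM] at hlim

theorem mul_pow_mul_sub_le_pow {q : ℕ} (hq : Odd q) (a b : ℝ) :
    (q + 1) * (b ^ q * a) - q * b ^ (q + 1) ≤ a ^ (q + 1) := by
  have heven : Even (q + 1) := hq.add_one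
  have habs : b ^ q * a ≤ |b| ^ q * |a| := by
    rw [← abs_pow, ← abs_mul]
    exact le_abs_self _
  have hnonneg : (q + 1) * (|b| ^ q * |a|) - q * |b| ^ (q + 1) ≤ |a| ^ (q + 1) := by
    rcases (abs_nonneg b).eq_or_lt with hb | hb
    · rw [← hb, zero_pow hq.pos.ne', zero_pow q.succ_ne_zero]
      simp
    · have hratio : -2 ≤ |a| / |b| - 1 := by linarith [div_nonneg (abs_nonneg a) hb.le]
      have hbernoulli := one_add_mul_le_pow hratio (q + 1)
      rw [add_sub_cancel, div_pow, le_div_iff₀ (by positivity)] at hbernoulli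
      refine le_of_eq_of_le ?_ hbernoulli
      push_cast
      field_simp
      ring
  rw [← heven.pow_abs a, ← heven.pow_abs b]
  linarith [mul_le_mul_of_nonneg_left habs (show (0 : ℝ) ≤ q + 1 by positivity)]

theorem truncate_pow_succ_le {q : ℕ} (hq : Odd q) {M : ℝ} (hM : 0 ≤ M) (t : ℝ) :
    truncate M t ^ (q + 1) ≤ truncate M t ^ q * t := by
  rw [pow_succ]
  rcases le_or_gt |t| M with h | h
  · rw [truncate_of_abs_le h]
  · unfold truncate
    rcases abs_cases t with ⟨ht, -⟩ | ⟨ht, -⟩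
    · rw [min_eq_right (by linarith), max_eq_right (by linarith)]
      exact mul_le_mul_of_nonneg_left (by linarith) (by positivity)
    · rw [min_eq_left (by linarith), max_eq_left (by linarith)]
      exact mul_le_mul_of_nonpos_left (by linarith) (hq.pow_nonpos (by linarith))

theorem memLp_of_integral_truncate_pow_le {α : Type*} [MeasurableSpace α] {μ : Measure α}
    [IsFiniteMeasure μ] {f : α → ℝ} (hf : AEStronglyMeasurable f μ) {p : ℕ} (hp : p ≠ 0) {C : ℝ}
    (hC : ∀ k : ℕ, ∫ x, |truncate k (f x)| ^ p ∂μ ≤ C) : MemLp f p μ := by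
  have htrunc : ∀ k : ℕ, AEStronglyMeasurable (fun x => truncate k (f x)) μ := fun k =>
    (continuous_truncate k).comp_aestronglyMeasurable hf
  have hbound : ∀ k : ℕ,
      eLpNorm (fun x => truncate k (f x)) p μ ≤ ENNReal.ofReal C ^ (1 / (p : ℝ)) := fun k => by
    refine eLpNorm_le_of_integral_abs_pow_le hp ?_ (hC k)
    refine .of_bound ((htrunc k).norm.pow p) ((k : ℝ) ^ p) (ae_of_all _ fun x => ?_)
    rw [norm_pow, Real.norm_eq_abs, abs_abs]
    gcongr
    exact abs_truncate_le (Nat.cast_nonneg k) _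
  refine ⟨hf, (Lp.eLpNorm_lim_le_liminf_eLpNorm htrunc f
    (ae_of_all _ fun x => tendsto_truncate (f x))).trans_lt ?_⟩
  have htop : ENNReal.ofReal C ^ (1 / (p : ℝ)) < ⊤ :=
    ENNReal.rpow_lt_top_of_nonneg (by positivity) ENNReal.ofReal_ne_top
  refine lt_of_le_of_lt (liminf_le_of_le (by isBoundedDefault) fun b hb => ?_) htop
  obtain ⟨k, hk⟩ := hb.exists
  exact hk.trans (hbound k)

theorem abs_mul_pow_mul_sub_le (q : ℕ) {a b M : ℝ} (hb : |b| ≤ M) :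
    |(q + 1) * (b ^ q * a) - q * b ^ (q + 1)|
      ≤ (q + 1) * (M ^ q * |a|) + q * M ^ (q + 1) := by
  refine (abs_sub _ _).trans (add_le_add ?_ ?_)
  · rw [abs_mul, abs_mul, abs_pow, abs_of_nonneg (by positivity : (0 : ℝ) ≤ q + 1)]
    gcongr
  · rw [abs_mul, abs_pow, Nat.abs_cast]
    gcongr

theorem integral_abs_truncate_pow_le {X : Type*} [TopologicalSpace X] [NormalSpace X]
    [MeasurableSpace X] [BorelSpace X] {μ : Measure X} [IsFiniteMeasure μ] [μ.WeaklyRegular]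
    {W : X → ℝ} (hW : Integrable W μ) {q : ℕ} (hq : Odd q) {C : ℝ}
    (hC : ∀ Ψ : C(X, ℝ), ∫ z, ((q + 1) * (Ψ z ^ q * W z) - q * Ψ z ^ (q + 1)) ∂μ ≤ C)
    {M : ℝ} (hM : 0 ≤ M) : ∫ z, |truncate M (W z)| ^ (q + 1) ∂μ ≤ C := by
  have hmeas : AEStronglyMeasurable (fun z => truncate M (W z)) μ :=
    (continuous_truncate M).comp_aestronglyMeasurable hW.1
  obtain ⟨g, hgM, hg⟩ := exists_seq_continuousMap_tendsto_ae hmeas hM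
    (ae_of_all _ fun z => abs_truncate_le hM _)
  have hdom : Integrable (fun z => (q + 1) * (M ^ q * |W z|) + q * M ^ (q + 1)) μ :=
    ((hW.abs.const_mul _).const_mul _).add (integrable_const _)
  have hlim : Tendsto (fun n => ∫ z, ((q + 1) * (g n z ^ q * W z) - q * g n z ^ (q + 1)) ∂μ) atTop
      (𝓝 (∫ z, ((q + 1) * (truncate M (W z) ^ q * W z) - q * truncate M (W z) ^ (q + 1)) ∂μ)) := by
    refine tendsto_integral_of_dominated_convergence _ (fun n => ?_) hdom
      (fun n => ae_of_all _ fun z => abs_mul_pow_mul_sub_le q (hgM n z)) ?_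
    · have := (g n).continuous.aestronglyMeasurable (μ := μ)
      exact (((this.pow q).mul hW.1).const_mul _).sub ((this.pow _).const_mul _)
    · filter_upwards [hg] with z hz
      exact (((hz.pow q).mul_const _).const_mul _).sub ((hz.pow _).const_mul _)
  refine (integral_mono_of_nonneg (ae_of_all _ fun z => by positivity) ?_ ?_).trans
    (le_of_tendsto' hlim fun n => hC (g n))
  · exact hdom.mono' ((((hmeas.pow q).mul hW.1).const_mul _).sub ((hmeas.pow _).const_mul _))
      (ae_of_all _ fun z => abs_mul_pow_mul_sub_le q (abs_truncate_le hM _))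
  · refine ae_of_all _ fun z => ?_
    simp only [hq.add_one.pow_abs]
    linarith [mul_le_mul_of_nonneg_left (truncate_pow_succ_le hq hM (W z))
      (show (0 : ℝ) ≤ q + 1 by positivity)]

section MemLpLimit

variable {Ω X : Type*} [MeasurableSpace Ω] {P : Measure Ω} [IsProbabilityMeasure P]
  [TopologicalSpace X] [CompactSpace X] [MeasurableSpace X] [BorelSpace X] {μ : Measure X}
  [IsProbabilityMeasure μ] {φ : ℕ → Ω → X} {w : ℕ → Ω → ℝ} {W : X → ℝ}

theorem TendstoAlong.integral_mul_pow_mul_sub_le (hφ : ∀ n, Measurable (φ n))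
    (hlaw : ∀ Ψ : C(X, ℝ), Tendsto (fun n => ∫ x, Ψ (φ n x) ∂P) atTop (𝓝 (∫ z, Ψ z ∂μ)))
    (hw : ∀ n, Integrable (w n) P) (hW : Integrable W μ) (h : TendstoAlong P μ φ w W) {q : ℕ}
    (hq : Odd q) (hwq : ∀ n, Integrable (fun x => w n x ^ (q + 1)) P) {C : ℝ}
    (hC : ∀ n, ∫ x, w n x ^ (q + 1) ∂P ≤ C) (Ψ : C(X, ℝ)) :
    ∫ z, ((q + 1) * (Ψ z ^ q * W z) - q * Ψ z ^ (q + 1)) ∂μ ≤ C := by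
  have hWΨ : Integrable (fun z => Ψ z ^ q * W z) μ := by
    simpa only [ContinuousMap.pow_apply, id_eq, mul_comm (W _)] using
      integrable_mul_comp hW measurable_id (Ψ ^ q)
  have hΨ : Integrable (fun z => Ψ z ^ (q + 1)) μ := integrable_continuousMap (Ψ ^ (q + 1))
  have hwΨ : ∀ n, Integrable (fun x => Ψ (φ n x) ^ q * w n x) P := fun n => by
    simpa only [ContinuousMap.pow_apply, mul_comm (w _ _)] using
      integrable_mul_comp (hw n) (hφ n) (Ψ ^ q)
  have hΨφ : ∀ n, Integrable (fun x => Ψ (φ n x) ^ (q + 1)) P := fun n => by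
    simpa using integrable_mul_comp (integrable_const (1 : ℝ)) (hφ n) (Ψ ^ (q + 1))
  rw [integral_sub (hWΨ.const_mul _) (hΨ.const_mul _), integral_const_mul, integral_const_mul]
  have hlim := ((h (Ψ ^ q)).const_mul (q + 1 : ℝ)).sub
    ((hlaw (Ψ ^ (q + 1))).const_mul (q : ℝ))
  simp only [ContinuousMap.pow_apply, mul_comm (w _ _), mul_comm (W _)] at hlim
  refine le_of_tendsto' hlim fun n => le_trans ?_ (hC n)
  rw [← integral_const_mul, ← integral_const_mul,
    ← integral_sub ((hwΨ n).const_mul _) ((hΨφ n).const_mul _)]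
  exact integral_mono (((hwΨ n).const_mul _).sub ((hΨφ n).const_mul _)) (hwq n) fun x =>
    mul_pow_mul_sub_le_pow hq (w n x) (Ψ (φ n x))

/- Passing to the limit in the tangent inequality `(q + 1) b^q a - q b^(q+1) ≤ a^(q+1)` with `a`
the values of `w n` and `b` those of a continuous function; then `b` approximates truncations
of `W`. -/
theorem TendstoAlong.memLp_natCast [NormalSpace X] [μ.WeaklyRegular] (hφ : ∀ n, Measurable (φ n))
    (hlaw : ∀ Ψ : C(X, ℝ), Tendsto (fun n => ∫ x, Ψ (φ n x) ∂P) atTop (𝓝 (∫ z, Ψ z ∂μ)))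
    (hw : ∀ n, Integrable (w n) P) (hW : Integrable W μ) (h : TendstoAlong P μ φ w W) {p : ℕ}
    (hp0 : p ≠ 0) (hp : Even p) (hwp : ∀ n, Integrable (fun x => w n x ^ p) P) {C : ℝ}
    (hC : ∀ n, ∫ x, w n x ^ p ∂P ≤ C) : MemLp W p μ := by
  obtain ⟨q, rfl⟩ := Nat.exists_eq_succ_of_ne_zero hp0
  have hq : Odd q := by simpa [Nat.even_add_one] using hp
  exact memLp_of_integral_truncate_pow_le hW.1 hp0 fun k =>
    integral_abs_truncate_pow_le hW hq
      (h.integral_mul_pow_mul_sub_le hφ hlaw hw hW hq hwp hC) (Nat.cast_nonneg k)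

end MemLpLimit

section PartialIntegral

variable {α β E : Type*} [MeasurableSpace α] [MeasurableSpace β] {μ : Measure α} {ν : Measure β}
  [IsProbabilityMeasure ν] [NormedAddCommGroup E] [NormedSpace ℝ E] {F : α × β → E} {q : ℝ≥0∞}

theorem eLpNorm_integral_le (hF : AEStronglyMeasurable F (μ.prod ν)) (hq1 : 1 ≤ q) (hq : q ≠ ⊤) :
    eLpNorm (fun a => ∫ b, F (a, b) ∂ν) q μ ≤ eLpNorm F q (μ.prod ν) := by
  have hq0 : q ≠ 0 := (zero_lt_one.trans_le hq1).ne'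
  rw [eLpNorm_eq_lintegral_rpow_enorm_toReal hq0 hq, eLpNorm_eq_lintegral_rpow_enorm_toReal hq0 hq]
  gcongr
  rw [lintegral_prod _ (hF.enorm.pow_const _)]
  refine lintegral_mono_ae ?_
  filter_upwards [hF.prodMk_left] with a ha
  have hnorm : ‖∫ b, F (a, b) ∂ν‖ₑ ≤ eLpNorm (fun b => F (a, b)) q ν := by
    refine (enorm_integral_le_lintegral_enorm _).trans ?_
    rw [← eLpNorm_one_eq_lintegral_enorm]
    exact eLpNorm_le_eLpNorm_of_exponent_le hq1 ha
  calc ‖∫ b, F (a, b) ∂ν‖ₑ ^ q.toReal ≤ eLpNorm (fun b => F (a, b)) q ν ^ q.toReal := by gcongr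
    _ = ∫⁻ b, ‖F (a, b)‖ₑ ^ q.toReal ∂ν := by
        rw [eLpNorm_eq_lintegral_rpow_enorm_toReal hq0 hq, ← ENNReal.rpow_mul,
          one_div, inv_mul_cancel₀ (ENNReal.toReal_pos hq0 hq).ne', ENNReal.rpow_one]

theorem memLp_integral_prod (hF : MemLp F q (μ.prod ν)) (hq1 : 1 ≤ q) (hq : q ≠ ⊤) :
    MemLp (fun a => ∫ b, F (a, b) ∂ν) q μ :=
  ⟨hF.1.integral_prod_right', (eLpNorm_integral_le hF.1 hq1 hq).trans_lt hF.2⟩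

end PartialIntegral

/-! ### Weak convergence against general test functions -/

theorem abs_integral_mul_le {α : Type*} [MeasurableSpace α] {μ : Measure α} {p p' : ℝ≥0∞}
    [p.HolderConjugate p'] {f g : α → ℝ} (hf : MemLp f p μ) (hg : MemLp g p' μ) :
    |∫ x, f x * g x ∂μ| ≤ (eLpNorm f p μ).toReal * (eLpNorm g p' μ).toReal := by
  rw [← ENNReal.toReal_mul, ← Real.norm_eq_abs, ← toReal_enorm]
  refine ENNReal.toReal_mono (ENNReal.mul_ne_top hf.2.ne hg.2.ne) ?_
  have hholder : eLpNorm (f • g) 1 μ ≤ eLpNorm f p μ * eLpNorm g p' μ :=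
    eLpNorm_smul_le_mul_eLpNorm hg.1 hf.1
  rw [eLpNorm_one_eq_lintegral_enorm] at hholder
  exact (enorm_integral_le_lintegral_enorm _).trans hholder

theorem tendsto_integral_mul_of_tendsto_eLpNorm {α : Type*} [MeasurableSpace α] {μ : Measure α}
    {p p' : ℝ≥0∞} [p.HolderConjugate p'] {f : ℕ → α → ℝ} {f₀ : α → ℝ} (hf : ∀ n, MemLp (f n) p μ)
    (hf₀ : MemLp f₀ p μ) {C : ℝ≥0∞} (hC : C ≠ ⊤) (hfC : ∀ n, eLpNorm (f n) p μ ≤ C)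
    {g : α → ℝ} {φ : ℕ → α → ℝ} (hg : MemLp g p' μ) (hφ : ∀ j, MemLp (φ j) p' μ)
    (hφg : Tendsto (fun j => eLpNorm (fun x => φ j x - g x) p' μ) atTop (𝓝 0))
    (h : ∀ j, Tendsto (fun n => ∫ x, f n x * φ j x ∂μ) atTop (𝓝 (∫ x, f₀ x * φ j x ∂μ))) :
    Tendsto (fun n => ∫ x, f n x * g x ∂μ) atTop (𝓝 (∫ x, f₀ x * g x ∂μ)) := by
  have hφg' : Tendsto (fun j => (eLpNorm (fun x => φ j x - g x) p' μ).toReal) atTop (𝓝 0) :=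
    (ENNReal.tendsto_toReal ENNReal.zero_ne_top).comp hφg
  have hdist : ∀ {F : α → ℝ} (_ : MemLp F p μ) (j : ℕ),
      dist (∫ x, F x * φ j x ∂μ) (∫ x, F x * g x ∂μ)
        ≤ (eLpNorm F p μ).toReal * (eLpNorm (fun x => φ j x - g x) p' μ).toReal := by
    intro F hF j
    have hFφ : Integrable (fun x => F x * φ j x) μ := hF.integrable_mul (hφ j)
    have hFg : Integrable (fun x => F x * g x) μ := hF.integrable_mul hg
    rw [Real.dist_eq, ← integral_sub hFφ hFg]
    simp only [← mul_sub]
    exact abs_integral_mul_le hF ((hφ j).sub hg)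
  refine TendstoUniformly.tendsto_of_eventually_tendsto (p := atTop)
    (F := fun j n => ∫ x, f n x * φ j x ∂μ) ?_ (Eventually.of_forall h) ?_
  · refine Metric.tendstoUniformly_iff.2 fun η hη => ?_
    have hlim := hφg'.const_mul C.toReal
    rw [mul_zero] at hlim
    filter_upwards [hlim.eventually (gt_mem_nhds hη)] with j hj n
    rw [dist_comm]
    refine ((hdist (hf n) j).trans ?_).trans_lt hj
    gcongr
    exact hfC n
  · exact tendsto_iff_dist_tendsto_zero.2 (squeeze_zero (fun _ => dist_nonneg) (hdist hf₀)
      (by simpa using hφg'.const_mul (eLpNorm f₀ p μ).toReal))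

theorem abs_integral_mul_le_add_truncate {α : Type*} [MeasurableSpace α] {μ : Measure α}
    [IsFiniteMeasure μ] {f h : α → ℝ} (hf : Integrable f μ) (hh : AEStronglyMeasurable h μ) {N : ℝ}
    (hN : ∀ᵐ x ∂μ, |h x| ≤ N) {k : ℝ} (hk : 0 ≤ k) :
    |∫ x, f x * h x ∂μ| ≤ k * ∫ x, |h x| ∂μ + N * ∫ x, |f x - truncate k (f x)| ∂μ := by
  have hh1 : Integrable (fun x => k * |h x|) μ := (Integrable.of_bound hh N hN).abs.const_mul k
  have htail : Integrable (fun x => N * |f x - truncate k (f x)|) μ :=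
    (hf.sub (integrable_truncate_comp hf.1 hk)).abs.const_mul N
  rw [← integral_const_mul, ← integral_const_mul, ← integral_add hh1 htail, ← Real.norm_eq_abs]
  refine norm_integral_le_of_norm_le (hh1.add htail) ?_
  filter_upwards [hN] with x hx
  have hsplit : |f x| ≤ k + |f x - truncate k (f x)| := by
    linarith [abs_truncate_le hk (f x), abs_sub_abs_le_abs_sub (f x) (truncate k (f x))]
  rw [norm_mul, Real.norm_eq_abs, Real.norm_eq_abs]
  nlinarith [abs_nonneg (h x), abs_nonneg (f x - truncate k (f x))]

theorem tendsto_integral_abs_sub_of_tendsto_ae {α : Type*} [MeasurableSpace α] {μ : Measure α}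
    [IsFiniteMeasure μ] {g : α → ℝ} {φ : ℕ → α → ℝ} (hg : AEStronglyMeasurable g μ)
    (hφ : ∀ j, AEStronglyMeasurable (φ j) μ) {C : ℝ} (hC : ∀ j, ∀ᵐ x ∂μ, |g x - φ j x| ≤ C)
    (hφg : ∀ᵐ x ∂μ, Tendsto (fun j => φ j x) atTop (𝓝 (g x))) :
    Tendsto (fun j => ∫ x, |g x - φ j x| ∂μ) atTop (𝓝 0) := by
  rw [← integral_zero α ℝ (μ := μ)]
  refine tendsto_integral_of_dominated_convergence (fun _ => C)
    (fun j => (hg.sub (hφ j)).norm) (integrable_const _) (fun j => ?_) ?_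
  · simpa only [Real.norm_eq_abs, abs_abs] using hC j
  · filter_upwards [hφg] with x hx
    simpa using (hx.const_sub (g x)).abs

theorem tendsto_integral_mul_of_truncate {α : Type*} [MeasurableSpace α] {μ : Measure α}
    [IsFiniteMeasure μ] {f : ℕ → α → ℝ} {f₀ : α → ℝ} (hf : ∀ n, Integrable (f n) μ)
    (hf₀ : Integrable f₀ μ) {δ : ℕ → ℝ} (hδ : Tendsto δ atTop (𝓝 0))
    (hfδ : ∀ n (k : ℕ), ∫ x, |f n x - truncate k (f n x)| ∂μ ≤ δ k)
    {g : α → ℝ} {φ : ℕ → α → ℝ} (hg : AEStronglyMeasurable g μ)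
    (hφ : ∀ j, AEStronglyMeasurable (φ j) μ) {N : ℝ} (hN : 0 ≤ N)
    (hgN : ∀ᵐ x ∂μ, |g x| ≤ N) (hφN : ∀ j, ∀ᵐ x ∂μ, |φ j x| ≤ N)
    (hφg : ∀ᵐ x ∂μ, Tendsto (fun j => φ j x) atTop (𝓝 (g x)))
    (h : ∀ j, Tendsto (fun n => ∫ x, f n x * φ j x ∂μ) atTop (𝓝 (∫ x, f₀ x * φ j x ∂μ))) :
    Tendsto (fun n => ∫ x, f n x * g x ∂μ) atTop (𝓝 (∫ x, f₀ x * g x ∂μ)) := by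
  have hsub : ∀ j, ∀ᵐ x ∂μ, |g x - φ j x| ≤ 2 * N := fun j => by
    filter_upwards [hgN, hφN j] with x hx hxj
    exact (abs_sub _ _).trans (by linarith)
  have hL1 := tendsto_integral_abs_sub_of_tendsto_ae hg hφ hsub hφg
  refine TendstoUniformly.tendsto_of_eventually_tendsto (p := atTop)
    (F := fun j n => ∫ x, f n x * φ j x ∂μ) ?_ (Eventually.of_forall h) ?_
  · refine Metric.tendstoUniformly_iff.2 fun η hη => ?_
    have hδN : Tendsto (fun k => 2 * N * δ k) atTop (𝓝 0) := by simpa using hδ.const_mul (2 * N)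
    obtain ⟨k, hk⟩ := (hδN.eventually (gt_mem_nhds (half_pos hη))).exists
    have hkL1 : Tendsto (fun j => k * ∫ x, |g x - φ j x| ∂μ) atTop (𝓝 0) := by
      simpa using hL1.const_mul (k : ℝ)
    filter_upwards [hkL1.eventually (gt_mem_nhds (half_pos hη))] with j hj n
    have hle := abs_integral_mul_le_add_truncate (hf n) (hg.sub (hφ j)) (hsub j)
      (Nat.cast_nonneg k)
    simp only [Pi.sub_apply, mul_sub] at hle
    rw [integral_sub ((hf n).mul_bdd hg hgN) ((hf n).mul_bdd (hφ j) (hφN j))] at hle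
    have htail : 2 * N * ∫ x, |f n x - truncate k (f n x)| ∂μ ≤ 2 * N * δ k :=
      mul_le_mul_of_nonneg_left (hfδ n k) (by positivity)
    rw [Real.dist_eq]
    linarith
  · refine tendsto_integral_of_dominated_convergence (fun x => |f₀ x| * N)
      (fun j => hf₀.1.mul (hφ j)) (hf₀.abs.mul_const _) (fun j => ?_) ?_
    · filter_upwards [hφN j] with x hx
      rw [norm_mul]
      exact mul_le_mul_of_nonneg_left hx (norm_nonneg _)
    · filter_upwards [hφg] with x hx
      exact hx.const_mul _

/-- The representative in `[0, 1)^d` of a point of the torus. -/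
def cellRepresentative (a : Torus d) : Euc d :=
  WithLp.toLp 2 fun i => (AddCircle.equivIco 1 0 (a i) : ℝ)

theorem measurable_cellRepresentative : Measurable (cellRepresentative : Torus d → Euc d) :=
  (PiLp.volume_preserving_toLp (Fin d)).measurable.comp <| measurable_pi_lambda _ fun i =>
    measurable_subtype_coe.comp
      ((AddCircle.measurableEquivIco 1 0).measurable.comp (measurable_pi_apply i))

theorem cellRepresentative_toTorus {x : Euc d} (hx : x ∈ cell d) :
    cellRepresentative (toTorus x) = x := by
  ext i
  have hxi : x i ∈ Set.Ico (0 : ℝ) (0 + 1) := by simpa using hx i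
  simp only [cellRepresentative, toTorus]
  rw [AddCircle.equivIco_coe_eq hxi]

theorem measurePreserving_cellRepresentative :
    MeasurePreserving (cellRepresentative : Torus d → Euc d) volume (cellVol d) := by
  refine ⟨measurable_cellRepresentative, ?_⟩
  rw [← measurePreserving_toTorus.map_eq,
    Measure.map_map measurable_cellRepresentative measurePreserving_toTorus.measurable]
  have hid : (cellRepresentative ∘ toTorus : Euc d → Euc d) =ᵐ[cellVol d] id := by
    filter_upwards [ae_mem_cell] with x hx
    exact cellRepresentative_toTorus hx
  rw [Measure.map_congr hid, Measure.map_id]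

theorem exists_seq_continuousMap_tendsto_eLpNorm {p : ℝ≥0∞} (hp : p ≠ ⊤) {g : Euc d → ℝ}
    (hg : MemLp g p (cellVol d)) :
    ∃ φ : ℕ → C(Torus d, ℝ),
      Tendsto (fun j => eLpNorm (fun x => φ j (toTorus x) - g x) p (cellVol d)) atTop (𝓝 0) := by
  have hG : MemLp (g ∘ cellRepresentative) p (volume : Measure (Torus d)) :=
    hg.comp_measurePreserving measurePreserving_cellRepresentative
  choose φ hφ hφm using fun n : ℕ => hG.exists_boundedContinuous_eLpNorm_sub_le hp
    (ENNReal.inv_ne_zero.2 (ENNReal.natCast_ne_top n))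
  refine ⟨fun n => (φ n).toContinuousMap, tendsto_of_tendsto_of_tendsto_of_le_of_le
    tendsto_const_nhds ENNReal.tendsto_inv_nat_nhds_zero (fun _ => zero_le) fun n => ?_⟩
  refine le_trans (le_of_eq ?_) (hφ n)
  rw [eLpNorm_sub_comm,
    ← eLpNorm_comp_measurePreserving ((hφm n).1.sub hG.1) measurePreserving_toTorus]
  refine eLpNorm_congr_ae ?_
  filter_upwards [ae_mem_cell] with x hx
  simp [cellRepresentative_toTorus hx]

theorem tendsto_integral_mul_of_memLp {p p' : ℝ≥0∞} [p.HolderConjugate p'] (hp' : p' ≠ ⊤)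
    {f : ℕ → Euc d → ℝ} {f₀ : Euc d → ℝ} (hf : ∀ n, MemLp (f n) p (cellVol d))
    (hf₀ : MemLp f₀ p (cellVol d)) {C : ℝ≥0∞} (hC : C ≠ ⊤)
    (hfC : ∀ n, eLpNorm (f n) p (cellVol d) ≤ C)
    (h : ∀ φ : C(Torus d, ℝ), Tendsto (fun n => ∫ x, f n x * φ (toTorus x) ∂cellVol d) atTop
      (𝓝 (∫ x, f₀ x * φ (toTorus x) ∂cellVol d)))
    {g : Euc d → ℝ} (hg : MemLp g p' (cellVol d)) :
    Tendsto (fun n => ∫ x, f n x * g x ∂cellVol d) atTop (𝓝 (∫ x, f₀ x * g x ∂cellVol d)) := by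
  obtain ⟨φ, hφ⟩ := exists_seq_continuousMap_tendsto_eLpNorm hp' hg
  exact tendsto_integral_mul_of_tendsto_eLpNorm hf hf₀ hC hfC hg
    (fun j => memLp_cellVol_of_continuous (by fun_prop) p') hφ fun j => h (φ j)

theorem tendsto_integral_mul_of_memLp_top {f : ℕ → Euc d → ℝ} {f₀ : Euc d → ℝ}
    (hf : ∀ n, Integrable (f n) (cellVol d)) (hf₀ : Integrable f₀ (cellVol d)) {δ : ℕ → ℝ}
    (hδ : Tendsto δ atTop (𝓝 0))
    (hfδ : ∀ n (k : ℕ), ∫ x, |f n x - truncate k (f n x)| ∂cellVol d ≤ δ k)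
    (h : ∀ φ : C(Torus d, ℝ), Tendsto (fun n => ∫ x, f n x * φ (toTorus x) ∂cellVol d) atTop
      (𝓝 (∫ x, f₀ x * φ (toTorus x) ∂cellVol d)))
    {g : Euc d → ℝ} (hg : MemLp g ⊤ (cellVol d)) :
    Tendsto (fun n => ∫ x, f n x * g x ∂cellVol d) atTop (𝓝 (∫ x, f₀ x * g x ∂cellVol d)) := by
  have hgM : ∀ᵐ x ∂cellVol d, |g x| ≤ (eLpNorm g ⊤ (cellVol d)).toReal := by
    filter_upwards [enorm_ae_le_eLpNormEssSup g (cellVol d)] with x hx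
    simpa using ENNReal.toReal_mono hg.2.ne (hx.trans_eq eLpNorm_exponent_top.symm)
  obtain ⟨φ, hφM, hφ⟩ := exists_seq_continuousMap_tendsto_ae
    (hg.1.comp_measurePreserving measurePreserving_cellRepresentative) ENNReal.toReal_nonneg
    (measurePreserving_cellRepresentative.quasiMeasurePreserving.ae hgM)
  refine tendsto_integral_mul_of_truncate hf hf₀ hδ hfδ hg.1
    (φ := fun j x => φ j (toTorus x)) (fun j => Continuous.aestronglyMeasurable (by fun_prop))
    ENNReal.toReal_nonneg hgM (fun j => ae_of_all _ fun x => hφM j _) ?_ fun j => h (φ j)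
  filter_upwards [measurePreserving_toTorus.quasiMeasurePreserving.ae hφ, ae_mem_cell] with x hx hxc
  simpa [cellRepresentative_toTorus hxc] using hx

/-! ### Two-scale limits of gradients are curl free in the fast variable -/

theorem partialDeriv_comm {u : Euc d → ℝ} (hu : ContDiff ℝ ∞ u) (i j : Fin d) (x : Euc d) :
    partialDeriv i (partialDeriv j u) x = partialDeriv j (partialDeriv i u) x := by
  have hd : Differentiable ℝ (fderiv ℝ u) :=
    (hu.fderiv_right (m := ∞) (by simp)).differentiable (by simp)
  have hsecond : ∀ i j : Fin d, partialDeriv i (partialDeriv j u) x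
      = fderiv ℝ (fderiv ℝ u) x (EuclideanSpace.single i 1) (EuclideanSpace.single j 1) := by
    intro i j
    have h := (hd x).hasFDerivAt.clm_apply (hasFDerivAt_const (EuclideanSpace.single j (1 : ℝ)) x)
    change fderiv ℝ (fun y => fderiv ℝ u y (EuclideanSpace.single j 1)) x
      (EuclideanSpace.single i 1) = _
    rw [h.fderiv]
    simp
  rw [hsecond, hsecond]
  exact second_derivative_symmetric (fun y => (hu.differentiable (by simp) y).hasFDerivAt)
    (hd x).hasFDerivAt _ _

theorem partialDeriv_comp_smul {θ : Euc d → ℝ} (hθ : Differentiable ℝ θ) (c : ℝ) (i : Fin d)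
    (x : Euc d) : partialDeriv i (fun x => θ (c • x)) x = c * partialDeriv i θ (c • x) := by
  have hsmul : HasFDerivAt (fun x : Euc d => c • x) (c • ContinuousLinearMap.id ℝ (Euc d)) x :=
    (hasFDerivAt_id x).const_smul c
  have hcomp : HasFDerivAt (fun x => θ (c • x)) _ x :=
    (hθ (c • x)).hasFDerivAt.comp x hsmul
  unfold partialDeriv
  rw [hcomp.fderiv]
  simp

theorem hasCompactSupport_partialDeriv {F : Euc d → ℝ} (hs : HasCompactSupport F) (i : Fin d) :
    HasCompactSupport (partialDeriv i F) :=
  hs.fderiv_apply (𝕜 := ℝ) _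

theorem integrable_partialDeriv_of_hasCompactSupport {F : Euc d → ℝ} (hF : ContDiff ℝ ∞ F)
    (hs : HasCompactSupport F) (i : Fin d) : Integrable (partialDeriv i F) :=
  (contDiff_partialDeriv hF i).continuous.integrable_of_hasCompactSupport
    (hasCompactSupport_partialDeriv hs i)

theorem integral_partialDeriv_eq_zero_of_hasCompactSupport {F : Euc d → ℝ} (hF : ContDiff ℝ ∞ F)
    (hs : HasCompactSupport F) (i : Fin d) : ∫ x, partialDeriv i F x = 0 := by
  have h := integral_mul_fderiv_eq_neg_fderiv_mul_of_integrable (μ := (volume : Measure (Euc d)))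
    (f := fun _ => (1 : ℝ)) (g := F) (v := EuclideanSpace.single i 1) (by simp)
    (by simpa using! integrable_partialDeriv_of_hasCompactSupport hF hs i)
    (by simpa using hF.continuous.integrable_of_hasCompactSupport hs)
    (fun x _ => by fun_prop) (fun x _ => hF.differentiable (by simp) x)
  simpa [partialDeriv] using h

section Curl

variable {u θ η : Euc d → ℝ}

theorem partialDeriv_mul_partialDeriv_sub (hu : ContDiff ℝ ∞ u) (hθ : ContDiff ℝ ∞ θ)
    (hη : ContDiff ℝ ∞ η) (c : ℝ) (i j : Fin d) (x : Euc d) :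
    partialDeriv i (fun x => θ (c • x) * η x * partialDeriv j u x) x
        - partialDeriv j (fun x => θ (c • x) * η x * partialDeriv i u x) x
      = c * ((partialDeriv j u x * partialDeriv i θ (c • x)
          - partialDeriv i u x * partialDeriv j θ (c • x)) * η x)
        + θ (c • x) * (partialDeriv i η x * partialDeriv j u x
          - partialDeriv j η x * partialDeriv i u x) := by
  have hθc : Differentiable ℝ fun x => θ (c • x) :=
    (hθ.comp (by fun_prop : ContDiff ℝ ∞ fun x : Euc d => c • x)).differentiable (by simp)
  have hη' := hη.differentiable (by simp)
  have hexpand : ∀ k l, partialDeriv l (fun x => θ (c • x) * η x * partialDeriv k u x) x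
      = (c * partialDeriv l θ (c • x) * η x + θ (c • x) * partialDeriv l η x) * partialDeriv k u x
        + θ (c • x) * η x * partialDeriv l (partialDeriv k u) x := fun k l => by
    rw [partialDeriv_mul ((hθc x).fun_mul (hη' x))
      ((contDiff_partialDeriv hu k).differentiable (by simp) x),
      partialDeriv_mul (hθc x) (hη' x), partialDeriv_comp_smul (hθ.differentiable (by simp))]
  rw [hexpand, hexpand, partialDeriv_comm hu i j]
  ring

theorem mul_integral_curl_mul (hu : ContDiff ℝ ∞ u) (hθ : ContDiff ℝ ∞ θ)
    (hη : ContDiff ℝ ∞ η) (hs : HasCompactSupport η) (c : ℝ) (i j : Fin d) :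
    c * ∫ x, (partialDeriv j u x * partialDeriv i θ (c • x)
        - partialDeriv i u x * partialDeriv j θ (c • x)) * η x
      = -∫ x, θ (c • x) * (partialDeriv i η x * partialDeriv j u x
          - partialDeriv j η x * partialDeriv i u x) := by
  have hθc : ContDiff ℝ ∞ fun x => θ (c • x) := hθ.comp (by fun_prop)
  have hu' := fun k => (contDiff_partialDeriv hu k)
  have hθ' := fun k => (contDiff_partialDeriv hθ k).continuous
  have hη' := fun k => (contDiff_partialDeriv hη k).continuous
  have hF : ∀ k, ContDiff ℝ ∞ fun x => θ (c • x) * η x * partialDeriv k u x := fun k =>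
    (hθc.mul hη).mul (hu' k)
  have hFs : ∀ k, HasCompactSupport fun x => θ (c • x) * η x * partialDeriv k u x := fun k =>
    hs.mul_left.mul_right
  have hzero : ∫ x, (partialDeriv i (fun x => θ (c • x) * η x * partialDeriv j u x) x
      - partialDeriv j (fun x => θ (c • x) * η x * partialDeriv i u x) x) = 0 := by
    rw [integral_sub (integrable_partialDeriv_of_hasCompactSupport (hF j) (hFs j) i)
        (integrable_partialDeriv_of_hasCompactSupport (hF i) (hFs i) j),
      integral_partialDeriv_eq_zero_of_hasCompactSupport (hF j) (hFs j),
      integral_partialDeriv_eq_zero_of_hasCompactSupport (hF i) (hFs i), sub_zero]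
  have hcurl : Integrable fun x => (partialDeriv j u x * partialDeriv i θ (c • x)
      - partialDeriv i u x * partialDeriv j θ (c • x)) * η x := by
    refine Continuous.integrable_of_hasCompactSupport ?_ hs.mul_left
    have hui := (hu' i).continuous
    have huj := (hu' j).continuous
    have hηc := hη.continuous
    fun_prop
  have hrest : Integrable fun x => θ (c • x) * (partialDeriv i η x * partialDeriv j u x
      - partialDeriv j η x * partialDeriv i u x) := by
    refine Continuous.integrable_of_hasCompactSupport ?_ (HasCompactSupport.mul_left ?_)
    · have hui := (hu' i).continuous
      have huj := (hu' j).continuous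
      have hθcc := hθ.continuous
      fun_prop
    · exact (hasCompactSupport_partialDeriv hs i).mul_right.sub
        (hasCompactSupport_partialDeriv hs j).mul_right
  simp only [partialDeriv_mul_partialDeriv_sub hu hθ hη] at hzero
  rw [integral_add (hcurl.const_mul c) hrest, integral_const_mul] at hzero
  linarith

end Curl

theorem integral_cellVol_of_tsupport_subset {f : Euc d → ℝ} (hf : tsupport f ⊆ cell d) :
    ∫ x, f x ∂cellVol d = ∫ x, f x :=
  setIntegral_eq_integral_of_forall_compl_eq_zero fun _ hx =>
    image_eq_zero_of_notMem_tsupport fun h => hx (hf h)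

theorem tsupport_partialDeriv_subset (f : Euc d → ℝ) (i : Fin d) :
    tsupport (partialDeriv i f) ⊆ tsupport f :=
  tsupport_fderiv_apply_subset ℝ (f := f) (EuclideanSpace.single i 1)

theorem abs_integral_curl_mul_le {u θ η : Euc d → ℝ} (hu : ContDiff ℝ ∞ u)
    (hθ : ContDiff ℝ ∞ θ) (hη : ContDiff ℝ ∞ η) (hs : HasCompactSupport η)
    (hsub : tsupport η ⊆ cell d) {ε : ℝ} (hε : 0 < ε) (i j : Fin d) {A B C : ℝ}
    (hA : ∀ x, |θ x| ≤ A) (hB : ∀ k x, |partialDeriv k η x| ≤ B)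
    (hC : ∀ k, ∫ x, |partialDeriv k u x| ∂cellVol d ≤ C) :
    |∫ x, (partialDeriv j u x * partialDeriv i θ (ε⁻¹ • x)
        - partialDeriv i u x * partialDeriv j θ (ε⁻¹ • x)) * η x ∂cellVol d|
      ≤ ε * (A * (B * C + B * C)) := by
  have hA0 : 0 ≤ A := (abs_nonneg _).trans (hA 0)
  have hB0 : 0 ≤ B := (abs_nonneg _).trans (hB i 0)
  have hu' : ∀ k, Integrable (fun x => |partialDeriv k u x|) (cellVol d) := fun k =>
    (integrable_cellVol_of_continuous (contDiff_partialDeriv hu k).continuous).abs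
  have hI := mul_integral_curl_mul hu hθ hη hs ε⁻¹ i j
  rw [← integral_cellVol_of_tsupport_subset ((tsupport_mul_subset_right).trans hsub),
    ← integral_cellVol_of_tsupport_subset, inv_mul_eq_iff_eq_mul₀ hε.ne'] at hI
  · rw [hI, abs_mul, abs_neg, abs_of_pos hε]
    gcongr
    calc |∫ x, θ (ε⁻¹ • x) * (partialDeriv i η x * partialDeriv j u x
            - partialDeriv j η x * partialDeriv i u x) ∂cellVol d|
        ≤ ∫ x, A * (B * |partialDeriv j u x| + B * |partialDeriv i u x|) ∂cellVol d := by
          rw [← Real.norm_eq_abs]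
          refine norm_integral_le_of_norm_le
            ((((hu' j).const_mul B).add ((hu' i).const_mul B)).const_mul A)
            (ae_of_all _ fun x => ?_)
          rw [norm_mul]
          refine mul_le_mul (hA _) ((norm_sub_le _ _).trans ?_) (norm_nonneg _) hA0
          rw [norm_mul, norm_mul]
          exact add_le_add (mul_le_mul_of_nonneg_right (hB i x) (norm_nonneg _))
            (mul_le_mul_of_nonneg_right (hB j x) (norm_nonneg _))
      _ = A * (B * ∫ x, |partialDeriv j u x| ∂cellVol d
            + B * ∫ x, |partialDeriv i u x| ∂cellVol d) := by
          rw [integral_const_mul, integral_add ((hu' j).const_mul _) ((hu' i).const_mul _),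
            integral_const_mul, integral_const_mul]
      _ ≤ A * (B * C + B * C) := by
          gcongr
          exacts [hC j, hC i]
  · refine (tsupport_mul_subset_right).trans ((tsupport_sub _ _).trans (Set.union_subset ?_ ?_))
    · exact (tsupport_mul_subset_left.trans (tsupport_partialDeriv_subset η i)).trans hsub
    · exact (tsupport_mul_subset_left.trans (tsupport_partialDeriv_subset η j)).trans hsub

/-- The open cell `(0, 1)^d`, which carries the test functions compactly supported in the cell. -/
def openCell (d : ℕ) : Set (Euc d) := {x | ∀ i, x i ∈ Set.Ioo (0 : ℝ) 1}

theorem isOpen_openCell : IsOpen (openCell d) := by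
  have hpre : openCell d = ⋂ i, (fun x : Euc d => x i) ⁻¹' Set.Ioo (0 : ℝ) 1 := by
    ext x
    simp [openCell]
  rw [hpre]
  exact isOpen_iInter_of_finite fun i => isOpen_Ioo.preimage (by fun_prop)

theorem openCell_subset_cell : openCell d ⊆ cell d := fun _ hx i => ⟨(hx i).1.le, (hx i).2⟩

theorem ae_mem_openCell : ∀ᵐ x ∂cellVol d, x ∈ openCell d := by
  have hne : ∀ i, ∀ᵐ x ∂cellVol d, x i ≠ 0 := by
    intro i
    refine ae_restrict_of_ae ?_
    have hpi : ∀ᵐ f : Fin d → ℝ, f i ≠ 0 := by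
      rw [ae_iff]
      simpa [volume_pi] using Measure.pi_hyperplane (fun _ : Fin d => (volume : Measure ℝ)) i 0
    exact (PiLp.volume_preserving_ofLp (Fin d)).quasiMeasurePreserving.ae hpi
  filter_upwards [ae_mem_cell, ae_all_iff.2 hne] with x hx hx0 i
  exact ⟨(hx i).1.lt_of_ne' (hx0 i), (hx i).2⟩

theorem ae_eq_zero_of_integral_mul_contDiff_eq_zero {f : Euc d → ℝ} (hf : Integrable f (cellVol d))
    (h : ∀ η : Euc d → ℝ, ContDiff ℝ ∞ η → HasCompactSupport η → tsupport η ⊆ cell d →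
      ∫ x, f x * η x ∂cellVol d = 0) : ∀ᵐ x ∂cellVol d, f x = 0 := by
  have hf' : IntegrableOn f (cell d) := hf
  have hae := isOpen_openCell.ae_eq_zero_of_integral_contDiff_smul_eq_zero
    (hf'.mono_set openCell_subset_cell).locallyIntegrableOn fun η hη hs hsub => by
      have hsub' := hsub.trans openCell_subset_cell
      rw [← integral_cellVol_of_tsupport_subset ((tsupport_smul_subset_left _ _).trans hsub')]
      simpa only [smul_eq_mul, mul_comm] using h η hη hs hsub'
  filter_upwards [ae_restrict_of_ae (s := cell d) hae, ae_mem_openCell] with x hx hxo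
  exact hx hxo

theorem integral_abs_le_toReal_eLpNorm {Ω : Type*} [MeasurableSpace Ω] {P : Measure Ω}
    [IsProbabilityMeasure P] {f : Ω → ℝ} {p : ℝ≥0∞} (hp : 1 ≤ p) (hf : MemLp f p P) :
    ∫ x, |f x| ∂P ≤ (eLpNorm f p P).toReal := by
  simp only [← Real.norm_eq_abs]
  rw [integral_norm_eq_lintegral_enorm hf.1, ← eLpNorm_one_eq_lintegral_enorm]
  exact ENNReal.toReal_mono hf.2.ne (eLpNorm_le_eLpNorm_of_exponent_le hp hf.1)

theorem integral_prod_toTorus {W : Torus d × Torus d → ℝ}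
    (hW : Integrable W (volume.prod volume)) :
    ∫ z, W z ∂volume.prod volume = ∫ x, (∫ b, W (toTorus x, b)) ∂cellVol d := by
  rw [integral_prod _ hW, integral_comp_measurePreserving measurePreserving_toTorus
    (f := fun a => ∫ b, W (a, b)) hW.integral_prod_left.aestronglyMeasurable]

theorem memLp_mul_continuousMap {α X : Type*} [MeasurableSpace α] {μ : Measure α}
    [TopologicalSpace X] [CompactSpace X] [MeasurableSpace X] [BorelSpace X] {p : ℝ≥0∞}
    {w : α → ℝ} (hw : MemLp w p μ) {φ : α → X} (hφ : Measurable φ) (Θ : C(X, ℝ)) :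
    MemLp (fun x => w x * Θ (φ x)) p μ := by
  refine hw.of_le_mul (c := ‖Θ‖)
    (hw.1.mul (Θ.continuous.measurable.comp hφ).aestronglyMeasurable) (ae_of_all _ fun x => ?_)
  rw [norm_mul, mul_comm]
  exact mul_le_mul_of_nonneg_right (Θ.norm_coe_le_norm _) (norm_nonneg _)

theorem eLpNorm_mul_continuousMap_le {α X : Type*} [MeasurableSpace α] (μ : Measure α)
    [TopologicalSpace X] [CompactSpace X] (p : ℝ≥0∞) (w : α → ℝ) (φ : α → X) (Θ : C(X, ℝ)) :
    eLpNorm (fun x => w x * Θ (φ x)) p μ ≤ ENNReal.ofReal ‖Θ‖ * eLpNorm w p μ := by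
  refine eLpNorm_le_mul_eLpNorm_of_ae_le_mul (ae_of_all _ fun x => ?_) p
  rw [norm_mul, mul_comm]
  exact mul_le_mul_of_nonneg_right (Θ.norm_coe_le_norm _) (norm_nonneg _)

section FastTest

variable {ε : ℕ → ℝ} {w : ℕ → Euc d → ℝ} {W : Torus d × Torus d → ℝ}

theorem TendstoAlong.integral_mul_fast_mul (hW : Integrable W (volume.prod volume))
    (h : TendstoAlong (cellVol d) (volume.prod volume) (fun n => twoScaleMap (ε n)) w W)
    (θ φ : C(Torus d, ℝ)) :
    Tendsto (fun n => ∫ x, w n x * θ (toTorus ((ε n)⁻¹ • x)) * φ (toTorus x) ∂cellVol d) atTop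
      (𝓝 (∫ x, (∫ b, W (toTorus x, b) * θ b) * φ (toTorus x) ∂cellVol d)) := by
  have hlim := h ⟨fun z => θ z.2 * φ z.1, by fun_prop⟩
  rw [integral_prod_toTorus (by simpa only [id_eq] using integrable_mul_comp hW measurable_id _)]
    at hlim
  simpa only [ContinuousMap.coe_mk, twoScaleMap, ← mul_assoc, integral_mul_const] using hlim

theorem memLp_integral_mul_continuousMap (hW : MemLp W 2 (volume.prod volume))
    (θ : C(Torus d, ℝ)) :
    MemLp (fun x => ∫ b, W (toTorus x, b) * θ b) 2 (cellVol d) :=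
  (memLp_integral_prod (F := fun z : Torus d × Torus d => W z * θ z.2)
    (memLp_mul_continuousMap hW measurable_snd θ) one_le_two
    ENNReal.ofNat_ne_top).comp_measurePreserving measurePreserving_toTorus

theorem TendstoAlong.integral_mul_fast_mul_continuous (hw : ∀ n, MemLp (w n) 2 (cellVol d))
    {C : ℝ≥0∞} (hC : C ≠ ⊤) (hwC : ∀ n, eLpNorm (w n) 2 (cellVol d) ≤ C)
    (hW : MemLp W 2 (volume.prod volume))
    (h : TendstoAlong (cellVol d) (volume.prod volume) (fun n => twoScaleMap (ε n)) w W)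
    (θ : C(Torus d, ℝ)) {η : Euc d → ℝ} (hη : Continuous η) :
    Tendsto (fun n => ∫ x, w n x * θ (toTorus ((ε n)⁻¹ • x)) * η x ∂cellVol d) atTop
      (𝓝 (∫ x, (∫ b, W (toTorus x, b) * θ b) * η x ∂cellVol d)) := by
  have hmeas : ∀ n, Measurable fun x : Euc d => toTorus ((ε n)⁻¹ • x) := fun n =>
    Continuous.measurable (by fun_prop)
  exact tendsto_integral_mul_of_memLp (p := 2) (p' := 2) ENNReal.ofNat_ne_top
    (fun n => memLp_mul_continuousMap (hw n) (hmeas n) θ) (memLp_integral_mul_continuousMap hW θ)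
    (ENNReal.mul_ne_top ENNReal.ofReal_ne_top hC)
    (fun n => (eLpNorm_mul_continuousMap_le _ _ _ _ θ).trans (by gcongr; exact hwC n))
    (h.integral_mul_fast_mul (hW.integrable one_le_two) θ) (memLp_cellVol_of_continuous hη 2)

end FastTest

theorem exists_bound_partialDeriv_of_hasCompactSupport {η : Euc d → ℝ} (hη : ContDiff ℝ ∞ η)
    (hs : HasCompactSupport η) : ∃ B, ∀ k x, |partialDeriv k η x| ≤ B := by
  choose B hB using fun k =>
    (contDiff_partialDeriv hη k).continuous.bounded_above_of_compact_support
      (hasCompactSupport_partialDeriv hs k)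
  exact ⟨∑ k, |B k|, fun k x => ((hB k x).trans (le_abs_self _)).trans
    (Finset.single_le_sum (fun k _ => abs_nonneg (B k)) (Finset.mem_univ k))⟩

theorem integral_mul_comp_toTorus {w : Torus d → ℝ} (hw : StronglyMeasurable w)
    (Θ : C(Torus d, ℝ)) :
    ∫ y, w (toTorus y) * Θ (toTorus y) ∂cellVol d = ∫ b, w b * Θ b :=
  integral_comp_measurePreserving measurePreserving_toTorus (f := fun b => w b * Θ b)
    (hw.mul Θ.continuous.stronglyMeasurable).aestronglyMeasurable

section CurlFree

variable {ε : ℕ → ℝ} {u : ℕ → Euc d → ℝ} {C : ℝ≥0∞} {W : Fin d → Torus d × Torus d → ℝ}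
  {θ : Euc d → ℝ}

theorem TendstoAlong.integral_curl_mul_eq_zero (hε : ∀ n, 0 < ε n) (hε0 : Tendsto ε atTop (𝓝 0))
    (hu : ∀ n, SmoothPeriodic (u n)) (hC : C ≠ ⊤)
    (huC : ∀ n i, eLpNorm (partialDeriv i (u n)) 2 (cellVol d) ≤ C)
    (hW : ∀ i, MemLp (W i) 2 (volume.prod volume))
    (h : ∀ i, TendstoAlong (cellVol d) (volume.prod volume) (fun n => twoScaleMap (ε n))
      (fun n => partialDeriv i (u n)) (W i))
    (hθ : SmoothPeriodic θ) {Θ : Fin d → C(Torus d, ℝ)}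
    (hΘ : ∀ k x, Θ k (toTorus x) = partialDeriv k θ x) (i j : Fin d) {η : Euc d → ℝ}
    (hη : ContDiff ℝ ∞ η) (hs : HasCompactSupport η) (hsub : tsupport η ⊆ cell d) :
    ∫ x, ((∫ b, W j (toTorus x, b) * Θ i b) - ∫ b, W i (toTorus x, b) * Θ j b) * η x
      ∂cellVol d = 0 := by
  have hLp : ∀ n k, MemLp (partialDeriv k (u n)) 2 (cellVol d) := fun n k =>
    memLp_cellVol_of_continuous ((hu n).partialDeriv k).continuous 2
  have hlim : ∀ k l, Tendsto (fun n => ∫ x, partialDeriv k (u n) x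
      * Θ l (toTorus ((ε n)⁻¹ • x)) * η x ∂cellVol d) atTop
      (𝓝 (∫ x, (∫ b, W k (toTorus x, b) * Θ l b) * η x ∂cellVol d)) := fun k l =>
    (h k).integral_mul_fast_mul_continuous (fun n => hLp n k) hC (fun n => huC n k) (hW k) (Θ l)
      hη.continuous
  have hint : ∀ k l, Integrable (fun x => (∫ b, W k (toTorus x, b) * Θ l b) * η x) (cellVol d) :=
    fun k l => (memLp_integral_mul_continuousMap (hW k) (Θ l)).integrable_mul
      (memLp_cellVol_of_continuous hη.continuous 2)
  obtain ⟨A, hA⟩ := hθ.periodic.exists_bound hθ.continuous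
  obtain ⟨B, hB⟩ := exists_bound_partialDeriv_of_hasCompactSupport hη hs
  have hbound : ∀ n, ‖∫ x, partialDeriv j (u n) x * Θ i (toTorus ((ε n)⁻¹ • x)) * η x ∂cellVol d
      - ∫ x, partialDeriv i (u n) x * Θ j (toTorus ((ε n)⁻¹ • x)) * η x ∂cellVol d‖
      ≤ ε n * (A * (B * C.toReal + B * C.toReal)) := by
    intro n
    have hintn : ∀ k l, Integrable (fun x => partialDeriv k (u n) x
        * Θ l (toTorus ((ε n)⁻¹ • x)) * η x) (cellVol d) := fun k l => by
      have huc := ((hu n).partialDeriv k).continuous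
      have hηc := hη.continuous
      exact integrable_cellVol_of_continuous (by fun_prop)
    rw [← integral_sub (hintn j i) (hintn i j)]
    simp only [hΘ, ← sub_mul]
    exact abs_integral_curl_mul_le (hu n).smooth hθ.smooth hη hs hsub (hε n) i j hA hB fun k =>
      (integral_abs_le_toReal_eLpNorm one_le_two (hLp n k)).trans
        (ENNReal.toReal_mono hC (huC n k))
  simp only [sub_mul]
  rw [integral_sub (hint j i) (hint i j)]
  refine tendsto_nhds_unique ((hlim j i).sub (hlim i j)) (squeeze_zero_norm hbound ?_)
  simpa using hε0.mul_const (A * (B * C.toReal + B * C.toReal))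

theorem TendstoAlong.ae_integral_mul_partialDeriv_eq (hε : ∀ n, 0 < ε n)
    (hε0 : Tendsto ε atTop (𝓝 0)) (hu : ∀ n, SmoothPeriodic (u n)) (hC : C ≠ ⊤)
    (huC : ∀ n i, eLpNorm (partialDeriv i (u n)) 2 (cellVol d) ≤ C)
    (hWm : ∀ i, StronglyMeasurable (W i)) (hW : ∀ i, MemLp (W i) 2 (volume.prod volume))
    (h : ∀ i, TendstoAlong (cellVol d) (volume.prod volume) (fun n => twoScaleMap (ε n))
      (fun n => partialDeriv i (u n)) (W i))
    (hθ : SmoothPeriodic θ) (i j : Fin d) :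
    ∀ᵐ x ∂cellVol d, ∫ y, W j (toTorus x, toTorus y) * partialDeriv i θ y ∂cellVol d
      = ∫ y, W i (toTorus x, toTorus y) * partialDeriv j θ y ∂cellVol d := by
  choose Θ hΘ using fun k => (hθ.partialDeriv k).periodic.exists_lift (hθ.partialDeriv k).continuous
  have hdescend : ∀ k l x, ∫ y, W k (toTorus x, toTorus y) * partialDeriv l θ y ∂cellVol d
      = ∫ b, W k (toTorus x, b) * Θ l b := fun k l x => by
    simp only [← hΘ]
    exact integral_mul_comp_toTorus ((hWm k).comp_measurable measurable_prodMk_left) (Θ l)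
  have hK := fun k l => memLp_integral_mul_continuousMap (hW k) (Θ l)
  filter_upwards [ae_eq_zero_of_integral_mul_contDiff_eq_zero
    (((hK j i).sub (hK i j)).integrable one_le_two) fun η hη hs hsub =>
      TendstoAlong.integral_curl_mul_eq_zero hε hε0 hu hC huC hW h hθ hΘ i j hη hs hsub] with x hx
  rw [hdescend, hdescend]
  exact sub_eq_zero.1 hx

end CurlFree

/-- The law of a pair `(s, t)` with `s` uniform in the cell and `t` uniform in `(0, 1]`; it
parametrizes the points `t s` of the segments joining the origin to the points of the cell. -/
def rayVol (d : ℕ) : Measure (Euc d × ℝ) :=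
  (cellVol d).prod (volume.restrict (Set.Ioc (0 : ℝ) 1))

instance : IsProbabilityMeasure (rayVol d) := by
  have : IsProbabilityMeasure (volume.restrict (Set.Ioc (0 : ℝ) 1)) := ⟨by simp⟩
  unfold rayVol
  infer_instance

theorem ae_rayVol_fst_mem_cell : ∀ᵐ p ∂rayVol d, p.1 ∈ cell d :=
  Measure.quasiMeasurePreserving_fst.ae ae_mem_cell

/-- The average over `s` in the cell of the line integrals of the field `k` along the segments from
`g - s` to `g`, a potential of `k` when `k` is curl-free with mean zero. The segments are mapped to
the group `G` by `σ`, so that the same formula serves on `ℝ^d` and on the torus. -/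
def rayPotential {G : Type*} [Sub G] (σ : Euc d × ℝ → G) (k : Fin d → G → ℝ) (g : G) : ℝ :=
  ∫ p, ∑ i, k i (g - σ p) * p.1 i ∂rayVol d

theorem eq_sum_smul_proj (L : Euc d →L[ℝ] ℝ) :
    L = ∑ j, L (EuclideanSpace.single j 1) • (EuclideanSpace.proj j : Euc d →L[ℝ] ℝ) := by
  ext v
  conv_lhs => rw [← (EuclideanSpace.basisFun (Fin d) ℝ).sum_repr v]
  simp [mul_comm]

theorem SmoothPeriodic.exists_bound_fderiv {f : Euc d → ℝ} (hf : SmoothPeriodic f) :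
    ∃ C, ∀ x, ‖fderiv ℝ f x‖ ≤ C := by
  have hg := hf.continuous_gradient
  obtain ⟨C, hC⟩ := (hf.periodic.gradient.comp norm).exists_bound (by fun_prop)
  exact ⟨C, fun x => by rw [← norm_gradient]; simpa using hC x⟩

section SmoothField

variable {h : Fin d → Euc d → ℝ}

/-- The derivative in `y` of the integrand of `rayPotential` on `ℝ^d`. -/
def rayDeriv (h : Fin d → Euc d → ℝ) (y : Euc d) (p : Euc d × ℝ) : Euc d →L[ℝ] ℝ :=
  ∑ i, p.1 i • fderiv ℝ (h i) (y - p.2 • p.1)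

theorem continuous_rayDeriv (hh : ∀ i, SmoothPeriodic (h i)) (y : Euc d) :
    Continuous (rayDeriv h y) := by
  have hhf : ∀ i, Continuous (fderiv ℝ (h i)) := fun i => (hh i).smooth.continuous_fderiv (by simp)
  unfold rayDeriv
  fun_prop

theorem exists_bound_rayDeriv (hh : ∀ i, SmoothPeriodic (h i)) :
    ∃ C, ∀ y, ∀ p : Euc d × ℝ, p.1 ∈ cell d → ‖rayDeriv h y p‖ ≤ C := by
  choose C hC using fun i => (hh i).exists_bound_fderiv
  refine ⟨∑ i, C i, fun y p hp => (norm_sum_le _ _).trans (Finset.sum_le_sum fun i _ => ?_)⟩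
  rw [norm_smul]
  exact (mul_le_of_le_one_left (norm_nonneg _) (abs_le_one_of_mem_cell hp i)).trans (hC i _)

theorem integrable_rayDeriv (hh : ∀ i, SmoothPeriodic (h i)) (y : Euc d) :
    Integrable (rayDeriv h y) (rayVol d) := by
  obtain ⟨C, hC⟩ := exists_bound_rayDeriv hh
  refine Integrable.of_bound (continuous_rayDeriv hh y).aestronglyMeasurable C ?_
  filter_upwards [ae_rayVol_fst_mem_cell] with p hp using hC y p hp

theorem integrable_sum_mul_ray (hh : ∀ i, SmoothPeriodic (h i)) (y : Euc d) :
    Integrable (fun p => ∑ i, h i (y - p.2 • p.1) * p.1 i) (rayVol d) := by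
  have hhc : ∀ i, Continuous (h i) := fun i => (hh i).continuous
  choose B hB using fun i => (hh i).periodic.exists_bound (hhc i)
  refine Integrable.of_bound (Continuous.aestronglyMeasurable (by fun_prop)) (∑ i, B i) ?_
  filter_upwards [ae_rayVol_fst_mem_cell] with p hp
  refine (norm_sum_le _ _).trans (Finset.sum_le_sum fun i _ => ?_)
  rw [norm_mul]
  exact (mul_le_of_le_one_right (norm_nonneg _) (abs_le_one_of_mem_cell hp i)).trans (hB i _)

theorem hasFDerivAt_rayPotential_integral (hh : ∀ i, SmoothPeriodic (h i)) (y : Euc d) :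
    HasFDerivAt (rayPotential (fun p => p.2 • p.1) h) (∫ p, rayDeriv h y p ∂rayVol d) y := by
  obtain ⟨C, hC⟩ := exists_bound_rayDeriv hh
  refine hasFDerivAt_integral_of_dominated_of_fderiv_le (s := Set.univ) (bound := fun _ => C)
    univ_mem (Eventually.of_forall fun x => (integrable_sum_mul_ray hh x).1)
    (integrable_sum_mul_ray hh y) (continuous_rayDeriv hh y).aestronglyMeasurable ?_
    (integrable_const _) (ae_of_all _ fun p x _ => HasFDerivAt.fun_sum fun i _ => ?_)
  · filter_upwards [ae_rayVol_fst_mem_cell] with p hp x _ using hC x p hp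
  · have hcomp : HasFDerivAt (fun x => h i (x - p.2 • p.1))
        (fderiv ℝ (h i) (x - p.2 • p.1)) x := by
      simpa using! ((hh i).differentiable (x - p.2 • p.1)).hasFDerivAt.comp x
        ((hasFDerivAt_id x).sub_const (p.2 • p.1))
    exact hcomp.mul_const (p.1 i)

theorem rayDeriv_single (hcurl : ∀ i j x, partialDeriv i (h j) x = partialDeriv j (h i) x)
    (y : Euc d) (p : Euc d × ℝ) (j : Fin d) :
    rayDeriv h y p (EuclideanSpace.single j 1) = fderiv ℝ (h j) (y - p.2 • p.1) p.1 := by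
  rw [eq_sum_smul_proj (fderiv ℝ (h j) _)]
  simp only [rayDeriv, sum_apply, smul_apply, smul_eq_mul, PiLp.proj_apply]
  exact Finset.sum_congr rfl fun i _ => by rw [mul_comm]; exact congrArg (· * _) (hcurl j i _)

theorem setIntegral_fderiv_ray {f : Euc d → ℝ} (hf : ContDiff ℝ 1 f) (y s : Euc d) :
    ∫ t in Set.Ioc (0 : ℝ) 1, fderiv ℝ f (y - t • s) s = f y - f (y - s) := by
  have hseg := sub_eq_intervalIntegral_fderiv hf y (-s)
  rw [intervalIntegral.integral_of_le zero_le_one] at hseg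
  simp only [smul_neg, ← sub_eq_add_neg, map_neg] at hseg
  rw [integral_neg] at hseg
  linarith

theorem integral_fderiv_ray {f : Euc d → ℝ} (hf : SmoothPeriodic f)
    (hmean : ∫ x, f x ∂cellVol d = 0) {y : Euc d}
    (hi : Integrable (fun p : Euc d × ℝ => fderiv ℝ f (y - p.2 • p.1) p.1) (rayVol d)) :
    ∫ p, fderiv ℝ f (y - p.2 • p.1) p.1 ∂rayVol d = f y := by
  have hfc := hf.continuous
  unfold rayVol at hi ⊢
  rw [integral_prod _ hi]
  simp only [setIntegral_fderiv_ray hf.contDiff_one]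
  rw [integral_sub (integrable_const _) (integrable_cellVol_of_continuous (by fun_prop)),
    hf.periodic.integral_sub hfc, hmean]
  simp

theorem hasFDerivAt_rayPotential (hh : ∀ i, SmoothPeriodic (h i))
    (hcurl : ∀ i j x, partialDeriv i (h j) x = partialDeriv j (h i) x)
    (hmean : ∀ i, ∫ x, h i x ∂cellVol d = 0) (y : Euc d) :
    HasFDerivAt (rayPotential (fun p => p.2 • p.1) h)
      (∑ j, h j y • (EuclideanSpace.proj j : Euc d →L[ℝ] ℝ)) y := by
  have hint := integrable_rayDeriv hh y
  have hcomp : ∀ j, (∫ p, rayDeriv h y p ∂rayVol d) (EuclideanSpace.single j 1) = h j y := by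
    intro j
    have hj := hint.apply_continuousLinearMap (EuclideanSpace.single j 1)
    rw [ContinuousLinearMap.integral_apply hint]
    simp only [rayDeriv_single hcurl] at hj ⊢
    exact integral_fderiv_ray (hh j) (hmean j) hj
  simpa only [← hcomp, ← eq_sum_smul_proj] using hasFDerivAt_rayPotential_integral hh y

theorem smoothPeriodic_rayPotential (hh : ∀ i, SmoothPeriodic (h i))
    (hcurl : ∀ i j x, partialDeriv i (h j) x = partialDeriv j (h i) x)
    (hmean : ∀ i, ∫ x, h i x ∂cellVol d = 0) :
    SmoothPeriodic (rayPotential (fun p => p.2 • p.1) h) := by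
  have hderiv := hasFDerivAt_rayPotential hh hcurl hmean
  refine ⟨contDiff_infty_iff_fderiv.2 ⟨fun y => (hderiv y).differentiableAt, ?_⟩, fun i x => ?_⟩
  · rw [funext fun y => (hderiv y).fderiv]
    exact ContDiff.sum fun j _ => (hh j).smooth.smul contDiff_const
  · simp only [rayPotential, add_sub_right_comm, (hh _).periodic i]

theorem gradient_rayPotential (hh : ∀ i, SmoothPeriodic (h i))
    (hcurl : ∀ i j x, partialDeriv i (h j) x = partialDeriv j (h i) x)
    (hmean : ∀ i, ∫ x, h i x ∂cellVol d = 0) (y : Euc d) (i : Fin d) :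
    gradient (rayPotential (fun p => p.2 • p.1) h) y i = h i y := by
  rw [gradient_apply, partialDeriv, (hasFDerivAt_rayPotential hh hcurl hmean y).fderiv]
  simp

end SmoothField

theorem SmoothPeriodic.sum {ι : Type*} {f : ι → Euc d → ℝ} (hf : ∀ l, SmoothPeriodic (f l))
    (s : Finset ι) : SmoothPeriodic fun x => ∑ l ∈ s, f l x :=
  ⟨ContDiff.sum fun l _ => (hf l).smooth, fun i x => Finset.sum_congr rfl fun l _ =>
    (hf l).periodic i x⟩

/-- `κ` is a separated kernel: `κ (z - y)` is a finite sum of products of smooth periodic functions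
of `z` and of `y`. Convolution with such a kernel only involves finitely many test functions,
whatever the point at which it is evaluated. -/
def Separated (κ : Euc d → ℝ) : Prop :=
  ∃ (ι : Type) (_ : Fintype ι) (a b : ι → Euc d → ℝ), (∀ l, SmoothPeriodic (a l)) ∧
    (∀ l, SmoothPeriodic (b l)) ∧ ∀ z y, κ (z - y) = ∑ l, a l z * b l y

theorem Separated.const (c : ℝ) : Separated fun _ : Euc d => c :=
  ⟨Unit, inferInstance, fun _ _ => c, fun _ _ => 1, fun _ => SmoothPeriodic.const c,
    fun _ => SmoothPeriodic.const 1, fun z y => by simp⟩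

theorem Separated.add {κ κ' : Euc d → ℝ} (h : Separated κ) (h' : Separated κ') :
    Separated fun x => κ x + κ' x := by
  obtain ⟨ι, _, a, b, ha, hb, hκ⟩ := h
  obtain ⟨ι', _, a', b', ha', hb', hκ'⟩ := h'
  refine ⟨ι ⊕ ι', inferInstance, Sum.elim a a', Sum.elim b b', ?_, ?_, fun z y => ?_⟩
  · rintro (l | l)
    exacts [ha l, ha' l]
  · rintro (l | l)
    exacts [hb l, hb' l]
  · simp [hκ, hκ']

theorem Separated.mul {κ κ' : Euc d → ℝ} (h : Separated κ) (h' : Separated κ') :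
    Separated fun x => κ x * κ' x := by
  obtain ⟨ι, _, a, b, ha, hb, hκ⟩ := h
  obtain ⟨ι', _, a', b', ha', hb', hκ'⟩ := h'
  refine ⟨ι × ι', inferInstance, fun l x => a l.1 x * a' l.2 x, fun l x => b l.1 x * b' l.2 x,
    fun l => (ha _).mul (ha' _), fun l => (hb _).mul (hb' _), fun z y => ?_⟩
  simp only [hκ, hκ', Finset.sum_mul_sum, Fintype.sum_prod_type]
  exact Finset.sum_congr rfl fun l _ => Finset.sum_congr rfl fun l' _ => by ring

theorem Separated.pow {κ : Euc d → ℝ} (h : Separated κ) (n : ℕ) : Separated fun x => κ x ^ n := by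
  induction n with
  | zero => simpa using Separated.const (d := d) 1
  | succ n ih => simpa only [pow_succ] using ih.mul h

theorem Separated.sum {ι : Type*} {κ : ι → Euc d → ℝ} (h : ∀ i, Separated (κ i)) (s : Finset ι) :
    Separated fun x => ∑ i ∈ s, κ i x := by
  classical
  induction s using Finset.induction_on with
  | empty => simpa using Separated.const (d := d) 0
  | insert i s hi ih => simpa only [Finset.sum_insert hi] using (h i).add ih

theorem smoothPeriodic_cos (i : Fin d) :
    SmoothPeriodic fun x : Euc d => Real.cos (2 * Real.pi * x i) := by
  refine ⟨by fun_prop, fun j x => ?_⟩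
  by_cases hij : i = j
  · subst hij
    simp [mul_add]
  · simp [hij]

theorem smoothPeriodic_sin (i : Fin d) :
    SmoothPeriodic fun x : Euc d => Real.sin (2 * Real.pi * x i) := by
  refine ⟨by fun_prop, fun j x => ?_⟩
  by_cases hij : i = j
  · subst hij
    simp [mul_add]
  · simp [hij]

theorem separated_cos (i : Fin d) : Separated fun x : Euc d => Real.cos (2 * Real.pi * x i) := by
  let e : Bool → Euc d → ℝ := fun l x =>
    if l then Real.cos (2 * Real.pi * x i) else Real.sin (2 * Real.pi * x i)
  have he : ∀ l, SmoothPeriodic (e l) := by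
    rintro (_ | _)
    · simpa [e] using smoothPeriodic_sin i
    · simpa [e] using smoothPeriodic_cos i
  exact ⟨Bool, inferInstance, e, e, he, he, fun z y => by simp [e, mul_sub, Real.cos_sub]⟩

theorem partialDeriv_sum_mul_const {ι : Type*} [Fintype ι] {a : ι → Euc d → ℝ}
    (ha : ∀ l, Differentiable ℝ (a l)) (β : ι → ℝ) (i : Fin d) (z : Euc d) :
    partialDeriv i (fun x => ∑ l, a l x * β l) z = ∑ l, partialDeriv i (a l) z * β l := by
  have hderiv : HasFDerivAt (fun x => ∑ l, a l x * β l) (∑ l, β l • fderiv ℝ (a l) z) z :=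
    HasFDerivAt.fun_sum fun l _ => (ha l z).hasFDerivAt.mul_const (β l)
  rw [partialDeriv, hderiv.fderiv]
  simp [partialDeriv, mul_comm]

theorem partialDeriv_comp_const_sub (κ : Euc d → ℝ) (z y : Euc d) (i : Fin d) :
    partialDeriv i (fun x => κ (z - x)) y = -partialDeriv i κ (z - y) := by
  have hneg := (ContinuousLinearEquiv.neg ℝ (M := Euc d)).comp_right_fderiv
    (f := fun w => κ (z + w)) (x := y)
  rw [fderiv_comp_add_left] at hneg
  have hcomp : (fun x => κ (z - x)) = (fun w => κ (z + w)) ∘ ContinuousLinearEquiv.neg ℝ := by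
    ext x
    simp [sub_eq_add_neg]
  rw [partialDeriv, hcomp, hneg]
  simp [partialDeriv, sub_eq_add_neg]

theorem sum_partialDeriv_mul_eq_neg {κ : Euc d → ℝ} {ι : Type*} [Fintype ι] {a b : ι → Euc d → ℝ}
    (ha : ∀ l, SmoothPeriodic (a l)) (hb : ∀ l, SmoothPeriodic (b l))
    (hab : ∀ z y, κ (z - y) = ∑ l, a l z * b l y) (i : Fin d) (z y : Euc d) :
    ∑ l, partialDeriv i (a l) z * b l y = -∑ l, a l z * partialDeriv i (b l) y := by
  calc ∑ l, partialDeriv i (a l) z * b l y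
      = partialDeriv i (fun x => κ (x - y)) z := by
        rw [← partialDeriv_sum_mul_const fun l => (ha l).differentiable]
        simp only [hab]
    _ = -partialDeriv i (fun x => κ (z - x)) y := by
        rw [partialDeriv_comp_const_sub, neg_neg, partialDeriv, fderiv_comp_sub, partialDeriv]
    _ = -∑ l, partialDeriv i (b l) y * a l z := by
        rw [← partialDeriv_sum_mul_const fun l => (hb l).differentiable]
        simp only [hab, mul_comm]
    _ = _ := by simp only [mul_comm]

section Mollification

variable {G : Type*} [AddCommGroup G] [TopologicalSpace G] [CompactSpace G] [MeasureSpace G]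
  [BorelSpace G] [(volume : Measure G).IsAddHaarMeasure]

/-- A continuous function attaining its maximum exactly at the origin; its normalized powers are an
approximate identity. -/
structure IsPeak (c : C(G, ℝ)) : Prop where
  nonneg : ∀ a, 0 ≤ c a
  pos : 0 < c 0
  lt : ∀ a, a ≠ 0 → c a < c 0

/-- The `n`-th power of `c`, normalized to have integral one. -/
def peakDensity (c : C(G, ℝ)) (n : ℕ) : C(G, ℝ) :=
  ⟨fun s => (∫ r, c r ^ n)⁻¹ * c s ^ n, by fun_prop⟩

/-- The probability measure with density `peakDensity c n`. -/
def peakVol (c : C(G, ℝ)) (n : ℕ) : Measure G :=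
  volume.withDensity fun s => ENNReal.ofReal (peakDensity c n s)

/-- The convolution of `k` with `peakDensity c n`. -/
def mollify (c : C(G, ℝ)) (n : ℕ) (k : G → ℝ) (a : G) : ℝ :=
  ∫ s, k (a - s) ∂peakVol c n

namespace IsPeak

variable {c : C(G, ℝ)}

theorem integral_pow_pos (hc : IsPeak c) (n : ℕ) : 0 < ∫ s, c s ^ n := by
  have hcont : Continuous fun s => c s ^ n := by fun_prop
  exact hcont.integral_pos_of_hasCompactSupport_nonneg_nonzero
    (HasCompactSupport.of_compactSpace _) (fun a => pow_nonneg (hc.nonneg a) n) (x := 0)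
    (pow_pos hc.pos n).ne'

theorem peakDensity_nonneg (hc : IsPeak c) (n : ℕ) (s : G) : 0 ≤ peakDensity c n s :=
  mul_nonneg (inv_nonneg.2 (hc.integral_pow_pos n).le) (pow_nonneg (hc.nonneg s) n)

theorem isProbabilityMeasure_peakVol (hc : IsPeak c) (n : ℕ) :
    IsProbabilityMeasure (peakVol c n) := by
  refine ⟨?_⟩
  rw [peakVol, withDensity_apply _ MeasurableSet.univ, Measure.restrict_univ,
    ← ofReal_integral_eq_lintegral_ofReal (integrable_continuousMap _)
      (ae_of_all _ (hc.peakDensity_nonneg n))]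
  simp only [peakDensity, ContinuousMap.coe_mk]
  rw [integral_const_mul, inv_mul_cancel₀ (hc.integral_pow_pos n).ne', ENNReal.ofReal_one]

theorem integral_peakVol (hc : IsPeak c) (n : ℕ) (g : G → ℝ) :
    ∫ s, g s ∂peakVol c n = ∫ s, peakDensity c n s * g s := by
  rw [peakVol, integral_withDensity_eq_integral_toReal_smul (by fun_prop)
    (ae_of_all _ fun s => ENNReal.ofReal_lt_top)]
  simp only [ENNReal.toReal_ofReal (hc.peakDensity_nonneg n _), smul_eq_mul]

theorem integrable_peakVol (hc : IsPeak c) (n : ℕ) {g : G → ℝ} (hg : Integrable g volume) :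
    Integrable g (peakVol c n) := by
  rw [peakVol, integrable_withDensity_iff_integrable_smul₀' (by fun_prop)
    (ae_of_all _ fun s => ENNReal.ofReal_lt_top)]
  simpa only [ENNReal.toReal_ofReal (hc.peakDensity_nonneg n _), smul_eq_mul, mul_comm, id_eq] using
    integrable_mul_comp hg measurable_id (peakDensity c n)

theorem tendsto_integral_peakVol [TopologicalSpace.MetrizableSpace G] (hc : IsPeak c)
    {g : G → ℝ} (hg : Continuous g) :
    Tendsto (fun n => ∫ s, g s ∂peakVol c n) atTop (𝓝 (g 0)) := by
  have hlim := tendsto_setIntegral_pow_smul_of_unique_maximum_of_isCompact_of_continuousOn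
    (μ := (volume : Measure G)) (s := Set.univ) (x₀ := 0) isCompact_univ
    c.continuous.continuousOn (fun y _ hy => hc.lt y hy) (fun x _ => hc.nonneg x) hc.pos
    (by simp) hg.continuousOn
  simp only [hc.integral_peakVol, peakDensity, ContinuousMap.coe_mk, mul_assoc, integral_const_mul]
  simpa using hlim

end IsPeak

variable [IsTopologicalAddGroup G]

theorem continuous_eLpNorm_translate {q : ℝ≥0∞} (hq1 : 1 ≤ q) (hq : q ≠ ⊤) {k : G → ℝ}
    (hk : MemLp k q volume) :
    Continuous fun s : G => (eLpNorm (fun a => k (a - s) - k a) q volume).toReal := by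
  have : Fact (1 ≤ q) := ⟨hq1⟩
  let shift : G → C(G, G) := fun s => ⟨fun a => a - s, by fun_prop⟩
  have hshift : Continuous shift := ContinuousMap.continuous_of_continuous_uncurry _ (by
    change Continuous fun p : G × G => p.2 - p.1
    fun_prop)
  have hshift_mp : ∀ s, MeasurePreserving (shift s) (volume : Measure G) volume := fun s =>
    measurePreserving_sub_right volume s
  have hnorm : Continuous fun s =>
      ‖Lp.compMeasurePreserving (shift s) (hshift_mp s) (hk.toLp k) - hk.toLp k‖ :=
    ((continuous_const.compMeasurePreservingLp hshift hshift_mp hq).sub continuous_const).norm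
  refine hnorm.congr fun s => ?_
  rw [Lp.toLp_compMeasurePreserving, ← MemLp.toLp_sub, Lp.norm_toLp]
  rfl

namespace IsPeak

variable {c : C(G, ℝ)} [SecondCountableTopology G]

theorem integral_mollify (hc : IsPeak c) (n : ℕ) {k : G → ℝ} (hk : Integrable k volume) :
    ∫ a, mollify c n k a = ∫ a, k a := by
  have := hc.isProbabilityMeasure_peakVol n
  have hskew : MeasurePreserving (fun p : G × G => (p.1, p.2 - p.1))
      ((peakVol c n).prod volume) ((peakVol c n).prod volume) :=
    MeasurePreserving.skew_product (MeasurePreserving.id _)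
      (g := fun s a => a - s) (measurable_snd.sub measurable_fst)
      (ae_of_all _ fun s => (measurePreserving_sub_right volume s).map_eq)
  have hsub : MeasurePreserving (fun p : G × G => p.1 - p.2)
      (volume.prod (peakVol c n)) volume :=
    (measurePreserving_snd.comp hskew).comp Measure.measurePreserving_swap
  have hfubini := integral_prod _ (hsub.integrable_comp_of_integrable hk)
  simp only [Function.comp_apply] at hfubini
  rw [integral_comp_measurePreserving hsub hk.1] at hfubini
  exact hfubini.symm

variable [(volume : Measure G).IsNegInvariant]

theorem eLpNorm_mollify_sub_le (hc : IsPeak c) {q : ℝ≥0∞} (hq1 : 1 ≤ q) (hq : q ≠ ⊤) {k : G → ℝ}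
    (hkm : StronglyMeasurable k) (hk : MemLp k q volume) (n : ℕ) :
    eLpNorm (fun a => mollify c n k a - k a) q volume
      ≤ ENNReal.ofReal (∫ s, (eLpNorm (fun a => k (a - s) - k a) q volume).toReal ^ q.toReal
          ∂peakVol c n) ^ (1 / q.toReal) := by
  have hq0 : q ≠ 0 := (zero_lt_one.trans_le hq1).ne'
  have hqr : 0 < q.toReal := ENNReal.toReal_pos hq0 hq
  have := hc.isProbabilityMeasure_peakVol n
  let F : G × G → ℝ := fun p => k (p.1 - p.2) - k p.1
  have hF : StronglyMeasurable F :=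
    (hkm.comp_measurable (measurable_fst.sub measurable_snd)).sub
      (hkm.comp_measurable measurable_fst)
  have hmollify : ∀ a, mollify c n k a - k a = ∫ s, F (a, s) ∂peakVol c n := fun a => by
    have hka : Integrable (fun s => k (a - s)) (peakVol c n) :=
      hc.integrable_peakVol n ((Measure.measurePreserving_sub_left volume a
        ).integrable_comp_of_integrable (hk.integrable hq1))
    simp only [F]
    rw [integral_sub hka (integrable_const _)]
    simp [mollify]
  have hint : Integrable (fun s => (eLpNorm (fun a => k (a - s) - k a) q volume).toReal ^ q.toReal)
      (peakVol c n) :=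
    integrable_continuousMap ⟨_, (continuous_eLpNorm_translate hq1 hq hk).rpow_const fun _ =>
      Or.inr hqr.le⟩
  have htop : ∀ s, eLpNorm (fun a => k (a - s) - k a) q volume ≠ ⊤ := fun s =>
    ((hk.comp_measurePreserving (measurePreserving_sub_right volume s)).sub hk).2.ne
  simp only [hmollify]
  refine (eLpNorm_integral_le hF.aestronglyMeasurable hq1 hq).trans ?_
  rw [eLpNorm_eq_lintegral_rpow_enorm_toReal hq0 hq,
    ofReal_integral_eq_lintegral_ofReal hint
      (ae_of_all _ fun s => Real.rpow_nonneg ENNReal.toReal_nonneg _)]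
  gcongr
  rw [lintegral_prod_symm' _ (by fun_prop)]
  refine le_of_eq (lintegral_congr fun s => ?_)
  rw [← ENNReal.ofReal_rpow_of_nonneg ENNReal.toReal_nonneg hqr.le, ENNReal.ofReal_toReal (htop s),
    eLpNorm_eq_lintegral_rpow_enorm_toReal hq0 hq, ← ENNReal.rpow_mul, one_div,
    inv_mul_cancel₀ hqr.ne', ENNReal.rpow_one]

theorem tendsto_eLpNorm_mollify_sub [TopologicalSpace.MetrizableSpace G] (hc : IsPeak c)
    {q : ℝ≥0∞} (hq1 : 1 ≤ q) (hq : q ≠ ⊤) {k : G → ℝ} (hkm : StronglyMeasurable k)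
    (hk : MemLp k q volume) :
    Tendsto (fun n => eLpNorm (fun a => mollify c n k a - k a) q volume) atTop (𝓝 0) := by
  have hqr : 0 < q.toReal := ENNReal.toReal_pos (zero_lt_one.trans_le hq1).ne' hq
  have hmean := hc.tendsto_integral_peakVol
    ((continuous_eLpNorm_translate hq1 hq hk).rpow_const fun _ => Or.inr hqr.le)
  simp only [sub_zero, sub_self, eLpNorm_zero', ENNReal.toReal_zero, Real.zero_rpow hqr.ne']
    at hmean
  have hroot := ((ENNReal.continuous_rpow_const (y := 1 / q.toReal)).tendsto _).comp
    (ENNReal.tendsto_ofReal hmean)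
  rw [ENNReal.ofReal_zero, ENNReal.zero_rpow_of_pos (by positivity)] at hroot
  exact tendsto_of_tendsto_of_tendsto_of_le_of_le tendsto_const_nhds hroot (fun _ => zero_le)
    fun n => hc.eLpNorm_mollify_sub_le hq1 hq hkm hk n

end IsPeak

end Mollification

/-- The peak `1 + ∑ i, (1 + cos (2πxᵢ))` on the torus. The leading `1` keeps it positive at the
origin when `d = 0`. -/
def cosPeak (d : ℕ) : C(Torus d, ℝ) :=
  ⟨fun a => 1 + ∑ i, (1 + (fourier 1 (a i)).re), by fun_prop⟩

theorem cosPeak_toTorus (x : Euc d) :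
    cosPeak d (toTorus x) = 1 + ∑ i, (1 + Real.cos (2 * Real.pi * x i)) := by
  simp only [cosPeak, toTorus, ContinuousMap.coe_mk, fourier_coe_apply, Int.cast_one, mul_one,
    Complex.ofReal_one, div_one]
  refine congrArg (1 + ·) (Finset.sum_congr rfl fun i _ => ?_)
  rw [show 2 * (Real.pi : ℂ) * Complex.I * (x i : ℂ) = ((2 * Real.pi * x i : ℝ) : ℂ) * Complex.I by
    push_cast; ring, Complex.exp_ofReal_mul_I_re]

theorem separated_cosPeak_pow (n : ℕ) : Separated fun x : Euc d => cosPeak d (toTorus x) ^ n := by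
  simp only [cosPeak_toTorus]
  exact ((Separated.const 1).add
    (Separated.sum (fun i => (Separated.const 1).add (separated_cos i)) Finset.univ)).pow n

theorem toTorus_eq_zero_of_cos_eq_one {x : Euc d} (h : ∀ i, Real.cos (2 * Real.pi * x i) = 1) :
    toTorus x = 0 := by
  ext i
  obtain ⟨m, hm⟩ := (Real.cos_eq_one_iff _).1 (h i)
  have hx : (m : ℝ) = x i := by
    have := Real.pi_pos
    field_simp at hm
    linarith
  exact (AddCircle.coe_eq_zero_iff 1).2 ⟨m, by simpa using hx⟩

theorem isPeak_cosPeak : IsPeak (cosPeak d) := by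
  have hterm : ∀ (x : Euc d) i, 0 ≤ 1 + Real.cos (2 * Real.pi * x i) := fun x i => by
    linarith [Real.neg_one_le_cos (2 * Real.pi * x i)]
  have hzero : toTorus (0 : Euc d) = 0 := toTorus_eq_zero_of_cos_eq_one fun i => by simp
  refine ⟨fun a => ?_, ?_, fun a ha => ?_⟩
  · obtain ⟨x, rfl⟩ := isOpenQuotientMap_toTorus.surjective a
    rw [cosPeak_toTorus]
    exact add_nonneg zero_le_one (Finset.sum_nonneg fun i _ => hterm x i)
  · rw [← hzero, cosPeak_toTorus]
    exact add_pos_of_pos_of_nonneg one_pos (Finset.sum_nonneg fun i _ => hterm 0 i)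
  · obtain ⟨x, rfl⟩ := isOpenQuotientMap_toTorus.surjective a
    obtain ⟨i, hi⟩ : ∃ i, Real.cos (2 * Real.pi * x i) ≠ 1 := by
      by_contra! hcon
      exact ha (toTorus_eq_zero_of_cos_eq_one hcon)
    rw [← hzero, cosPeak_toTorus, cosPeak_toTorus]
    refine add_lt_add_right (Finset.sum_lt_sum (fun j _ => ?_) ⟨i, Finset.mem_univ _, ?_⟩) 1
    · simpa using Real.cos_le_one (2 * Real.pi * x j)
    · simpa using lt_of_le_of_ne (Real.cos_le_one (2 * Real.pi * x i)) hi

theorem integrable_mul_comp_toTorus {k : Torus d → ℝ} (hk : Integrable k volume)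
    {b : Euc d → ℝ} (hb : SmoothPeriodic b) :
    Integrable (fun y => k (toTorus y) * b y) (cellVol d) := by
  obtain ⟨B, hB⟩ := hb.periodic.exists_lift hb.continuous
  simpa only [hB, id_eq, Function.comp_def] using
    measurePreserving_toTorus.integrable_comp_of_integrable
      (integrable_mul_comp hk measurable_id B)

section

variable {c : C(Torus d, ℝ)} {n : ℕ} {k : Torus d → ℝ} {ι : Type*} [Fintype ι]
  {a b : ι → Euc d → ℝ}

theorem IsPeak.mollify_toTorus (hc : IsPeak c) (hk : Integrable k volume)
    (hb : ∀ l, SmoothPeriodic (b l))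
    (hab : ∀ z y, c (toTorus (z - y)) ^ n = ∑ l, a l z * b l y) (z : Euc d) :
    mollify c n k (toTorus z)
      = ∑ l, a l z * ((∫ s, c s ^ n)⁻¹ * ∫ y, k (toTorus y) * b l y ∂cellVol d) := by
  have hkc : AEStronglyMeasurable (fun s => c (toTorus z - s) ^ n * k s) volume :=
    (by fun_prop : Continuous fun s => c (toTorus z - s) ^ n).aestronglyMeasurable.mul hk.1
  calc mollify c n k (toTorus z)
      = (∫ s, c s ^ n)⁻¹ * ∫ s, c s ^ n * k (toTorus z - s) := by
        simp only [mollify, hc.integral_peakVol, peakDensity, ContinuousMap.coe_mk, mul_assoc,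
          integral_const_mul]
    _ = (∫ s, c s ^ n)⁻¹ * ∫ s, c (toTorus z - s) ^ n * k s := by
        rw [← integral_sub_left_eq_self (fun s => c s ^ n * k (toTorus z - s)) _ (toTorus z)]
        simp only [sub_sub_cancel]
    _ = (∫ s, c s ^ n)⁻¹ * ∫ y, ∑ l, a l z * (k (toTorus y) * b l y) ∂cellVol d := by
        rw [← integral_comp_measurePreserving measurePreserving_toTorus hkc]
        simp only [← toTorus_sub, hab, Finset.sum_mul, mul_assoc, mul_comm (k _)]
    _ = _ := by
        rw [integral_finsetSum _ fun l _ =>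
          (integrable_mul_comp_toTorus hk (hb l)).const_mul (a l z), Finset.mul_sum]
        simp only [integral_const_mul, mul_left_comm]

theorem IsPeak.partialDeriv_mollify_toTorus (hc : IsPeak c) (hk : Integrable k volume)
    (ha : ∀ l, SmoothPeriodic (a l)) (hb : ∀ l, SmoothPeriodic (b l))
    (hab : ∀ z y, c (toTorus (z - y)) ^ n = ∑ l, a l z * b l y) (i : Fin d) (z : Euc d) :
    partialDeriv i (fun y => mollify c n k (toTorus y)) z
      = -((∫ s, c s ^ n)⁻¹ *
          ∑ l, a l z * ∫ y, k (toTorus y) * partialDeriv i (b l) y ∂cellVol d) := by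
  have hparts : ∑ l, partialDeriv i (a l) z * ∫ y, k (toTorus y) * b l y ∂cellVol d
      = -∑ l, a l z * ∫ y, k (toTorus y) * partialDeriv i (b l) y ∂cellVol d := by
    simp only [← integral_const_mul]
    rw [← integral_finsetSum _ fun l _ => (integrable_mul_comp_toTorus hk (hb l)).const_mul _,
      ← integral_finsetSum _ fun l _ =>
        (integrable_mul_comp_toTorus hk ((hb l).partialDeriv i)).const_mul _, ← integral_neg]
    refine integral_congr_ae (ae_of_all _ fun y => ?_)
    simp only [mul_left_comm _ (k (toTorus y)), ← Finset.mul_sum]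
    rw [sum_partialDeriv_mul_eq_neg (κ := fun x => c (toTorus x) ^ n) ha hb hab, mul_neg]
  simp only [hc.mollify_toTorus hk hb hab]
  rw [partialDeriv_sum_mul_const fun l => (ha l).differentiable]
  simp only [mul_left_comm _ (∫ s, c s ^ n)⁻¹, ← Finset.mul_sum]
  rw [hparts, mul_neg]

end

theorem smoothPeriodic_mollify_cosPeak (n : ℕ) {k : Torus d → ℝ} (hk : Integrable k volume) :
    SmoothPeriodic fun y => mollify (cosPeak d) n k (toTorus y) := by
  obtain ⟨ι, _, a, b, ha, hb, hab⟩ := separated_cosPeak_pow (d := d) n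
  simp only [isPeak_cosPeak.mollify_toTorus hk hb hab]
  exact SmoothPeriodic.sum (fun l => (ha l).mul (SmoothPeriodic.const _)) _

/-- Whether the mollifications of a field are curl-free is decided by countably many test functions,
so that for a field on the product of two tori it holds for almost all slices. -/
theorem exists_countable_forall_partialDeriv_mollify_eq (d : ℕ) :
    ∃ T : Set (Euc d → ℝ), T.Countable ∧ (∀ θ ∈ T, SmoothPeriodic θ) ∧
      ∀ k : Fin d → Torus d → ℝ, (∀ i, Integrable (k i) volume) →
        (∀ θ ∈ T, ∀ i j, ∫ y, k j (toTorus y) * partialDeriv i θ y ∂cellVol d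
          = ∫ y, k i (toTorus y) * partialDeriv j θ y ∂cellVol d) →
        ∀ n i j z, partialDeriv i (fun y => mollify (cosPeak d) n (k j) (toTorus y)) z
          = partialDeriv j (fun y => mollify (cosPeak d) n (k i) (toTorus y)) z := by
  choose ι hι a b ha hb hab using separated_cosPeak_pow (d := d)
  refine ⟨Set.range fun l : Σ n, ι n => b l.1 l.2, Set.countable_range _,
    Set.forall_mem_range.2 fun l => hb l.1 l.2, fun k hk hcurl n i j z => ?_⟩
  rw [isPeak_cosPeak.partialDeriv_mollify_toTorus (hk j) (ha n) (hb n) (hab n),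
    isPeak_cosPeak.partialDeriv_mollify_toTorus (hk i) (ha n) (hb n) (hab n)]
  simp only [hcurl _ (Set.mem_range_self (⟨n, _⟩ : Σ n, ι n)) i j]

section RayPotential

variable {G : Type*} [AddCommGroup G] [MeasurableSpace G] [MeasurableAdd₂ G] [MeasurableNeg G]
  {μ : Measure G} [SFinite μ] [μ.IsAddRightInvariant] {σ : Euc d × ℝ → G} {q : ℝ≥0∞}

theorem measurePreserving_sub_ray (hσ : Measurable σ) :
    MeasurePreserving (fun z : G × (Euc d × ℝ) => z.1 - σ z.2) (μ.prod (rayVol d)) μ := by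
  have hskew : MeasurePreserving (fun z : (Euc d × ℝ) × G => (z.1, z.2 - σ z.1))
      ((rayVol d).prod μ) ((rayVol d).prod μ) :=
    MeasurePreserving.skew_product (MeasurePreserving.id _)
      (g := fun p a => a - σ p) (measurable_snd.sub (hσ.comp measurable_fst))
      (ae_of_all _ fun p => (measurePreserving_sub_right μ (σ p)).map_eq)
  exact (measurePreserving_snd.comp hskew).comp Measure.measurePreserving_swap

theorem eLpNorm_ray_le (hσ : Measurable σ) {k : G → ℝ} (hk : AEStronglyMeasurable k μ)
    (i : Fin d) :
    eLpNorm (fun z : G × (Euc d × ℝ) => k (z.1 - σ z.2) * z.2.1 i) q (μ.prod (rayVol d))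
      ≤ eLpNorm k q μ := by
  rw [← eLpNorm_comp_measurePreserving hk (measurePreserving_sub_ray hσ)]
  refine eLpNorm_mono_ae ?_
  filter_upwards [Measure.quasiMeasurePreserving_snd.ae ae_rayVol_fst_mem_cell] with z hz
  rw [norm_mul]
  exact mul_le_of_le_one_right (norm_nonneg _) (abs_le_one_of_mem_cell hz i)

theorem memLp_ray (hσ : Measurable σ) {k : G → ℝ} (hk : MemLp k q μ) (i : Fin d) :
    MemLp (fun z : G × (Euc d × ℝ) => k (z.1 - σ z.2) * z.2.1 i) q (μ.prod (rayVol d)) :=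
  ⟨(hk.1.comp_measurePreserving (measurePreserving_sub_ray hσ)).mul
    (by fun_prop : Measurable fun z : G × (Euc d × ℝ) => z.2.1 i).aestronglyMeasurable,
    (eLpNorm_ray_le hσ hk.1 i).trans_lt hk.2⟩

variable {k : Fin d → G → ℝ}

theorem memLp_sum_ray (hσ : Measurable σ) (hk : ∀ i, MemLp (k i) q μ) :
    MemLp (fun z : G × (Euc d × ℝ) => ∑ i, k i (z.1 - σ z.2) * z.2.1 i) q (μ.prod (rayVol d)) :=
  memLp_finsetSum _ fun i _ => memLp_ray hσ (hk i) i

theorem integrable_sum_ray (hσ : Measurable σ) (hk : ∀ i, Integrable (k i) μ) :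
    Integrable (fun z : G × (Euc d × ℝ) => ∑ i, k i (z.1 - σ z.2) * z.2.1 i)
      (μ.prod (rayVol d)) :=
  memLp_one_iff_integrable.1 (memLp_sum_ray hσ fun i => memLp_one_iff_integrable.2 (hk i))

theorem memLp_rayPotential (hσ : Measurable σ) (hq1 : 1 ≤ q) (hq : q ≠ ⊤)
    (hk : ∀ i, MemLp (k i) q μ) : MemLp (rayPotential σ k) q μ :=
  memLp_integral_prod (memLp_sum_ray hσ hk) hq1 hq

theorem eLpNorm_rayPotential_le (hσ : Measurable σ) (hq1 : 1 ≤ q) (hq : q ≠ ⊤)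
    (hk : ∀ i, MemLp (k i) q μ) :
    eLpNorm (rayPotential σ k) q μ ≤ ∑ i, eLpNorm (k i) q μ := by
  have hjensen := eLpNorm_integral_le (memLp_sum_ray hσ hk).1 hq1 hq
  have hsum : (fun z : G × (Euc d × ℝ) => ∑ i, k i (z.1 - σ z.2) * z.2.1 i)
      = ∑ i, fun z : G × (Euc d × ℝ) => k i (z.1 - σ z.2) * z.2.1 i := by
    ext z
    simp only [Finset.sum_apply]
  rw [hsum] at hjensen
  exact hjensen.trans ((eLpNorm_sum_le (fun i _ => (memLp_ray hσ (hk i) i).1) hq1).trans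
    (Finset.sum_le_sum fun i _ => eLpNorm_ray_le hσ (hk i).1 i))

theorem rayPotential_sub_ae_eq (hσ : Measurable σ) {k' : Fin d → G → ℝ}
    (hk : ∀ i, Integrable (k i) μ) (hk' : ∀ i, Integrable (k' i) μ) :
    rayPotential σ (fun i g => k i g - k' i g)
      =ᵐ[μ] fun g => rayPotential σ k g - rayPotential σ k' g := by
  filter_upwards [(integrable_sum_ray hσ hk).prod_right_ae,
    (integrable_sum_ray hσ hk').prod_right_ae] with g hg hg'
  rw [rayPotential, rayPotential, rayPotential, ← integral_sub hg hg']
  simp only [sub_mul, Finset.sum_sub_distrib]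

theorem integral_rayPotential (hσ : Measurable σ) (hk : ∀ i, Integrable (k i) μ)
    (hmean : ∀ i, ∫ g, k i g ∂μ = 0) : ∫ g, rayPotential σ k g ∂μ = 0 := by
  have hfibre : ∀ p, ∫ g, ∑ i, k i (g - σ p) * p.1 i ∂μ = 0 := fun p => by
    have hki : ∀ i, Integrable (fun g => k i (g - σ p)) μ := fun i =>
      (measurePreserving_sub_right μ (σ p)).integrable_comp_of_integrable (hk i)
    rw [integral_finsetSum _ fun i _ => (hki i).mul_const _]
    simp only [integral_mul_const, integral_sub_right_eq_self, hmean, zero_mul,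
      Finset.sum_const_zero]
  unfold rayPotential
  rw [integral_integral_swap (integrable_sum_ray hσ hk)]
  simp only [hfibre, integral_zero]

theorem tendsto_eLpNorm_rayPotential_sub [IsFiniteMeasure μ] (hσ : Measurable σ) (hq1 : 1 ≤ q)
    (hq : q ≠ ⊤) (hk : ∀ i, MemLp (k i) q μ) {h : ℕ → Fin d → G → ℝ}
    (hh : ∀ n i, MemLp (h n i) q μ)
    (hlim : ∀ i, Tendsto (fun n => eLpNorm (fun g => h n i g - k i g) q μ) atTop (𝓝 0)) :
    Tendsto (fun n => eLpNorm (fun g => rayPotential σ (h n) g - rayPotential σ k g) q μ)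
      atTop (𝓝 0) := by
  have hsum : Tendsto (fun n => ∑ i, eLpNorm (fun g => h n i g - k i g) q μ) atTop (𝓝 0) := by
    simpa using tendsto_finsetSum Finset.univ fun i _ => hlim i
  refine tendsto_of_tendsto_of_tendsto_of_le_of_le tendsto_const_nhds hsum (fun _ => zero_le)
    fun n => ?_
  simp only
  rw [← eLpNorm_congr_ae (rayPotential_sub_ae_eq hσ (fun i => (hh n i).integrable hq1)
    fun i => (hk i).integrable hq1)]
  exact eLpNorm_rayPotential_le hσ hq1 hq fun i => (hh n i).sub (hk i)

end RayPotential

theorem norm_le_sum_abs (v : Euc d) : ‖v‖ ≤ ∑ i, |v i| := by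
  calc ‖v‖ = ‖∑ i, v i • EuclideanSpace.single i (1 : ℝ)‖ := by
        congr 1
        ext j
        simp [Pi.single_apply]
    _ ≤ ∑ i, ‖v i • EuclideanSpace.single i (1 : ℝ)‖ := norm_sum_le _ _
    _ = ∑ i, |v i| := by simp [norm_smul]

theorem eLpNorm_le_sum_eLpNorm_apply {α : Type*} [MeasurableSpace α] {μ : Measure α}
    {F : α → Euc d} {q : ℝ≥0∞} (hq1 : 1 ≤ q)
    (hF : ∀ i, AEStronglyMeasurable (fun x => F x i) μ) :
    eLpNorm F q μ ≤ ∑ i, eLpNorm (fun x => F x i) q μ := by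
  calc eLpNorm F q μ ≤ eLpNorm (∑ i, fun x => |F x i|) q μ :=
        eLpNorm_mono_ae_real (ae_of_all _ fun x => by simpa using norm_le_sum_abs (F x))
    _ ≤ ∑ i, eLpNorm (fun x => |F x i|) q μ := eLpNorm_sum_le (fun i _ => (hF i).norm) hq1
    _ = ∑ i, eLpNorm (fun x => F x i) q μ :=
        Finset.sum_congr rfl fun i _ => eLpNorm_norm fun x => F x i

theorem tendsto_eLpNorm_of_tendsto_eLpNorm_apply {α : Type*} [MeasurableSpace α] {μ : Measure α}
    {F : ℕ → α → Euc d} {q : ℝ≥0∞} (hq1 : 1 ≤ q)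
    (hF : ∀ n i, AEStronglyMeasurable (fun x => F n x i) μ)
    (h : ∀ i, Tendsto (fun n => eLpNorm (fun x => F n x i) q μ) atTop (𝓝 0)) :
    Tendsto (fun n => eLpNorm (F n) q μ) atTop (𝓝 0) := by
  have hsum : Tendsto (fun n => ∑ i, eLpNorm (fun x => F n x i) q μ) atTop (𝓝 0) := by
    simpa using tendsto_finsetSum Finset.univ fun i _ => h i
  exact tendsto_of_tendsto_of_tendsto_of_le_of_le tendsto_const_nhds hsum (fun _ => zero_le)
    fun n => eLpNorm_le_sum_eLpNorm_apply hq1 (hF n)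

instance : MeasurableAdd₂ (Torus d × Torus d) := ContinuousAdd.measurableMul₂

instance : MeasurableNeg (Torus d × Torus d) := ContinuousNeg.measurableNeg

instance : ((volume : Measure (Torus d)).prod (volume : Measure (Torus d))).IsAddRightInvariant :=
  ⟨fun g => ((measurePreserving_add_right volume g.1).prod
    (measurePreserving_add_right volume g.2)).map_eq⟩

/-- The projections to the torus of the segments from the origin to the points of the cell. -/
def torusRay (p : Euc d × ℝ) : Torus d := toTorus (p.2 • p.1)

theorem measurable_torusRay : Measurable (torusRay : Euc d × ℝ → Torus d) :=
  measurable_toTorus.comp (by fun_prop)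

theorem memLp_of_smoothPeriodic {h : Torus d → ℝ} (hh : SmoothPeriodic fun y => h (toTorus y))
    (q : ℝ≥0∞) : MemLp h q volume := by
  obtain ⟨F, hF⟩ := hh.periodic.exists_lift hh.continuous
  have hFh : ⇑F = h := isOpenQuotientMap_toTorus.surjective.injective_comp_right (funext hF)
  rw [← hFh]
  exact MemLp.of_bound F.continuous.aestronglyMeasurable ‖F‖ (ae_of_all _ F.norm_coe_le_norm)

theorem memSobolevPer_rayPotential {q : ℝ≥0∞} (hq1 : 1 ≤ q) (hq : q ≠ ⊤) {k : Fin d → Torus d → ℝ}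
    (hk : ∀ i, MemLp (k i) q volume) {h : ℕ → Fin d → Torus d → ℝ}
    (hh : ∀ n i, SmoothPeriodic fun y => h n i (toTorus y))
    (hcurl : ∀ n i j z, partialDeriv i (fun y => h n j (toTorus y)) z
      = partialDeriv j (fun y => h n i (toTorus y)) z)
    (hmean : ∀ n i, ∫ a, h n i a = 0)
    (hlim : ∀ i, Tendsto (fun n => eLpNorm (fun a => h n i a - k i a) q volume) atTop (𝓝 0)) :
    MemSobolevPer q (fun y => rayPotential torusRay k (toTorus y))
      (fun y => WithLp.toLp 2 fun i => k i (toTorus y)) := by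
  have hhLp : ∀ n i, MemLp (h n i) q volume := fun n i => memLp_of_smoothPeriodic (hh n i) q
  have hmean' : ∀ n i, ∫ y, h n i (toTorus y) ∂cellVol d = 0 := fun n i => by
    rw [integral_comp_measurePreserving measurePreserving_toTorus (hhLp n i).1, hmean]
  have hpotential : ∀ n y, rayPotential (fun p => p.2 • p.1) (fun i y => h n i (toTorus y)) y
      = rayPotential torusRay (h n) (toTorus y) := fun n y => by
    simp only [rayPotential, toTorus_sub, torusRay]
  have hkpot := memLp_rayPotential measurable_torusRay hq1 hq hk
  have hsub : ∀ n i, MemLp (fun a => h n i a - k i a) q volume := fun n i => (hhLp n i).sub (hk i)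
  refine ⟨hkpot.comp_measurePreserving measurePreserving_toTorus,
    MemLp.of_eval_piLp fun i => (hk i).comp_measurePreserving measurePreserving_toTorus,
    fun n => rayPotential (fun p => p.2 • p.1) fun i y => h n i (toTorus y),
    fun n => smoothPeriodic_rayPotential (hh n) (hcurl n) (hmean' n), ?_, ?_⟩
  · simp only [hpotential]
    refine (tendsto_eLpNorm_rayPotential_sub measurable_torusRay hq1 hq hk hhLp hlim).congr
      fun n => ?_
    exact (eLpNorm_comp_measurePreserving ((memLp_rayPotential measurable_torusRay hq1 hq
      (hhLp n)).sub hkpot).1 measurePreserving_toTorus).symm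
  · have hgrad : ∀ n i, (fun y => (gradient (rayPotential (fun p => p.2 • p.1)
        fun i y => h n i (toTorus y)) y - WithLp.toLp 2 fun i => k i (toTorus y)) i)
        = (fun a => h n i a - k i a) ∘ toTorus := fun n i => by
      ext y
      simp [gradient_rayPotential (hh n) (hcurl n) (hmean' n)]
    have hcomp : ∀ n i, eLpNorm ((fun a => h n i a - k i a) ∘ toTorus) q (cellVol d)
        = eLpNorm (fun a => h n i a - k i a) q volume := fun n i =>
      eLpNorm_comp_measurePreserving (g := fun a => h n i a - k i a) (hsub n i).1
        measurePreserving_toTorus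
    refine tendsto_eLpNorm_of_tendsto_eLpNorm_apply hq1 (fun n i => ?_) fun i => ?_
    · rw [hgrad]
      exact (hsub n i).1.comp_measurePreserving measurePreserving_toTorus
    · simp only [hgrad, hcomp]
      exact hlim i

theorem ae_memLp_section {q : ℝ≥0∞} (hq1 : 1 ≤ q) (hq : q ≠ ⊤) {k : Torus d × Torus d → ℝ}
    (hkm : StronglyMeasurable k) (hk : MemLp k q (volume.prod volume)) :
    ∀ᵐ x ∂cellVol d, MemLp (fun b => k (toTorus x, b)) q volume := by
  have hq0 : q ≠ 0 := (zero_lt_one.trans_le hq1).ne'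
  filter_upwards [measurePreserving_toTorus.quasiMeasurePreserving.ae
    (hk.integrable_norm_rpow hq0 hq).prod_right_ae] with x hx
  exact (integrable_norm_rpow_iff (hkm.comp_measurable
    measurable_prodMk_left).aestronglyMeasurable hq0 hq).1 hx

theorem exists_memLpSobolevPer {q : ℝ≥0∞} (hq1 : 1 ≤ q) (hq : q ≠ ⊤)
    {k : Fin d → Torus d × Torus d → ℝ} (hkm : ∀ i, StronglyMeasurable (k i))
    (hk : ∀ i, MemLp (k i) q (volume.prod volume))
    (hmean : ∀ᵐ x ∂cellVol d, ∀ i, ∫ b, k i (toTorus x, b) = 0)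
    (hcurl : ∀ θ, SmoothPeriodic θ → ∀ i j, ∀ᵐ x ∂cellVol d,
      ∫ y, k j (toTorus x, toTorus y) * partialDeriv i θ y ∂cellVol d
        = ∫ y, k i (toTorus x, toTorus y) * partialDeriv j θ y ∂cellVol d) :
    ∃ w, MemLpSobolevPer q w
      fun z => WithLp.toLp 2 fun i => k i (toTorus z.1, toTorus z.2) := by
  have hσ : Measurable fun p : Euc d × ℝ => ((0 : Torus d), torusRay p) :=
    measurable_const.prodMk measurable_torusRay
  obtain ⟨T, hTcount, hTsmooth, hT⟩ := exists_countable_forall_partialDeriv_mollify_eq d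
  have hcurlT : ∀ᵐ x ∂cellVol d, ∀ θ ∈ T, ∀ i j,
      ∫ y, k j (toTorus x, toTorus y) * partialDeriv i θ y ∂cellVol d
        = ∫ y, k i (toTorus x, toTorus y) * partialDeriv j θ y ∂cellVol d := by
    simp only [ae_ball_iff hTcount, ae_all_iff]
    exact fun θ hθ => hcurl θ (hTsmooth θ hθ)
  have hsection : ∀ᵐ x ∂cellVol d, ∀ i, MemLp (fun b => k i (toTorus x, b)) q volume :=
    ae_all_iff.2 fun i => ae_memLp_section hq1 hq (hkm i) (hk i)
  have hfibre : ∀ x y : Euc d, rayPotential (fun p => ((0 : Torus d), torusRay p)) k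
      (toTorus x, toTorus y) = rayPotential torusRay (fun i b => k i (toTorus x, b))
        (toTorus y) := fun x y => by
    simp only [rayPotential, Prod.mk_sub_mk, sub_zero]
  have hpotential := memLp_rayPotential (μ := volume.prod volume) hσ hq1 hq hk
  refine ⟨fun z => rayPotential (fun p => ((0 : Torus d), torusRay p)) k
    (toTorus z.1, toTorus z.2),
    hpotential.comp_measurePreserving measurePreserving_toTorus_prod,
    MemLp.of_eval_piLp fun i => (hk i).comp_measurePreserving measurePreserving_toTorus_prod,
    ?_, ?_⟩
  · filter_upwards [hmean, hsection, hcurlT] with x hmean hLp hcurl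
    have hint : ∀ i, Integrable (fun b => k i (toTorus x, b)) volume := fun i =>
      (hLp i).integrable hq1
    simp only [hfibre]
    exact memSobolevPer_rayPotential hq1 hq hLp
      (fun n i => smoothPeriodic_mollify_cosPeak n (hint i)) (hT _ hint hcurl)
      (fun n i => by rw [isPeak_cosPeak.integral_mollify n (hint i), hmean])
      fun i => isPeak_cosPeak.tendsto_eLpNorm_mollify_sub hq1 hq
        ((hkm i).comp_measurable measurable_prodMk_left) (hLp i)
  · filter_upwards [hmean, hsection] with x hmean hLp
    simp only [hfibre]
    rw [integral_comp_measurePreserving measurePreserving_toTorus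
      (memLp_rayPotential measurable_torusRay hq1 hq hLp).1]
    exact integral_rayPotential measurable_torusRay (fun i => (hLp i).integrable hq1) hmean

/-! ### Compactness of the sequence of solutions -/

theorem holderWith_of_abs_sub_le {E : Type*} [SeminormedAddCommGroup E] {u : E → ℝ} {K : ℝ}
    {α : ℝ≥0} (h : ∀ y z, |u y - u z| ≤ K * ‖y - z‖ ^ (α : ℝ)) : HolderWith K.toNNReal α u := by
  intro y z
  rw [edist_dist, edist_dist, Real.dist_eq, dist_eq_norm,
    ENNReal.ofReal_rpow_of_nonneg (norm_nonneg _) α.coe_nonneg, ← ENNReal.ofReal,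
    ← ENNReal.ofReal_mul' (by positivity)]
  exact ENNReal.ofReal_le_ofReal (h y z)

theorem exists_strictMono_tendstoUniformly {u : ℕ → Euc d → ℝ} (hper : ∀ n, IsPeriodic (u n))
    {A : ℝ} (hA : ∀ n y, |u n y| ≤ A) {K α : ℝ≥0} (hα : 0 < α)
    (hK : ∀ n, HolderWith K α (u n)) :
    ∃ (u₀ : Euc d → ℝ) (σ : ℕ → ℕ), StrictMono σ ∧ IsPeriodic u₀ ∧ HolderWith K α u₀ ∧
      TendstoUniformly (fun n => u (σ n)) u₀ atTop := by
  choose U hU using fun n => (hper n).exists_lift ((hK n).continuous hα)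
  let Ub : ℕ → BoundedContinuousFunction (Torus d) ℝ := fun n =>
    BoundedContinuousFunction.mkOfCompact (U n)
  have hUb : ∀ n x, Ub n (toTorus x) = u n x := hU
  have hcompact : IsCompact (closure (Set.range Ub)) := by
    refine BoundedContinuousFunction.arzela_ascoli (Set.Icc (-A) A) isCompact_Icc _ ?_ fun a => ?_
    · rintro _ a ⟨n, rfl⟩
      obtain ⟨x, rfl⟩ := isOpenQuotientMap_toTorus.surjective a
      rw [hUb]
      exact abs_le.1 (hA n x)
    · obtain ⟨x, rfl⟩ := isOpenQuotientMap_toTorus.surjective a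
      rw [Metric.equicontinuousAt_iff_right]
      intro η hη
      rw [← isOpenQuotientMap_toTorus.map_nhds_eq, eventually_map]
      have hmodulus : Tendsto (fun y => K * dist x y ^ (α : ℝ)) (𝓝 x) (𝓝 0) := by
        have hcont : Continuous fun y => (K : ℝ) * dist x y ^ (α : ℝ) :=
          continuous_const.mul ((continuous_const.dist continuous_id).rpow_const
            fun _ => Or.inr α.coe_nonneg)
        simpa [hα.ne'] using hcont.tendsto x
      filter_upwards [hmodulus.eventually (gt_mem_nhds hη)] with y hy
      rintro ⟨_, n, rfl⟩
      rw [hUb, hUb]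
      exact ((hK n).dist_le x y).trans_lt hy
  obtain ⟨U₀, -, σ, hσ, hlim⟩ :=
    hcompact.tendsto_subseq fun n => subset_closure (Set.mem_range_self n)
  have hunif : TendstoUniformly (fun n => u (σ n)) (fun x => U₀ (toTorus x)) atTop := by
    simpa only [Function.comp_def, hUb] using
      (BoundedContinuousFunction.tendsto_iff_tendstoUniformly.1 hlim).comp toTorus
  refine ⟨fun x => U₀ (toTorus x), σ, hσ, IsPeriodic.comp_toTorus U₀, fun y z => ?_, hunif⟩
  exact le_of_tendsto' ((hunif.tendsto_at y).edist (hunif.tendsto_at z)) fun n => hK (σ n) y z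

theorem abs_sub_truncate_le {k : ℝ} (hk : 0 ≤ k) (t : ℝ) :
    |t - truncate k t| ≤ max 0 (|t| - k) := by
  unfold truncate
  grind

theorem abs_sub_truncate_le_sq {k : ℝ} (hk : 0 ≤ k) (t : ℝ) :
    |t - truncate k t| ≤ (t ^ 2 + 1) / (k + 1) := by
  refine (abs_sub_truncate_le hk t).trans (max_le (by positivity) ?_)
  rw [le_div_iff₀ (by positivity), ← sq_abs t]
  nlinarith [sq_nonneg (|t| - 2 * k), sq_nonneg (3 * |t| - 2)]

theorem abs_sub_truncate_le_mul_log {k t : ℝ} (hk : 0 ≤ k) (ht : 0 < t) :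
    |t - truncate k t| ≤ (t * Real.log t + 2) / Real.log (k + 2) := by
  have hlogk : 0 < Real.log (k + 2) := Real.log_pos (by linarith)
  have hentropy : t - 1 ≤ t * Real.log t := by
    have hlog := Real.one_sub_inv_le_log_of_pos ht
    calc t - 1 = t * (1 - t⁻¹) := by field_simp
      _ ≤ t * Real.log t := by gcongr
  have hyoung : t * Real.log (k + 2) ≤ t * Real.log t - t + (k + 2) := by
    have hlog := Real.log_le_sub_one_of_pos (show 0 < (k + 2) / t by positivity)
    rw [Real.log_div (by positivity) ht.ne'] at hlog
    calc t * Real.log (k + 2) ≤ t * (Real.log t + ((k + 2) / t - 1)) := by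
          gcongr
          linarith
      _ = t * Real.log t - t + (k + 2) := by field_simp; ring
  refine (abs_sub_truncate_le hk t).trans (max_le (div_nonneg (by linarith) hlogk.le) ?_)
  rw [le_div_iff₀ hlogk, abs_of_pos ht]
  rcases le_or_gt t k with htk | hkt
  · nlinarith
  · nlinarith [mul_nonneg hk hlogk.le]

section Truncation

variable {Ω : Type*} [MeasurableSpace Ω] {ν : Measure Ω} [IsProbabilityMeasure ν] {w : Ω → ℝ}
  {C k : ℝ}

theorem integral_abs_sub_truncate_le_of_integral_sq_le (hw : MemLp w 2 ν)
    (hC : ∫ x, w x ^ 2 ∂ν ≤ C) (hk : 0 ≤ k) :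
    ∫ x, |w x - truncate k (w x)| ∂ν ≤ (C + 1) / (k + 1) :=
  calc ∫ x, |w x - truncate k (w x)| ∂ν ≤ ∫ x, (w x ^ 2 + 1) / (k + 1) ∂ν :=
        integral_mono ((hw.integrable one_le_two).sub (integrable_truncate_comp hw.1 hk)).abs
          ((hw.integrable_sq.add (integrable_const 1)).div_const _)
          fun x => abs_sub_truncate_le_sq hk (w x)
    _ = (∫ x, w x ^ 2 ∂ν + 1) / (k + 1) := by
        rw [integral_div, integral_add hw.integrable_sq (integrable_const _)]
        simp
    _ ≤ (C + 1) / (k + 1) := by gcongr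

theorem integral_abs_sub_truncate_le_of_integral_mul_log_le (hw : Integrable w ν)
    (hlog : Integrable (fun x => w x * Real.log (w x)) ν) (hpos : ∀ x, 0 < w x)
    (hC : ∫ x, w x * Real.log (w x) ∂ν ≤ C) (hk : 0 ≤ k) :
    ∫ x, |w x - truncate k (w x)| ∂ν ≤ (C + 2) / Real.log (k + 2) := by
  have hlogk : 0 < Real.log (k + 2) := Real.log_pos (by linarith)
  calc ∫ x, |w x - truncate k (w x)| ∂ν
      ≤ ∫ x, (w x * Real.log (w x) + 2) / Real.log (k + 2) ∂ν :=
        integral_mono (hw.sub (integrable_truncate_comp hw.1 hk)).abs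
          ((hlog.add (integrable_const 2)).div_const _)
          fun x => abs_sub_truncate_le_mul_log hk (hpos x)
    _ = (∫ x, w x * Real.log (w x) ∂ν + 2) / Real.log (k + 2) := by
        rw [integral_div, integral_add hlog (integrable_const _)]
        simp
    _ ≤ (C + 2) / Real.log (k + 2) := by gcongr

end Truncation

theorem tendsto_div_natCast_add_one (C : ℝ) :
    Tendsto (fun k : ℕ => C / ((k : ℝ) + 1)) atTop (𝓝 0) :=
  tendsto_const_nhds.div_atTop (tendsto_natCast_atTop_atTop.atTop_add tendsto_const_nhds)

theorem tendsto_div_log_natCast_add_two (C : ℝ) :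
    Tendsto (fun k : ℕ => C / Real.log ((k : ℝ) + 2)) atTop (𝓝 0) :=
  tendsto_const_nhds.div_atTop (Real.tendsto_log_atTop.comp
    (tendsto_natCast_atTop_atTop.atTop_add tendsto_const_nhds))

namespace SolvesMFG

variable {V : Euc d × Euc d → ℝ} {P : Euc d} {ε : ℝ} {u m : Euc d → ℝ} {H M : ℝ}

theorem integral_abs_sub_truncate_density_le (h : SolvesMFG V P ε u m H) (hM : ∀ z, |V z| ≤ M)
    {k : ℝ} (hk : 0 ≤ k) :
    ∫ x, |m x - truncate k (m x)| ∂cellVol d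
      ≤ (‖P‖ ^ 2 / 2 + 2 * M + 2) / Real.log (k + 2) := by
  have hm := h.continuous_density
  refine integral_abs_sub_truncate_le_of_integral_mul_log_le (integrable_cellVol_of_continuous hm)
    (integrable_cellVol_of_continuous (hm.mul (hm.log fun x => (h.m_pos x).ne'))) h.m_pos ?_ hk
  linarith [h.integral_mul_log_le hM, h.neg_le_hamiltonian hM]

theorem integral_partialDeriv_pow_le (h : SolvesMFG V P ε u m H) (hM : ∀ z, |V z| ≤ M)
    (i : Fin d) (r : ℕ) :
    ∫ x, partialDeriv i u x ^ (2 * r) ∂cellVol d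
      ≤ 2 ^ (2 * r - 1) *
        (2 ^ r * r.factorial * Real.exp (‖P‖ ^ 2 / 2 + 2 * M) + ‖P‖ ^ (2 * r)) := by
  have hgrad := h.smooth_u.continuous_gradient
  have hpartial := (h.smooth_u.partialDeriv i).continuous
  refine (integral_mono (integrable_cellVol_of_continuous (by fun_prop))
    (integrable_cellVol_of_continuous (by fun_prop)) fun x => ?_).trans
    (h.integral_norm_gradient_pow_le hM r)
  rw [← (even_two_mul r).pow_abs, ← gradient_apply]
  exact pow_le_pow_left₀ (abs_nonneg _) (PiLp.norm_apply_le (gradient u x) i) _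

/- Morrey's inequality with the exponent `2 d`, whose Hölder exponent `1 - d / (2 d)` is `1 / 2`. -/
theorem exists_abs_le_and_holderWith_half (hd : 0 < d) (hM : ∀ z, |V z| ≤ M) (P : Euc d) :
    ∃ (A : ℝ) (K : ℝ≥0), ∀ ε u m H, SolvesMFG V P ε u m H →
      (∀ y, |u y| ≤ A) ∧ HolderWith K (1 / 2) u := by
  have hd' : (1 : ℝ) ≤ d := Nat.one_le_cast.2 hd
  have hexponent : 1 - (d : ℝ) / (2 * d) = 1 / 2 := by field_simp; norm_num
  set C : ℝ := 2 ^ (2 * d - 1) *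
    (2 ^ d * d.factorial * Real.exp (‖P‖ ^ 2 / 2 + 2 * M) + ‖P‖ ^ (2 * d))
  set B : ℝ := C ^ (2 * d : ℝ)⁻¹ with hB_def
  have hB : 0 ≤ B := by positivity
  have hgrad : ∀ {ε u m H}, SolvesMFG V P ε u m H →
      ∫ x, ‖gradient u x‖ ^ (2 * d : ℝ) ∂cellVol d ≤ B ^ (2 * d : ℝ) := fun {ε u m H} h => by
    rw [hB_def, Real.rpow_inv_rpow (by positivity) (by positivity)]
    have hpow : ∀ x, ‖gradient u x‖ ^ (2 * d : ℝ) = ‖gradient u x‖ ^ (2 * d) := fun x => by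
      rw [← Real.rpow_natCast]
      push_cast
      rfl
    simpa only [hpow] using h.integral_norm_gradient_pow_le hM d
  refine ⟨√d / (1 / 2) * B, _, fun ε u m H h => ⟨fun y => ?_, holderWith_of_abs_sub_le
    (K := (2 * (√d / (1 / 2)) + 1) * B) fun y z => ?_⟩⟩
  · have hmean := abs_sub_integral_le h.smooth_u.contDiff_one h.smooth_u.periodic
      (by linarith) (by linarith) hB (hgrad h) y
    rwa [h.integral_u, sub_zero, hexponent] at hmean
  · have hmorrey := abs_sub_le_mul_rpow h.smooth_u.contDiff_one h.smooth_u.periodic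
      (by linarith) (by linarith) hB (hgrad h) y z
    rw [hexponent] at hmorrey
    exact_mod_cast hmorrey

end SolvesMFG

/-- Boundedness of the sequence `w` in `L^p` of the cell for every `p < ∞`, in terms of even
moments. -/
def HasBoundedMoments (w : ℕ → Euc d → ℝ) : Prop :=
  ∀ r : ℕ, ∃ C, ∀ n, ∫ x, w n x ^ (2 * r) ∂cellVol d ≤ C

theorem HasBoundedMoments.exists_eLpNorm_le {w : ℕ → Euc d → ℝ} (hb : HasBoundedMoments w)
    (hw : ∀ n, Continuous (w n)) {p : ℝ≥0∞} (hp : p ≠ ⊤) :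
    ∃ C : ℝ≥0∞, C ≠ ⊤ ∧ ∀ n, eLpNorm (w n) p (cellVol d) ≤ C := by
  obtain ⟨r, hr⟩ := ENNReal.exists_nat_gt hp
  have hr0 : r ≠ 0 := by rintro rfl; simp at hr
  obtain ⟨C, hC⟩ := hb r
  refine ⟨ENNReal.ofReal C ^ (1 / ((2 * r : ℕ) : ℝ)),
    ENNReal.rpow_ne_top_of_nonneg (by positivity) ENNReal.ofReal_ne_top, fun n => ?_⟩
  have hwn := hw n
  have hpr : p ≤ (2 * r : ℕ) :=
    hr.le.trans (Nat.cast_le.2 (Nat.le_mul_of_pos_left r two_pos))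
  refine (eLpNorm_le_eLpNorm_of_exponent_le hpr hwn.aestronglyMeasurable).trans
    (eLpNorm_le_of_integral_abs_pow_le (by positivity)
      (integrable_cellVol_of_continuous (by fun_prop)) ?_)
  simpa only [(even_two_mul r).pow_abs] using hC n

/-! ### Passage to the limit -/

/-- `W` is a two-scale limit of the sequence `w` along the scales `ε`. It lives on the product of
two tori and is tested against all continuous functions there. -/
structure IsTwoScaleLimit (ε : ℕ → ℝ) (w : ℕ → Euc d → ℝ) (W : Torus d × Torus d → ℝ) :
    Prop where
  stronglyMeasurable : StronglyMeasurable W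
  integrable : Integrable W (volume.prod volume)
  tendstoAlong : TendstoAlong (cellVol d) (volume.prod volume) (fun n => twoScaleMap (ε n)) w W

section TwoScaleLimit

variable {ε : ℕ → ℝ}

theorem exists_strictMono_forall_isTwoScaleLimit (hε : ∀ n, ε n ≠ 0)
    (hε0 : Tendsto ε atTop (𝓝 0)) {ι : Type*} [Countable ι] {w : ι → ℕ → Euc d → ℝ}
    (hw : ∀ i n, Integrable (w i n) (cellVol d)) {δ : ι → ℕ → ℝ}
    (hδ : ∀ i, Tendsto (δ i) atTop (𝓝 0))
    (hwδ : ∀ i n (k : ℕ), ∫ x, |w i n x - truncate k (w i n x)| ∂cellVol d ≤ δ i k) :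
    ∃ σ : ℕ → ℕ, StrictMono σ ∧
      ∀ i, ∃ W, IsTwoScaleLimit (fun n => ε (σ n)) (fun n => w i (σ n)) W := by
  obtain ⟨σ, hσ, hW⟩ := exists_strictMono_forall_tendstoAlong
    (fun n => (continuous_twoScaleMap (ε n)).measurable) (tendsto_integral_twoScaleMap hε hε0)
    hw hδ hwδ
  exact ⟨σ, hσ, fun i => (hW i).imp fun W h => ⟨h.1, h.2.1, h.2.2⟩⟩

variable {w : ℕ → Euc d → ℝ} {W : Torus d × Torus d → ℝ} {q : ℝ≥0∞}

theorem memLp_marginal (hq1 : 1 ≤ q) (hq : q ≠ ⊤) (hW : MemLp W q (volume.prod volume)) :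
    MemLp (fun x => ∫ b, W (toTorus x, b)) q (cellVol d) :=
  (memLp_integral_prod hW hq1 hq).comp_measurePreserving measurePreserving_toTorus

namespace IsTwoScaleLimit

theorem integral_toTorus (h : IsTwoScaleLimit ε w W) (x : Euc d) :
    ∫ y, W (toTorus x, toTorus y) ∂cellVol d = ∫ b, W (toTorus x, b) :=
  integral_comp_measurePreserving measurePreserving_toTorus
    (h.stronglyMeasurable.comp_measurable measurable_prodMk_left).aestronglyMeasurable

theorem twoScale (h : IsTwoScaleLimit ε w W) (hw : ∀ n, MemLp (w n) q (cellVol d))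
    (hW : MemLp W q (volume.prod volume)) :
    TwoScale q ε w fun z => W (toTorus z.1, toTorus z.2) := by
  refine ⟨hw, hW.comp_measurePreserving measurePreserving_toTorus_prod, fun ψ hψ => ?_⟩
  obtain ⟨Ψ, hΨ⟩ := exists_lift₂ hψ.smooth.continuous hψ.periodic_fst hψ.periodic_snd
  have hint : Integrable (fun z => W z * Ψ z) (volume.prod volume) :=
    integrable_mul_comp h.integrable measurable_id Ψ
  have hfubini : ∫ z, W z * Ψ z ∂volume.prod volume
      = ∫ x, ∫ y, W (toTorus x, toTorus y) * ψ (x, y) ∂cellVol d ∂cellVol d := by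
    have hint' : Integrable
        (fun z : Euc d × Euc d => W (toTorus z.1, toTorus z.2) * Ψ (toTorus z.1, toTorus z.2))
        ((cellVol d).prod (cellVol d)) :=
      measurePreserving_toTorus_prod.integrable_comp_of_integrable hint
    rw [← integral_comp_measurePreserving measurePreserving_toTorus_prod hint.1]
    refine (integral_prod _ hint').trans ?_
    simp only [hΨ]
  simpa only [hfubini, twoScaleMap, hΨ] using h.tendstoAlong Ψ

theorem tendsto_integral_mul (h : IsTwoScaleLimit ε w W) (φ : C(Torus d, ℝ)) :
    Tendsto (fun n => ∫ x, w n x * φ (toTorus x) ∂cellVol d) atTop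
      (𝓝 (∫ x, (∫ b, W (toTorus x, b)) * φ (toTorus x) ∂cellVol d)) := by
  simpa using h.tendstoAlong.integral_mul_fast_mul h.integrable 1 φ

theorem weakLp_one (h : IsTwoScaleLimit ε w W) (hw : ∀ n, Integrable (w n) (cellVol d))
    {δ : ℕ → ℝ} (hδ : Tendsto δ atTop (𝓝 0))
    (hwδ : ∀ n (k : ℕ), ∫ x, |w n x - truncate k (w n x)| ∂cellVol d ≤ δ k) :
    WeakLp 1 w fun x => ∫ b, W (toTorus x, b) := by
  have hmarginal := memLp_marginal le_rfl ENNReal.one_ne_top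
    (memLp_one_iff_integrable.2 h.integrable)
  refine ⟨fun n => memLp_one_iff_integrable.2 (hw n), hmarginal, fun q' hq' g hg => ?_⟩
  obtain rfl : q' = ⊤ := by simpa using hq'.inv_add_inv_eq_one
  exact tendsto_integral_mul_of_memLp_top hw (memLp_one_iff_integrable.1 hmarginal) hδ hwδ
    h.tendsto_integral_mul hg

theorem memLp (h : IsTwoScaleLimit ε w W) (hε : ∀ n, ε n ≠ 0) (hε0 : Tendsto ε atTop (𝓝 0))
    (hw : ∀ n, Continuous (w n)) (hb : HasBoundedMoments w) (hq : q ≠ ⊤) :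
    MemLp W q (volume.prod volume) := by
  obtain ⟨r, hr⟩ := ENNReal.exists_nat_gt hq
  have hr0 : r ≠ 0 := by rintro rfl; simp at hr
  obtain ⟨C, hC⟩ := hb r
  have hqr : q ≤ (2 * r : ℕ) :=
    hr.le.trans (Nat.cast_le.2 (Nat.le_mul_of_pos_left r two_pos))
  exact (h.tendstoAlong.memLp_natCast (fun n => (continuous_twoScaleMap (ε n)).measurable)
    (tendsto_integral_twoScaleMap hε hε0) (fun n => integrable_cellVol_of_continuous (hw n))
    h.integrable (by positivity) (even_two_mul r)
    (fun n => integrable_cellVol_of_continuous ((hw n).pow _)) hC).mono_exponent hqr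

theorem weakLp (h : IsTwoScaleLimit ε w W) (hε : ∀ n, ε n ≠ 0) (hε0 : Tendsto ε atTop (𝓝 0))
    (hw : ∀ n, Continuous (w n)) (hb : HasBoundedMoments w) (hq1 : 1 ≤ q) (hq : q ≠ ⊤) :
    WeakLp q w fun x => ∫ b, W (toTorus x, b) := by
  have hmarginal : ∀ {p : ℝ≥0∞}, 1 ≤ p → p ≠ ⊤ →
      MemLp (fun x => ∫ b, W (toTorus x, b)) p (cellVol d) := fun hp1 hp =>
    memLp_marginal hp1 hp (h.memLp hε hε0 hw hb hp)
  have hwLp : ∀ (p : ℝ≥0∞) n, MemLp (w n) p (cellVol d) := fun p n =>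
    memLp_cellVol_of_continuous (hw n) p
  refine ⟨hwLp q, hmarginal hq1 hq, fun q' hq' g hg => ?_⟩
  rcases eq_or_ne q' ⊤ with rfl | hq'_top
  · obtain ⟨C, hC, hwC⟩ := hb.exists_eLpNorm_le hw ENNReal.ofNat_ne_top (p := 2)
    exact tendsto_integral_mul_of_memLp (p := 2) ENNReal.ofNat_ne_top (hwLp 2)
      (hmarginal one_le_two ENNReal.ofNat_ne_top) hC hwC h.tendsto_integral_mul
      (hg.mono_exponent (p := 2) le_top)
  · obtain ⟨C, hC, hwC⟩ := hb.exists_eLpNorm_le hw hq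
    exact tendsto_integral_mul_of_memLp hq'_top (hwLp q) (hmarginal hq1 hq) hC hwC
      h.tendsto_integral_mul hg

end IsTwoScaleLimit

end TwoScaleLimit

theorem TwoScale.tendsto_integral {q : ℝ≥0∞} {ε : ℕ → ℝ} {w : ℕ → Euc d → ℝ}
    {w₀ : Euc d × Euc d → ℝ} (h : TwoScale q ε w w₀) :
    Tendsto (fun n => ∫ x, w n x ∂cellVol d) atTop
      (𝓝 (∫ x, ∫ y, w₀ (x, y) ∂cellVol d ∂cellVol d)) := by
  simpa using h.tendsto (fun _ => 1) ⟨contDiff_const, fun _ _ _ => rfl, fun _ _ _ => rfl⟩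

theorem weakLp_of_tendstoUniformly {f : ℕ → Euc d → ℝ} {f₀ : Euc d → ℝ}
    (hf : ∀ n, Continuous (f n)) (h : TendstoUniformly f f₀ atTop) (q : ℝ≥0∞) :
    WeakLp q f f₀ := by
  have hf₀ : Continuous f₀ := h.continuous (Frequently.of_forall hf)
  refine ⟨fun n => memLp_cellVol_of_continuous (hf n) q, memLp_cellVol_of_continuous hf₀ q,
    fun q' hq' g hg => ?_⟩
  have hbound : Integrable (fun x => (|f₀ x| + 1) * |g x|) (cellVol d) :=
    MemLp.integrable_mul (p := q) (q := q') (memLp_cellVol_of_continuous (by fun_prop) q) hg.abs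
  refine tendsto_integral_filter_of_dominated_convergence _ (Eventually.of_forall fun n =>
    (hf n).aestronglyMeasurable.mul hg.1) ?_ hbound
    (ae_of_all _ fun x => (h.tendsto_at x).mul_const _)
  filter_upwards [Metric.tendstoUniformly_iff.1 h 1 one_pos] with n hn
  refine ae_of_all _ fun x => ?_
  rw [Real.norm_eq_abs, abs_mul]
  gcongr
  have hdist := hn x
  rw [dist_comm, Real.dist_eq] at hdist
  linarith [abs_sub_abs_le_abs_sub (f n x) (f₀ x)]

theorem weakSobolev_of_weakLp {q : ℝ≥0∞} (hq1 : 1 ≤ q) {u : ℕ → Euc d → ℝ} {u₀ : Euc d → ℝ}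
    {g₀ : Euc d → Euc d} (hu : ∀ n, SmoothPeriodic (u n)) (h : WeakLp q u u₀)
    (hgrad : ∀ i, WeakLp q (fun n => partialDeriv i (u n)) fun x => g₀ x i) :
    WeakSobolev q u u₀ g₀ := by
  refine ⟨⟨h.memLp_lim, MemLp.of_eval_piLp fun i => (hgrad i).memLp_lim, fun φ hφ i => ?_⟩, h,
    fun i => by simpa only [gradient_apply] using hgrad i⟩
  have hconj : q.HolderConjugate q.conjExponent := ENNReal.HolderConjugate.conjExponent hq1
  have hφLp : MemLp φ q.conjExponent (cellVol d) := memLp_cellVol_of_continuous hφ.continuous _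
  have hφ'Lp : MemLp (partialDeriv i φ) q.conjExponent (cellVol d) :=
    memLp_cellVol_of_continuous (hφ.partialDeriv i).continuous _
  have hleft := h.tendsto _ hconj _ hφ'Lp
  simp only [integral_mul_partialDeriv (hu _) hφ] at hleft
  simp only [gradient_apply]
  exact tendsto_nhds_unique hleft ((hgrad i).tendsto _ hconj _ hφLp).neg

theorem WeakLp.tendsto_integral {q : ℝ≥0∞} (hq1 : 1 ≤ q) {f : ℕ → Euc d → ℝ} {f₀ : Euc d → ℝ}
    (h : WeakLp q f f₀) :
    Tendsto (fun n => ∫ x, f n x ∂cellVol d) atTop (𝓝 (∫ x, f₀ x ∂cellVol d)) := by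
  simpa using h.tendsto _ (ENNReal.HolderConjugate.conjExponent hq1) _ (memLp_const 1)

theorem exists_corrector {ε : ℕ → ℝ} (hε : ∀ n, 0 < ε n) (hε0 : Tendsto ε atTop (𝓝 0))
    {u : ℕ → Euc d → ℝ} (hu : ∀ n, SmoothPeriodic (u n))
    (hb : ∀ i, HasBoundedMoments fun n => partialDeriv i (u n))
    {W : Fin d → Torus d × Torus d → ℝ}
    (hW : ∀ i, IsTwoScaleLimit ε (fun n => partialDeriv i (u n)) (W i))
    {q : ℝ≥0∞} (hq1 : 1 ≤ q) (hq : q ≠ ⊤) :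
    ∃ w, MemLpSobolevPer q w fun z =>
      WithLp.toLp 2 fun i => W i (toTorus z.1, toTorus z.2) - ∫ b, W i (toTorus z.1, b) := by
  have hu' : ∀ i n, Continuous (partialDeriv i (u n)) := fun i n =>
    ((hu n).partialDeriv i).continuous
  have hWLp : ∀ i {p : ℝ≥0∞}, p ≠ ⊤ → MemLp (W i) p (volume.prod volume) := fun i _ hp =>
    (hW i).memLp (fun n => (hε n).ne') hε0 (hu' i) (hb i) hp
  choose C hC huC using fun i => (hb i).exists_eLpNorm_le (hu' i) (p := 2) ENNReal.ofNat_ne_top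
  have hsection : ∀ i, ∀ᵐ x ∂cellVol d, Integrable (fun b => W i (toTorus x, b)) volume := fun i =>
    measurePreserving_toTorus.quasiMeasurePreserving.ae (hW i).integrable.prod_right_ae
  refine exists_memLpSobolevPer hq1 hq
    (k := fun i z => W i z - ∫ b, W i (z.1, b)) (fun i => ?_) (fun i => ?_) ?_
    (fun θ hθ i j => ?_)
  · exact (hW i).stronglyMeasurable.sub
      ((hW i).stronglyMeasurable.integral_prod_right'.comp_measurable measurable_fst)
  · exact (hWLp i hq).sub ((memLp_integral_prod (hWLp i hq) hq1 hq).comp_measurePreserving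
      measurePreserving_fst)
  · filter_upwards [ae_all_iff.2 hsection] with x hx i
    rw [integral_sub (hx i) (integrable_const _)]
    simp
  · have hdrop_mean : ∀ i j : Fin d, ∀ᵐ x ∂cellVol d,
        ∫ y, (W j (toTorus x, toTorus y) - ∫ b, W j (toTorus x, b)) * partialDeriv i θ y ∂cellVol d
          = ∫ y, W j (toTorus x, toTorus y) * partialDeriv i θ y ∂cellVol d := fun i j => by
      filter_upwards [hsection j] with x hx
      simp only [sub_mul]
      rw [integral_sub (integrable_mul_comp_toTorus hx (hθ.partialDeriv i))
        ((integrable_cellVol_of_continuous (hθ.partialDeriv i).continuous).const_mul _),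
        integral_const_mul, integral_partialDeriv_eq_zero hθ, mul_zero, sub_zero]
    filter_upwards [hdrop_mean i j, hdrop_mean j i,
      TendstoAlong.ae_integral_mul_partialDeriv_eq hε hε0 hu (ENNReal.sum_ne_top.2 fun i _ => hC i)
        (fun n i => (huC i n).trans (Finset.single_le_sum (fun _ _ => zero_le)
          (Finset.mem_univ i)))
        (fun i => (hW i).stronglyMeasurable) (fun i => hWLp i ENNReal.ofNat_ne_top)
        (fun i => (hW i).tendstoAlong) hθ i j] with x hij hji hcurl
    rw [hij, hji, hcurl]

theorem exists_twoScale_gradient {ε : ℕ → ℝ} (hε : ∀ n, 0 < ε n) (hε0 : Tendsto ε atTop (𝓝 0))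
    {u : ℕ → Euc d → ℝ} (hu : ∀ n, SmoothPeriodic (u n))
    (hb : ∀ i, HasBoundedMoments fun n => partialDeriv i (u n))
    {W : Fin d → Torus d × Torus d → ℝ}
    (hW : ∀ i, IsTwoScaleLimit ε (fun n => partialDeriv i (u n)) (W i))
    {q : ℝ≥0∞} (hq1 : 1 ≤ q) (hq : q ≠ ⊤) {u₀ : Euc d → ℝ} (hu₀ : WeakLp q u u₀) :
    ∃ g₀ u₁ G₁, WeakSobolev q u u₀ g₀ ∧ MemLpSobolevPer q u₁ G₁ ∧
      ∀ i, TwoScale q ε (fun n x => gradient (u n) x i) fun z => g₀ z.1 i + G₁ z i := by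
  have hpartial : ∀ i n, Continuous (partialDeriv i (u n)) := fun i n =>
    ((hu n).partialDeriv i).continuous
  let g₀ : Euc d → Euc d := fun x => WithLp.toLp 2 fun i => ∫ b, W i (toTorus x, b)
  obtain ⟨u₁, hu₁⟩ := exists_corrector hε hε0 hu hb hW hq1 hq
  refine ⟨g₀, u₁, _, weakSobolev_of_weakLp hq1 hu hu₀ fun i => ?_, hu₁, fun i => ?_⟩
  · exact (hW i).weakLp (fun n => (hε n).ne') hε0 (hpartial i) (hb i) hq1 hq
  · simpa [g₀, gradient_apply] using (hW i).twoScale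
      (fun n => memLp_cellVol_of_continuous (hpartial i n) q)
      ((hW i).memLp (fun n => (hε n).ne') hε0 (hpartial i) (hb i) hq)

namespace SolvesMFG

variable {V : Euc d × Euc d → ℝ} {P : Euc d} {ε : ℕ → ℝ} {u m : ℕ → Euc d → ℝ} {H : ℕ → ℝ} {M : ℝ}

theorem hasBoundedMoments_partialDeriv (h : ∀ n, SolvesMFG V P (ε n) (u n) (m n) (H n))
    (hM : ∀ z, |V z| ≤ M) (i : Fin d) : HasBoundedMoments fun n => partialDeriv i (u n) :=
  fun r => ⟨_, fun n => (h n).integral_partialDeriv_pow_le hM i r⟩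

theorem exists_strictMono_tendstoUniformly (hd : 0 < d)
    (h : ∀ n, SolvesMFG V P (ε n) (u n) (m n) (H n)) (hM : ∀ z, |V z| ≤ M) :
    ∃ (u₀ : Euc d → ℝ) (σ : ℕ → ℕ), StrictMono σ ∧ IsPeriodic u₀ ∧
      (∃ K, HolderWith K (1 / 2) u₀) ∧ TendstoUniformly (fun n => u (σ n)) u₀ atTop := by
  obtain ⟨A, K, hAK⟩ := exists_abs_le_and_holderWith_half hd hM P
  obtain ⟨u₀, σ, hσ, hper, hholder, hlim⟩ := TwoScaleMFG.exists_strictMono_tendstoUniformly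
    (fun n => (h n).smooth_u.periodic) (fun n => (hAK _ _ _ _ (h n)).1) (by simp)
    (fun n => (hAK _ _ _ _ (h n)).2)
  exact ⟨u₀, σ, hσ, hper, ⟨K, hholder⟩, hlim⟩

theorem exists_strictMono_tendsto_hamiltonian (h : ∀ n, SolvesMFG V P (ε n) (u n) (m n) (H n))
    (hM : ∀ z, |V z| ≤ M) :
    ∃ (H₀ : ℝ) (σ : ℕ → ℕ), StrictMono σ ∧ Tendsto (fun n => H (σ n)) atTop (𝓝 H₀) := by
  obtain ⟨H₀, -, σ, hσ, hlim⟩ := isCompact_Icc.tendsto_subseq fun n =>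
    Set.mem_Icc.2 ⟨(h n).neg_le_hamiltonian hM, (h n).hamiltonian_le hM⟩
  exact ⟨H₀, σ, hσ, hlim⟩

theorem exists_strictMono_isTwoScaleLimit (hε : ∀ n, ε n ≠ 0) (hε0 : Tendsto ε atTop (𝓝 0))
    (h : ∀ n, SolvesMFG V P (ε n) (u n) (m n) (H n)) (hM : ∀ z, |V z| ≤ M) :
    ∃ (Wm : Torus d × Torus d → ℝ) (W : Fin d → Torus d × Torus d → ℝ) (σ : ℕ → ℕ),
      StrictMono σ ∧ IsTwoScaleLimit (fun n => ε (σ n)) (fun n => m (σ n)) Wm ∧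
      ∀ i, IsTwoScaleLimit (fun n => ε (σ n)) (fun n => partialDeriv i (u (σ n))) (W i) := by
  have hpartial : ∀ i n, Continuous (partialDeriv i (u n)) := fun i n =>
    ((h n).smooth_u.partialDeriv i).continuous
  obtain ⟨σ, hσ, hW⟩ := exists_strictMono_forall_isTwoScaleLimit hε hε0
    (w := fun (o : Option (Fin d)) n => o.elim (m n) fun i => partialDeriv i (u n))
    (δ := fun (o : Option (Fin d)) k => o.elim
      ((‖P‖ ^ 2 / 2 + 2 * M + 2) / Real.log (k + 2))
      fun _ => (2 * (2 * Real.exp (‖P‖ ^ 2 / 2 + 2 * M) + ‖P‖ ^ 2) + 1) / (k + 1))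
    (by
      rintro (_ | i) n
      exacts [integrable_cellVol_of_continuous (h n).continuous_density,
        integrable_cellVol_of_continuous (hpartial i n)])
    (by
      rintro (_ | _)
      exacts [tendsto_div_log_natCast_add_two _, tendsto_div_natCast_add_one _])
    (by
      rintro (_ | i) n k
      · exact (h n).integral_abs_sub_truncate_density_le hM k.cast_nonneg
      · exact integral_abs_sub_truncate_le_of_integral_sq_le
          (memLp_cellVol_of_continuous (hpartial i n) 2)
          (by simpa using (h n).integral_partialDeriv_pow_le hM i 1) k.cast_nonneg)
  obtain ⟨Wm, hWm⟩ := hW none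
  choose W hW using fun i => hW (some i)
  exact ⟨Wm, W, σ, hσ, hWm, hW⟩

theorem twoScale_density (h : ∀ n, SolvesMFG V P (ε n) (u n) (m n) (H n)) (hM : ∀ z, |V z| ≤ M)
    {W : Torus d × Torus d → ℝ} (hW : IsTwoScaleLimit ε m W) :
    TwoScale 1 ε m (fun z => W (toTorus z.1, toTorus z.2)) ∧
      ∫ x, ∫ y, W (toTorus x, toTorus y) ∂cellVol d ∂cellVol d = 1 ∧
      WeakLp 1 m fun x => ∫ y, W (toTorus x, toTorus y) ∂cellVol d := by
  have hm : ∀ n, Integrable (m n) (cellVol d) := fun n =>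
    integrable_cellVol_of_continuous (h n).continuous_density
  have htwoScale := hW.twoScale (fun n => memLp_one_iff_integrable.2 (hm n))
    (memLp_one_iff_integrable.2 hW.integrable)
  refine ⟨htwoScale, ?_, ?_⟩
  · have hmass := htwoScale.tendsto_integral
    simp only [(h _).integral_m] at hmass
    exact tendsto_nhds_unique hmass tendsto_const_nhds
  · simpa only [hW.integral_toTorus] using hW.weakLp_one hm (tendsto_div_log_natCast_add_two _)
      fun n k => (h n).integral_abs_sub_truncate_density_le hM k.cast_nonneg

theorem exists_strictMono_limits (hd : 0 < d) (hε : ∀ n, ε n ≠ 0) (hε0 : Tendsto ε atTop (𝓝 0))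
    (h : ∀ n, SolvesMFG V P (ε n) (u n) (m n) (H n)) (hM : ∀ z, |V z| ≤ M) :
    ∃ (σ : ℕ → ℕ) (u₀ : Euc d → ℝ) (H₀ : ℝ) (Wm : Torus d × Torus d → ℝ)
      (W : Fin d → Torus d × Torus d → ℝ), StrictMono σ ∧
      (IsPeriodic u₀ ∧ (∃ K, HolderWith K (1 / 2) u₀) ∧
        TendstoUniformly (fun n => u (σ n)) u₀ atTop) ∧
      Tendsto (fun n => H (σ n)) atTop (𝓝 H₀) ∧
      IsTwoScaleLimit (fun n => ε (σ n)) (fun n => m (σ n)) Wm ∧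
      ∀ i, IsTwoScaleLimit (fun n => ε (σ n)) (fun n => partialDeriv i (u (σ n))) (W i) := by
  obtain ⟨u₀, σ₁, hσ₁, hper, hholder, hu⟩ := exists_strictMono_tendstoUniformly hd h hM
  obtain ⟨H₀, σ₂, hσ₂, hH⟩ := exists_strictMono_tendsto_hamiltonian (fun n => h (σ₁ n)) hM
  obtain ⟨Wm, W, σ₃, hσ₃, hWm, hW⟩ := exists_strictMono_isTwoScaleLimit
    (fun n => hε (σ₁ (σ₂ n))) (hε0.comp (hσ₁.comp hσ₂).tendsto_atTop)
    (fun n => h (σ₁ (σ₂ n))) hM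
  exact ⟨fun n => σ₁ (σ₂ (σ₃ n)), u₀, H₀, Wm, W, hσ₁.comp (hσ₂.comp hσ₃),
    ⟨hper, hholder, fun N hN => (hσ₂.comp hσ₃).tendsto_atTop.eventually (hu N hN)⟩,
    hH.comp hσ₃.tendsto_atTop, hWm, hW⟩

end SolvesMFG

theorem mainTheorem6_general (hd : 0 < d) (P : Euc d) (V : Euc d × Euc d → ℝ)
    {M : ℝ} (hV : ∀ z, |V z| ≤ M)
    (ε : ℕ → ℝ) (hε : ∀ n, 0 < ε n) (hε0 : Tendsto ε atTop (𝓝 0))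
    (u m : ℕ → Euc d → ℝ) (H : ℕ → ℝ)
    (hsol : ∀ n, SolvesMFG V P (ε n) (u n) (m n) (H n))
    (q : ℝ≥0∞) (hq1 : 1 ≤ q) (hq : q ≠ ⊤) :
    ∃ (α : ℝ≥0) (u₀ : Euc d → ℝ) (g₀ : Euc d → Euc d)
      (u₁ : Euc d × Euc d → ℝ) (G₁ : Euc d × Euc d → Euc d)
      (m₂ : Euc d × Euc d → ℝ) (Hbar : ℝ) (σ : ℕ → ℕ),
      (0 < α ∧ α < 1) ∧
      IsPeriodic u₀ ∧ (∃ C : ℝ≥0, HolderWith C α u₀) ∧ MemSobolev q u₀ g₀ ∧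
      ∫ x, u₀ x ∂cellVol d = 0 ∧
      MemLpSobolevPer q u₁ G₁ ∧
      MemLp m₂ 1 ((cellVol d).prod (cellVol d)) ∧
      ∫ x, ∫ y, m₂ (x, y) ∂cellVol d ∂cellVol d = 1 ∧
      StrictMono σ ∧
      TendstoUniformly (fun n => u (σ n)) u₀ atTop ∧
      WeakSobolev q (fun n => u (σ n)) u₀ g₀ ∧
      (∀ i, TwoScale q (fun n => ε (σ n)) (fun n x => gradient (u (σ n)) x i)
        (fun z => g₀ z.1 i + G₁ z i)) ∧
      TwoScale 1 (fun n => ε (σ n)) (fun n => m (σ n)) m₂ ∧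
      WeakLp 1 (fun n => m (σ n)) (fun x => ∫ y, m₂ (x, y) ∂cellVol d) ∧
      Tendsto (fun n => H (σ n)) atTop (𝓝 Hbar) := by
  obtain ⟨σ, u₀, Hbar, Wm, W, hσ, ⟨hper, hholder, hunif⟩, hH, hWm, hW⟩ :=
    SolvesMFG.exists_strictMono_limits hd (fun n => (hε n).ne') hε0 hsol hV
  have hu : ∀ n, SmoothPeriodic (u (σ n)) := fun n => (hsol (σ n)).smooth_u
  have hu₀ : WeakLp q (fun n => u (σ n)) u₀ :=
    weakLp_of_tendstoUniformly (fun n => (hu n).continuous) hunif q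
  obtain ⟨g₀, u₁, G₁, hsobolev, hu₁, hgrad⟩ := exists_twoScale_gradient (fun n => hε (σ n))
    (hε0.comp hσ.tendsto_atTop) hu
    (SolvesMFG.hasBoundedMoments_partialDeriv (fun n => hsol (σ n)) hV) hW hq1 hq hu₀
  obtain ⟨hdensity, hmass, hmarginal⟩ := SolvesMFG.twoScale_density (fun n => hsol (σ n)) hV hWm
  have hmean : ∫ x, u₀ x ∂cellVol d = 0 := by
    have hlim := hu₀.tendsto_integral hq1
    simp only [(hsol _).integral_u] at hlim
    exact tendsto_nhds_unique hlim tendsto_const_nhds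
  exact ⟨1 / 2, u₀, g₀, u₁, G₁, _, Hbar, σ, ⟨by norm_num, NNReal.half_lt_self one_ne_zero⟩, hper,
    hholder, hsobolev.memSobolev, hmean, hu₁, hdensity.memLp_lim, hmass, hσ, hunif, hsobolev,
    hgrad, hdensity, hmarginal, hH⟩

end TwoScaleMFG

end

theorem mainTheorem6 (d : ℕ) (hd : 0 < d) (P : Euc d)
    (V : Euc d × Euc d → ℝ) (hV : SmoothPeriodic₂ V)
    (ε : ℕ → ℝ) (hε : ∀ n, 0 < ε n) (hε0 : Tendsto ε atTop (𝓝 0))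
    (u m : ℕ → Euc d → ℝ) (H : ℕ → ℝ)
    (hsol : ∀ n, SolvesMFG V P (ε n) (u n) (m n) (H n))
    (q : ℝ≥0∞) (hq1 : 1 ≤ q) (hq : q ≠ ⊤) :
    ∃ (α : ℝ≥0) (u₀ : Euc d → ℝ) (g₀ : Euc d → Euc d)
      (u₁ : Euc d × Euc d → ℝ) (G₁ : Euc d × Euc d → Euc d)
      (m₂ : Euc d × Euc d → ℝ) (Hbar : ℝ) (σ : ℕ → ℕ),
      -- `α ∈ (0,1)`, `u₀ ∈ C^{0,α}(𝕋^d) ∩ W^{1,q}(𝕋^d)`, `∇u₀ = g₀`, `∫ u₀ = 0`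
      (0 < α ∧ α < 1) ∧
      IsPeriodic u₀ ∧ (∃ C : ℝ≥0, HolderWith C α u₀) ∧ MemSobolev q u₀ g₀ ∧
      ∫ x, u₀ x ∂cellVol d = 0 ∧
      -- `u₁ ∈ L^q(𝕋^d; W^{1,q}_#(𝒴^d)/ℝ)`, `∇_y u₁ = G₁`
      MemLpSobolevPer q u₁ G₁ ∧
      -- `m₂ ∈ L¹(𝕋^d × 𝒴^d)` has total integral one
      MemLp m₂ 1 ((cellVol d).prod (cellVol d)) ∧
      ∫ x, ∫ y, m₂ (x, y) ∂cellVol d ∂cellVol d = 1 ∧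
      -- the convergences, all along the same subsequence `σ`
      StrictMono σ ∧
      TendstoUniformly (fun n => u (σ n)) u₀ atTop ∧
      WeakSobolev q (fun n => u (σ n)) u₀ g₀ ∧
      (∀ i, TwoScale q (fun n => ε (σ n)) (fun n x => gradient (u (σ n)) x i)
        (fun z => g₀ z.1 i + G₁ z i)) ∧
      TwoScale 1 (fun n => ε (σ n)) (fun n => m (σ n)) m₂ ∧
      WeakLp 1 (fun n => m (σ n)) (fun x => ∫ y, m₂ (x, y) ∂cellVol d) ∧
      Tendsto (fun n => H (σ n)) atTop (𝓝 Hbar) := by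
  obtain ⟨M, hM⟩ := hV.exists_bound
  exact mainTheorem6_general hd P V hM ε hε hε0 u m H hsol q hq1 hq
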